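/- Let $L^+$ be a finite relational language with relation symbols $R_i$ ($i<p$) of arity $k_i$ (besides equality), and let $0<\alpha_i\le 1$ and $0<\gamma_i\le 1$ for $i<p$ be real numbers such that $1,\alpha_0,\dots,\alpha_{p-1}$ are linearly independent over $\mathbb{Q}$. An $L^+$-structure is called symmetric if each $R_i$ holds only of tuples of distinct elements and is invariant under permutations of the tuple, so that $R_i$ is a set of $k_i$-element subsets. *Random structures.* For a symmetric $L^+$-structure $N$ with universe $\{0,\dots,n-1\}$ put $$P_n(N)=\prod_{i<p}\ \prod_{C\in[N]^{k_i}} q_{i,n}(C),\qquad q_{i,n}(C)=\begin{cases}\gamma_i n^{-\alpha_i} & \text{if } R_i \text{ holds on } C,\\ 1-\gamma_i n^{-\alpha_i} & \text{otherwise,}\end{cases}$$ and for a sentence $\varphi$ let $P_n(\varphi)=\sum\{P_n(N): N\models\varphi\}$. Let $T^\alpha$, the almost sure theory, be the set of $L^+$-sentences $\varphi$ with $\lim_{n\to\infty}P_n(\varphi)=1$. *Generic structures.* For a finite symmetric $L^+$-structure $A$ let $w_i(A)$ be the number of $k_i$-element subsets of $A$ on which $R_i$ holds, and $\delta_\alpha(A)=|A|-\sum_{i<p}\alpha_i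 w_i(A)$. Let $K_\alpha$ be the class of finite symmetric $A$ with $\delta_\alpha(A')\ge 0$ for all substructures $A'$ of $A$. For a structure $N$ all of whose finite substructures are in $K_\alpha$ and a finite $X\subseteq N$ put $d_N(X)=\inf\{\delta_\alpha(B): X\subseteq B\subseteq N,\ B\text{ finite}\}$; for $M\subseteq N$ write $M\le_s N$ if $d_M(X)=d_N(X)$ for every finite $X\subseteq M$. A countable structure $M$ all of whose finite substructures are in $K_\alpha$ is $K_\alpha$-generic if (i) whenever $A$ is finite, $A\le_s M$ and $A\le_s B\in K_\alpha$, there is $B'\le_s M$ with $B'\cong_A B$; and (ii) $M$ is the union of a chain of finite substructures $A_0\le_s A_1\le_s A_2\le_s\cdots$. Then a $K_\alpha$-generic structure exists, and $T^\alpha$ equals the theory $T_\alpha$ of the $K_\alpha$-generic structure (that is, $T^\alpha$ is the complete first-order theory of every $K_\alpha$-generic structure). This theory is complete, stable (for some infinite cardinal $\kappa$ there are, for every finite $m$, at most $\kappa$ complete $m$-types over any set of at most $\kappa$ elements of a model) and nearly model complete (every formula is equivalent in it to a Boolean combination of existential formulas). It has the finite model property (each of its theorems has a finite model), it has only infinite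 models, and it is not finitely axiomatizable. -/

import Mathlib

open FirstOrder FirstOrder.Language

noncomputable section

namespace SparseRandom

/-- The finite relational language with relation symbols `R_i`, `i < p`, where `R_i` has
arity `k i` (equality is a logical symbol). -/
def lang {p : ℕ} (k : Fin p → ℕ) : FirstOrder.Language.{0, 0} where
  Functions _ := Empty
  Relations n := {i : Fin p // k i = n}

/-- The relation symbol `R_i`. -/
def sym {p : ℕ} (k : Fin p → ℕ) (i : Fin p) : (lang k).Relations (k i) := ⟨i, rfl⟩

section Dimension

variable {p : ℕ}

/-- Every relation is irreflexive (it holds only of tuples of distinct elements) and symmetric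
(it is invariant under permutations of the tuple). -/
def IsSymmetric (k : Fin p → ℕ) (M : Type) [(lang k).Structure M] : Prop :=
  ∀ (i : Fin p) (c : Fin (k i) → M), Structure.RelMap (sym k i) c →
    Function.Injective c ∧ ∀ σ : Equiv.Perm (Fin (k i)), Structure.RelMap (sym k i) (c ∘ σ)

/-- `w_i(A)`: the number of `k i`-element subsets of `A` on which `R_i` holds. -/
def edgeCount (k : Fin p → ℕ) {M : Type} [(lang k).Structure M] (i : Fin p) (A : Finset M) : ℕ :=
  Set.ncard {C : Finset M | C ⊆ A ∧ C.card = k i ∧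
    ∃ c : Fin (k i) → M, Set.range c = (C : Set M) ∧ Structure.RelMap (sym k i) c}

/-- `δ_α(A) = |A| - ∑_i α_i w_i(A)`, for the structure induced on a finite subset `A` of `M`. -/
def predim (k : Fin p → ℕ) (α : Fin p → ℝ) {M : Type} [(lang k).Structure M] (A : Finset M) : ℝ :=
  (A.card : ℝ) - ∑ i, α i * (edgeCount k i A : ℝ)

/-- `M` is a symmetric structure in which `δ_α` is nonnegative on all finite substructures. Finite
such `M` are the members of `K_α`; arbitrary such `M` are the structures all of whose finite
substructures belong to `K_α`. -/
def InClass (k : Fin p → ℕ) (α : Fin p → ℝ) (M : Type) [(lang k).Structure M] : Prop :=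
  IsSymmetric k M ∧ ∀ A : Finset M, 0 ≤ predim k α A

/-- `d_S(X) = inf {δ(B) : X ⊆ B ⊆ S, B finite}`, where the subset `S` of `M` carries the induced
structure. -/
def dimIn (k : Fin p → ℕ) (α : Fin p → ℝ) {M : Type} [(lang k).Structure M]
    (S : Set M) (X : Finset M) : ℝ :=
  sInf {r : ℝ | ∃ B : Finset M, X ⊆ B ∧ (B : Set M) ⊆ S ∧ predim k α B = r}

/-- `S ≤_s T` for the induced structures on subsets `S`, `T` of `M`. -/
def IsStrong (k : Fin p → ℕ) (α : Fin p → ℝ) {M : Type} [(lang k).Structure M]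
    (S T : Set M) : Prop :=
  S ⊆ T ∧ ∀ X : Finset M, (X : Set M) ⊆ S → dimIn k α S X = dimIn k α T X

/-- `M` is a `(K_α, ≤_s)`-generic structure. -/
structure IsGeneric (k : Fin p → ℕ) (α : Fin p → ℝ) (M : Type) [(lang k).Structure M] : Prop where
  countable : Countable M
  inClass : InClass k α M
  /-- If `A ≤_s M` is finite and `A ≤_s B ∈ K_α`, then `B` embeds strongly into `M` over `A`. -/
  extension : ∀ (A B : Type) [(lang k).Structure A] [(lang k).Structure B] [Finite A] [Finite B],
    InClass k α B → ∀ (f : A ↪[lang k] M) (g : A ↪[lang k] B),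
      IsStrong k α (Set.range f) Set.univ → IsStrong k α (Set.range g) Set.univ →
        ∃ h : B ↪[lang k] M, IsStrong k α (Set.range h) Set.univ ∧ ∀ a, h (g a) = f a
  /-- `M` is the union of a `≤_s`-chain of finite substructures. -/
  chain : ∃ A : ℕ → Finset M, (∀ n, IsStrong k α (A n : Set M) (A (n + 1) : Set M)) ∧
    ∀ x, ∃ n, x ∈ A n

end Dimension

section Random

variable {p : ℕ}

/-- The symmetric irreflexive structures with universe `Fin n`: for each `i < p`, the set of those
`k i`-element subsets on which `R_i` holds. -/
abbrev Config (k : Fin p → ℕ) (n : ℕ) : Type :=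
  (i : Fin p) → Finset {C : Finset (Fin n) // C.card = k i}

/-- The structure on `Fin n` given by a configuration: `R_i` holds of a tuple just if the tuple
enumerates, without repetition, one of the selected `k i`-element subsets. -/
@[reducible] def Config.toStructure {k : Fin p → ℕ} {n : ℕ} (G : Config k n) :
    (lang k).Structure (Fin n) where
  funMap f := f.elim
  RelMap r c := Function.Injective c ∧ ∃ C ∈ G r.1, (C.1 : Set (Fin n)) = Set.range c

/-- `P_n(N) = ∏_i ∏_C q_{i,n}(C)`, where `q_{i,n}(C)` is `γ_i n^{-α_i}` if `R_i` holds on `C`, and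
`1 - γ_i n^{-α_i}` otherwise. -/
def weight {k : Fin p → ℕ} (α γ : Fin p → ℝ) {n : ℕ} (G : Config k n) : ℝ :=
  ∏ i, ∏ C : {C : Finset (Fin n) // C.card = k i},
    if C ∈ G i then γ i * (n : ℝ) ^ (-α i) else 1 - γ i * (n : ℝ) ^ (-α i)

open Classical in
/-- The probability that a random structure of size `n` satisfies `φ`. -/
def prob {k : Fin p → ℕ} (α γ : Fin p → ℝ) (n : ℕ) (φ : (lang k).Sentence) : ℝ :=
  ∑ G : Config k n, if @Sentence.Realize (lang k) (Fin n) G.toStructure φ then weight α γ G else 0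

/-- `T^α`: the sentences with limit probability `1`. -/
def almostSureTheory (k : Fin p → ℕ) (α γ : Fin p → ℝ) : (lang k).Theory :=
  {φ | Filter.Tendsto (fun n => prob α γ n φ) Filter.atTop (nhds 1)}

end Random

section ModelTheory

variable {L : FirstOrder.Language.{0, 0}}

/-- Boolean combinations of existential (`Σ₁`) formulas. -/
inductive IsBoolCombExistential {β : Type} : L.Formula β → Prop
  | existential {φ : L.Formula β} (h : BoundedFormula.IsExistential φ) : IsBoolCombExistential φ
  | not {φ : L.Formula β} (h : IsBoolCombExistential φ) : IsBoolCombExistential φ.not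
  | and {φ ψ : L.Formula β} (h₁ : IsBoolCombExistential φ) (h₂ : IsBoolCombExistential ψ) :
      IsBoolCombExistential (φ ⊓ ψ)
  | or {φ ψ : L.Formula β} (h₁ : IsBoolCombExistential φ) (h₂ : IsBoolCombExistential ψ) :
      IsBoolCombExistential (φ ⊔ ψ)

/-- Every formula is equivalent in `T` to a Boolean combination of existential formulas in the same
free variables. -/
def NearlyModelComplete (T : L.Theory) : Prop :=
  ∀ (m : ℕ) (φ : L.Formula (Fin m)), ∃ ψ : L.Formula (Fin m),
    IsBoolCombExistential ψ ∧ T.Iff φ ψ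

/-- `T` is stable: for some infinite cardinal `κ`, there are at most `κ` complete `m`-types over any
set of at most `κ` parameters in a model of `T`, for every finite `m`. -/
def IsStable (T : L.Theory) : Prop :=
  ∃ κ : Cardinal.{0}, Cardinal.aleph0 ≤ κ ∧
    ∀ (M : Type) [L.Structure M] [Nonempty M], M ⊨ T →
      ∀ A : Set M, Cardinal.mk A ≤ κ → ∀ m : ℕ,
        Cardinal.mk ((L[[A]].completeTheory M).CompleteType (Fin m)) ≤ κ

/-- Every theorem of `T` has a finite model. -/
def FiniteModelProperty (T : L.Theory) : Prop :=
  ∀ φ : L.Sentence, T ⊨ᵇ φ →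
    ∃ (M : Type) (_ : L.Structure M), Nonempty M ∧ Finite M ∧ M ⊨ φ

/-- Some finite set of sentences has the same consequences as `T`. -/
def FinitelyAxiomatizable (T : L.Theory) : Prop :=
  ∃ S : L.Theory, S.Finite ∧ ∀ φ : L.Sentence, S ⊨ᵇ φ ↔ T ⊨ᵇ φ

end ModelTheory

end SparseRandom

end

/-! The proof isolates a first-order theory, the axioms of `Semigeneric` structures, and shows that
it is complete, that generic structures satisfy it, and that each of its axioms has limit
probability 1. The equality of the two theories follows from this.

Combinatorics. The predimension is submodular, and its values on sets of bounded size do not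
accumulate from below (`exists_gap`). Hence repeatedly adding a small set that lowers the
predimension must stop, and every finite set has a `t`-closure of bounded size (`exists_tClosed`).
Strength of a finite set means `t`-closedness for all `t`, and `t`-closedness for a fixed `t` is
first-order. The semigeneric axioms say that, for a strong extension `A ⊆ B` by at most `v` points,
every `(t + v)`-closed copy of `A` extends to a `t`-closed copy of `B`.

Model theory. A back-and-forth argument (`exists_forth`) shows that the truth of a formula depends
only on a finite `t`-closed set around its parameters (`exists_realize_iff`). With no parameters
this is completeness. Minimal `t`-closures have bounded size and are recognized by existential
formulas (`exists_commonClosed`), which gives near model completeness. For stability, parameters are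
enlarged to an elementary submodel `S`; over `S` the closure of a tuple adds countably many points
lying on countably many edges outside `S`, so a type over `S` amounts to countable data
(`HasData.realize_iff`).

Existence. Strong extensions amalgamate freely (`exists_strong_amalgam`). A generic structure is the
limit of finite stages meeting countably many extension tasks, and free amalgamation over a member
of its chain shows that it is semigeneric.

Probability. A set of size at most `s` with predimension at most `D` occurs `O(n ^ D)` times on
average, so negative predimension almost surely does not occur. For a strong extension `A ⊆ B`,
linear independence over `ℚ` makes all proper intermediate steps strictly increase the predimension.
A second moment estimate, repeated on independent blocks of vertices, then shows that almost surely
every copy of `A` has at least `c * n ^ (δ(B) - δ(A))` weak extensions to `B`. If none of them were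
`t`-closed, then `K`-tuples of them would produce more sets of small predimension than the first
moment allows (`card_weakExts_pow_le`).

The finite model property holds because sentences of positive probability have finite models;
together with the infinitude of all models it excludes a finite axiomatization. -/

noncomputable section

namespace SparseRandom

/-! ### Edges, predimension and submodularity. -/

section Basics

variable {p : ℕ} {k : Fin p → ℕ} {α : Fin p → ℝ}
  {M N : Type} [(lang k).Structure M] [(lang k).Structure N]

/-- The `k i`-element sets on which `R_i` holds. -/
def edges (k : Fin p → ℕ) (M : Type) [(lang k).Structure M] (i : Fin p) : Set (Finset M) :=
  {C | C.card = k i ∧ ∃ c : Fin (k i) → M, Set.range c = (C : Set M) ∧ Structure.RelMap (sym k i) c}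

open Classical in
/-- The edges contained in a finite set. -/
def edgesIn (k : Fin p → ℕ) {M : Type} [(lang k).Structure M] (i : Fin p) (A : Finset M) :
    Finset (Finset M) :=
  A.powerset.filter (· ∈ edges k M i)

theorem mem_edgesIn {i : Fin p} {A C : Finset M} :
    C ∈ edgesIn k i A ↔ C ⊆ A ∧ C ∈ edges k M i := by
  simp [edgesIn]

theorem edgeCount_eq_card (i : Fin p) (A : Finset M) :
    edgeCount k i A = (edgesIn k i A).card := by
  rw [edgeCount, ← Set.ncard_coe_finset]
  congr 1
  ext C
  simp [mem_edgesIn, edges]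

theorem edgeCount_mono (i : Fin p) {A B : Finset M} (h : A ⊆ B) :
    edgeCount k i A ≤ edgeCount k i B := by
  simp only [edgeCount_eq_card]
  refine Finset.card_le_card fun C hC => ?_
  rw [mem_edgesIn] at hC ⊢
  exact ⟨hC.1.trans h, hC.2⟩

/-- An edge inside `A` or `B` is inside the union, and an edge inside both is inside the
intersection; edges crossing between `A` and `B` only increase the right-hand side. -/
theorem edgeCount_supermodular [DecidableEq M] (i : Fin p) (A B : Finset M) :
    edgeCount k i A + edgeCount k i B ≤ edgeCount k i (A ∪ B) + edgeCount k i (A ∩ B) := by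
  simp only [edgeCount_eq_card]
  rw [← Finset.card_union_add_card_inter]
  refine add_le_add (Finset.card_le_card fun C hC => ?_) (Finset.card_le_card fun C hC => ?_)
  · simp only [Finset.mem_union, mem_edgesIn] at hC ⊢
    rcases hC with hC | hC
    · exact ⟨hC.1.trans Finset.subset_union_left, hC.2⟩
    · exact ⟨hC.1.trans Finset.subset_union_right, hC.2⟩
  · simp only [Finset.mem_inter, mem_edgesIn] at hC ⊢
    exact ⟨Finset.subset_inter hC.1.1 hC.2.1, hC.1.2⟩

theorem predim_submodular [DecidableEq M] (hα : ∀ i, 0 < α i) (A B : Finset M) :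
    predim k α (A ∪ B) + predim k α (A ∩ B) ≤ predim k α A + predim k α B := by
  have h1 : ((A ∪ B).card : ℝ) + (A ∩ B).card = A.card + B.card := by
    exact_mod_cast Finset.card_union_add_card_inter A B
  have h2 : ∑ i, α i * (edgeCount k i A : ℝ) + ∑ i, α i * (edgeCount k i B : ℝ) ≤
      ∑ i, α i * (edgeCount k i (A ∪ B) : ℝ) + ∑ i, α i * (edgeCount k i (A ∩ B) : ℝ) := by
    rw [← Finset.sum_add_distrib, ← Finset.sum_add_distrib]
    refine Finset.sum_le_sum fun i _ => ?_
    rw [← mul_add, ← mul_add]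
    refine mul_le_mul_of_nonneg_left ?_ (hα i).le
    exact_mod_cast edgeCount_supermodular i A B
  unfold predim
  linarith

theorem predim_le_card (hα : ∀ i, 0 < α i) (A : Finset M) : predim k α A ≤ A.card := by
  unfold predim
  have : 0 ≤ ∑ i, α i * (edgeCount k i A : ℝ) :=
    Finset.sum_nonneg fun i _ => mul_nonneg (hα i).le (Nat.cast_nonneg _)
  linarith

/-- A relation of a symmetric structure is determined by its edges. -/
theorem IsSymmetric.relMap_iff (hM : IsSymmetric k M) [DecidableEq M] (i : Fin p)
    (c : Fin (k i) → M) : Structure.RelMap (sym k i) c ↔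
      Function.Injective c ∧ Finset.univ.image c ∈ edges k M i := by
  constructor
  · intro h
    have hc := (hM i c h).1
    refine ⟨hc, ?_, c, by simp, h⟩
    rw [Finset.card_image_of_injective _ hc, Finset.card_univ, Fintype.card_fin]
  · rintro ⟨hc, -, c', hr, hrel⟩
    have hc' := (hM i c' hrel).1
    have hr' : Set.range c' = Set.range c := by simpa using hr
    -- Two injective enumerations of the same set differ by a permutation of the indices, and
    -- symmetry absorbs it.
    let σ : Equiv.Perm (Fin (k i)) :=
      (Equiv.ofInjective c hc).trans ((Equiv.setCongr hr'.symm).trans (Equiv.ofInjective c' hc').symm)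
    have hσ : c' ∘ σ = c := by
      ext x
      have : (Equiv.ofInjective c' hc') (σ x) = ⟨c x, hr' ▸ Set.mem_range_self x⟩ := by
        simp [σ, Equiv.ofInjective_apply]
      exact congrArg Subtype.val this
    rw [← hσ]
    exact (hM i c' hrel).2 σ

/-- An embedding from a relation-preserving and relation-reflecting injection. -/
def embOfRel (f : M → N) (hf : Function.Injective f)
    (h : ∀ i (c : Fin (k i) → M), Structure.RelMap (sym k i) (f ∘ c) ↔ Structure.RelMap (sym k i) c) :
    M ↪[lang k] N where
  toFun := f
  inj' := hf
  map_fun' g := g.elim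
  map_rel' r x := by
    obtain ⟨i, rfl⟩ := r
    exact h i x

theorem emb_relMap (e : M ↪[lang k] N) (i : Fin p) (c : Fin (k i) → M) :
    Structure.RelMap (sym k i) (e ∘ c) ↔ Structure.RelMap (sym k i) c :=
  e.map_rel (sym k i) c

theorem map_mem_edges (e : M ↪[lang k] N) (i : Fin p) (C : Finset M) :
    C.map e.toEmbedding ∈ edges k N i ↔ C ∈ edges k M i := by
  simp only [edges, Set.mem_ofPred_eq, Finset.card_map, and_congr_right_iff]
  intro _
  constructor
  · rintro ⟨c, hc, h⟩
    have : ∀ x, ∃ y, e y = c x := by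
      intro x
      have : c x ∈ ((C.map e.toEmbedding : Finset N) : Set N) := hc ▸ Set.mem_range_self x
      simp only [Finset.coe_map, Set.mem_image] at this
      obtain ⟨y, -, hy⟩ := this
      exact ⟨y, hy⟩
    choose c' hc' using this
    have hcc : e ∘ c' = c := funext hc'
    refine ⟨c', ?_, (emb_relMap e i c').1 (hcc ▸ h)⟩
    apply Set.image_injective.2 e.injective
    rw [← Set.range_comp, hcc, hc, Finset.coe_map]
    rfl
  · rintro ⟨c, hc, h⟩
    refine ⟨e ∘ c, ?_, (emb_relMap e i c).2 h⟩
    rw [Set.range_comp, hc, Finset.coe_map]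
    rfl

/-- For symmetric structures, embeddings are the edge-preserving and edge-reflecting injections. -/
def embOfEdges (hM : IsSymmetric k M) (hN : IsSymmetric k N) (f : M ↪ N)
    (h : ∀ i (C : Finset M), C.map f ∈ edges k N i ↔ C ∈ edges k M i) : M ↪[lang k] N :=
  embOfRel f f.injective (by
    classical
    intro i c
    rw [hM.relMap_iff, hN.relMap_iff, f.injective.of_comp_iff, ← h i, Finset.map_eq_image,
      Finset.image_image])

theorem edgeCount_map (e : M ↪[lang k] N) (i : Fin p) (A : Finset M) :
    edgeCount k i (A.map e.toEmbedding) = edgeCount k i A := by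
  simp only [edgeCount_eq_card]
  symm
  refine Finset.card_bij (fun C _ => C.map e.toEmbedding) ?_ ?_ ?_
  · intro C hC
    rw [mem_edgesIn] at hC ⊢
    exact ⟨Finset.map_subset_map.2 hC.1, (map_mem_edges e i C).2 hC.2⟩
  · intro C _ D _ h
    exact Finset.map_injective _ h
  · intro D hD
    rw [mem_edgesIn, Finset.subset_map_iff] at hD
    obtain ⟨⟨C, hC, rfl⟩, hD⟩ := hD
    exact ⟨C, mem_edgesIn.2 ⟨hC, (map_mem_edges e i C).1 hD⟩, rfl⟩

theorem predim_map (e : M ↪[lang k] N) (A : Finset M) :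
    predim k α (A.map e.toEmbedding) = predim k α A := by
  simp [predim, edgeCount_map]

theorem IsSymmetric.of_embedding (hN : IsSymmetric k N) (e : M ↪[lang k] N) : IsSymmetric k M := by
  intro i c h
  have := hN i (e ∘ c) ((emb_relMap e i c).2 h)
  refine ⟨this.1.of_comp, fun σ => ?_⟩
  rw [← emb_relMap e]
  exact this.2 σ

theorem InClass.of_embedding (hN : InClass k α N) (e : M ↪[lang k] N) : InClass k α M :=
  ⟨hN.1.of_embedding e, fun A => predim_map (α := α) e A ▸ hN.2 _⟩

/-- Every subset is the universe of a substructure. -/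
def sub (k : Fin p → ℕ) {M : Type} [(lang k).Structure M] (S : Set M) :
    (lang k).Substructure M where
  carrier := S
  fun_mem f := f.elim

end Basics

/-! ### Closed sets and bounded closures. -/

section Closed

variable {p : ℕ} {k : Fin p → ℕ} {α : Fin p → ℝ}
  {M N : Type} [(lang k).Structure M] [(lang k).Structure N]

/-- No finite set with at most `t` elements outside `S` has smaller predimension than its trace
on `S`. -/
def TClosed (k : Fin p → ℕ) (α : Fin p → ℝ) {M : Type} [(lang k).Structure M] (t : ℕ)
    (S : Set M) : Prop :=
  ∀ X Y : Finset M, (X : Set M) = ↑Y ∩ S → Y.card ≤ X.card + t → predim k α X ≤ predim k α Y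

theorem TClosed.mono {t u : ℕ} (h : t ≤ u) {S : Set M} (hS : TClosed k α u S) : TClosed k α t S :=
  fun X Y hXY hc => hS X Y hXY (by omega)

theorem TClosed.predim_le [DecidableEq M] {t : ℕ} {S : Set M} (hS : TClosed k α t S) {X Y : Finset M}
    (hX : ∀ x, x ∈ X ↔ x ∈ Y ∧ x ∈ S) (h : Y.card ≤ X.card + t) : predim k α X ≤ predim k α Y :=
  hS X Y (by ext x; simp [hX]) h

/-- For a finite set, it suffices to consider its finite supersets. -/
theorem tClosed_coe_iff [DecidableEq M] (hα : ∀ i, 0 < α i) {t : ℕ} {A : Finset M} :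
    TClosed k α t (A : Set M) ↔
      ∀ F : Finset M, F.card ≤ t → predim k α A ≤ predim k α (A ∪ F) := by
  constructor
  · intro h F hF
    refine h.predim_le (by simp; tauto) ((Finset.card_union_le _ _).trans (by omega))
  · intro h X Y hXY hc
    have hX : X = A ∩ Y := by
      rw [← Finset.coe_inj, hXY, Finset.coe_inter, Set.inter_comm]
    have h1 := predim_submodular (k := k) hα A Y
    have h2 := h (Y \ A) (by
      have := Finset.card_sdiff_add_card_inter Y A
      rw [Finset.inter_comm, ← hX] at this
      omega)
    rw [Finset.union_sdiff_self_eq_union] at h2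
    rw [hX]
    linarith

/-- `t`-closedness is transitive. -/
theorem TClosed.trans_range {t : ℕ} (e : M ↪[lang k] N) (he : TClosed k α t (Set.range e))
    {S : Set M} (hS : TClosed k α t S) : TClosed k α t (e '' S) := by
  classical
  intro X Y hXY hc
  -- Passing from `Y` to its part in the range of `e`, and from there to its part in `e '' S`, drops
  -- at most `t` points each time. Closedness in `N` bounds the first change and closedness in `M`
  -- the second.
  let Z : Finset M := Y.preimage e e.injective.injOn
  let W : Finset M := X.preimage e e.injective.injOn
  have hZ : (Z.map e.toEmbedding : Finset N) = Y.filter (· ∈ Set.range e) := by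
    ext y
    simp only [Finset.mem_map, Z, Finset.mem_preimage, Finset.mem_filter, Set.mem_range]
    constructor
    · rintro ⟨x, hx, rfl⟩; exact ⟨hx, x, rfl⟩
    · rintro ⟨hy, x, rfl⟩; exact ⟨x, hy, rfl⟩
  have hW : W.map e.toEmbedding = X := by
    ext y
    have : y ∈ X ↔ y ∈ (X : Set N) := Iff.rfl
    simp only [Finset.mem_map, W, Finset.mem_preimage]
    constructor
    · rintro ⟨x, hx, rfl⟩; exact hx
    · intro hy
      have hy' := hy
      rw [this, hXY] at hy
      obtain ⟨_, x, _, rfl⟩ := hy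
      exact ⟨x, hy', rfl⟩
  have hWZ : (W : Set M) = ↑Z ∩ S := by
    ext x
    have : e x ∈ X ↔ e x ∈ (X : Set N) := Iff.rfl
    simp only [W, Z, Finset.coe_preimage, Set.mem_preimage, Set.mem_inter_iff]
    rw [Finset.mem_coe, this, hXY, Set.mem_inter_iff, e.injective.mem_set_image]
  have c1 : Z.card ≤ Y.card := by
    rw [← Finset.card_map e.toEmbedding, hZ]; exact Finset.card_filter_le _ _
  have c2 : W.card = X.card := by rw [← hW, Finset.card_map]
  have c3 : W.card ≤ Z.card := Finset.card_le_card (by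
    rw [← Finset.coe_subset, hWZ]; exact Set.inter_subset_left)
  have h1 := hS W Z hWZ (by omega)
  have h2 := he (Z.map e.toEmbedding) Y (by rw [hZ]; ext; simp) (by rw [Finset.card_map]; omega)
  rw [predim_map] at h2
  rw [← hW, predim_map]
  exact h1.trans h2

theorem TClosed.preimage {t : ℕ} (e : M ↪[lang k] N) {S : Set N} (hS : TClosed k α t S) :
    TClosed k α t (e ⁻¹' S) := by
  intro X Y hXY hc
  have := hS (X.map e.toEmbedding) (Y.map e.toEmbedding) (by
    rw [Finset.coe_map, hXY]
    ext y
    simp only [Set.mem_image, Set.mem_inter_iff, Finset.coe_map, Set.mem_preimage]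
    constructor
    · rintro ⟨x, ⟨h1, h2⟩, rfl⟩; exact ⟨⟨x, h1, rfl⟩, h2⟩
    · rintro ⟨⟨x, h1, rfl⟩, h2⟩; exact ⟨x, ⟨h1, h2⟩, rfl⟩) (by simpa using hc)
  simpa only [predim_map] using this

theorem tClosed_univ (t : ℕ) : TClosed k α t (Set.univ : Set M) := by
  intro X Y h _
  rw [Set.inter_univ, Finset.coe_inj] at h
  rw [h]

/-- Values of the predimension on sets of bounded size do not accumulate from below. -/
theorem exists_gap (hα : ∀ i, 0 < α i) (t : ℕ) (D : ℝ) : ∃ ε : ℝ, 0 < ε ∧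
    ∀ z : ℕ, z ≤ t → ∀ w : Fin p → ℕ, (z : ℝ) - ∑ i, α i * (w i : ℝ) < D →
      (z : ℝ) - ∑ i, α i * (w i : ℝ) ≤ D - ε := by
  classical
  -- A value above `D - 1` with `z ≤ t` forces `α i * w i < t + 1 - D`, so only finitely many pairs
  -- `(z, w)` give values between `D - 1` and `D`. The lower values are covered by taking `min ε 1`
  -- below.
  let bd : Fin p → ℕ := fun i => ⌈((t : ℝ) + 1 - D) / α i⌉₊ + 1
  let F : Finset ℝ := ((Finset.range (t + 1) ×ˢ Fintype.piFinset fun i => Finset.range (bd i)).image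
    fun q : ℕ × (Fin p → ℕ) => D - ((q.1 : ℝ) - ∑ i, α i * (q.2 i : ℝ))).filter (0 < ·)
  have hF : ∃ ε : ℝ, 0 < ε ∧ ∀ x ∈ F, ε ≤ x := by
    rcases F.eq_empty_or_nonempty with h | h
    · exact ⟨1, one_pos, by simp [h]⟩
    · exact ⟨F.min' h, (Finset.mem_filter.1 (F.min'_mem h)).2, fun x hx => F.min'_le x hx⟩
  obtain ⟨ε, hε, hεF⟩ := hF
  refine ⟨min ε 1, lt_min hε one_pos, fun z hz w hw => ?_⟩
  by_cases h1 : (z : ℝ) - ∑ i, α i * (w i : ℝ) ≤ D - 1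
  · have := min_le_right ε 1
    linarith
  · push Not at h1
    have hmem : D - ((z : ℝ) - ∑ i, α i * (w i : ℝ)) ∈ F := by
      refine Finset.mem_filter.2 ⟨Finset.mem_image.2 ⟨(z, w), ?_, rfl⟩, by linarith⟩
      refine Finset.mem_product.2 ⟨Finset.mem_range.2 (by simpa using Nat.lt_succ_of_le hz),
        Fintype.mem_piFinset.2 fun i => Finset.mem_range.2 ?_⟩
      have hz' : (z : ℝ) ≤ t := by exact_mod_cast hz
      have h2 : α i * (w i : ℝ) ≤ ∑ i, α i * (w i : ℝ) :=
        Finset.single_le_sum (f := fun i => α i * (w i : ℝ))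
          (fun j _ => mul_nonneg (hα j).le (Nat.cast_nonneg _)) (Finset.mem_univ i)
      have h3 : (w i : ℝ) ≤ ((t : ℝ) + 1 - D) / α i := by
        rw [le_div_iff₀ (hα i)]
        linarith
      have h4 : (w i : ℝ) ≤ (⌈((t : ℝ) + 1 - D) / α i⌉₊ : ℝ) := h3.trans (Nat.le_ceil _)
      have h5 : w i ≤ ⌈((t : ℝ) + 1 - D) / α i⌉₊ := by exact_mod_cast h4
      exact Nat.lt_succ_of_le h5
    have := hεF _ hmem
    have := min_le_left ε 1
    linarith

theorem exists_predim_gap (hα : ∀ i, 0 < α i) (t : ℕ) (D : ℝ) : ∃ ε : ℝ, 0 < ε ∧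
    ∀ (M : Type) [(lang k).Structure M] (A : Finset M), A.card ≤ t → predim k α A < D →
      predim k α A ≤ D - ε := by
  obtain ⟨ε, hε, h⟩ := exists_gap hα t D
  exact ⟨ε, hε, fun M _ A hA h' => h _ hA _ h'⟩

/-- The difference of the predimensions is again of the form `z - ∑ i, α i * w i` with `z ≤ t`, so
the size of `X` plays no role. This is what makes closures bounded over infinite sets as well. -/
theorem exists_relative_gap (hα : ∀ i, 0 < α i) (t : ℕ) : ∃ ε : ℝ, 0 < ε ∧
    ∀ (M : Type) [(lang k).Structure M] (X Y : Finset M), X ⊆ Y → Y.card ≤ X.card + t →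
      predim k α Y < predim k α X → predim k α Y ≤ predim k α X - ε := by
  obtain ⟨ε, hε, h⟩ := exists_gap hα t 0
  refine ⟨ε, hε, fun M _ X Y hXY hc hlt => ?_⟩
  have hcard := Finset.card_le_card hXY
  have := h (Y.card - X.card) (by omega) (fun i => edgeCount k i Y - edgeCount k i X)
  have e : ((Y.card - X.card : ℕ) : ℝ) -
      ∑ i, α i * ((edgeCount k i Y - edgeCount k i X : ℕ) : ℝ) = predim k α Y - predim k α X := by
    unfold predim
    rw [Nat.cast_sub hcard]
    simp_rw [Nat.cast_sub (edgeCount_mono _ hXY), mul_sub]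
    rw [Finset.sum_sub_distrib]
    ring
  rw [e] at this
  have := this (by linarith)
  linarith

/-- Over a closed set, every finite set has a finite `t`-closure of bounded size. -/
theorem exists_tClosed_union (hα : ∀ i, 0 < α i) (t s : ℕ) : ∃ b : ℕ,
    ∀ (M : Type) [(lang k).Structure M] (S : Set M), (∀ u, TClosed k α u S) →
      ∀ F : Finset M, F.card ≤ s → ∃ F' : Finset M, F ⊆ F' ∧ TClosed k α t (S ∪ ↑F') ∧
        {x | x ∈ F' ∧ x ∉ S}.ncard ≤ b := by
  classical
  obtain ⟨ε, hε, hgap⟩ := exists_relative_gap (k := k) hα t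
  -- The predimension relative to the trace on `S` starts at most at `s`, never becomes negative
  -- since `S` is closed, and drops by `ε` with each enlargement. So fewer than `q` enlargements
  -- occur, each adding at most `t` points outside `S`.
  obtain ⟨q, hq⟩ := exists_nat_gt ((s : ℝ) / ε)
  rw [div_lt_iff₀ hε] at hq
  refine ⟨s + q * t, fun M _ S hS F hF => ?_⟩
  let tr : Finset M → Finset M := fun Y => Y.filter (· ∈ S)
  have htr : ∀ Y, predim k α (tr Y) ≤ predim k α Y := fun Y =>
    hS Y.card (tr Y) Y (by ext; simp [tr]) (by omega)
  have main : ∀ (q : ℕ) (Y : Finset M), predim k α Y - predim k α (tr Y) < q * ε →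
      ∃ F' : Finset M, Y ⊆ F' ∧ TClosed k α t (S ∪ ↑F') ∧
        (F'.filter (· ∉ S)).card ≤ (Y.filter (· ∉ S)).card + q * t := by
    intro q
    induction q with
    | zero =>
      intro Y hY
      have := htr Y
      simp at hY
      linarith
    | succ q ih =>
      intro Y hY
      by_cases hcl : TClosed k α t (S ∪ ↑Y)
      · exact ⟨Y, subset_rfl, hcl, by omega⟩
      · unfold TClosed at hcl
        push Not at hcl
        obtain ⟨X', Y', hXY, hc, hlt⟩ := hcl
        have hX' : ∀ x, x ∈ X' ↔ x ∈ Y' ∧ (x ∈ S ∨ x ∈ Y) := by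
          intro x
          have : x ∈ X' ↔ x ∈ (X' : Set M) := Iff.rfl
          rw [this, hXY]; simp
        have hsub : X' ⊆ Y' := fun x hx => ((hX' x).1 hx).1
        have hdrop := hgap M X' Y' hsub hc hlt
        -- The part `X'` may bring in further elements of `S`. By submodularity, adding them does
        -- not raise the predimension relative to the trace (`s1`), and adding the rest of `Y'` then
        -- lowers it by `ε` (`s2`).
        let Z := Y ∪ X'
        have hYtr : tr Z ∪ Y = Z := by
          ext x; simp only [tr, Z, Finset.mem_union, Finset.mem_filter, hX']; tauto
        have hYtr' : tr Z ∩ Y = tr Y := by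
          ext x; simp only [tr, Z, Finset.mem_union, Finset.mem_filter, Finset.mem_inter, hX']; tauto
        have s1 := predim_submodular (k := k) hα (tr Z) Y
        rw [hYtr, hYtr'] at s1
        have hU : Z ∪ Y' = Y ∪ Y' := by
          ext x; simp only [Z, Finset.mem_union, hX']; tauto
        have hI : Z ∩ Y' = X' := by
          ext x; simp only [Z, Finset.mem_union, Finset.mem_inter, hX']; tauto
        have s2 := predim_submodular (k := k) hα Z Y'
        rw [hU, hI] at s2
        have htrU : tr (Y ∪ Y') = tr Z := by
          ext x; simp only [tr, Z, Finset.mem_union, Finset.mem_filter, hX']; tauto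
        obtain ⟨F', h1, h2, h3⟩ := ih (Y ∪ Y') (by
          rw [htrU]; push_cast at hY; linarith)
        refine ⟨F', Finset.subset_union_left.trans h1, h2, h3.trans ?_⟩
        have hsub2 : (Y ∪ Y').filter (· ∉ S) ⊆ Y.filter (· ∉ S) ∪ (Y' \ X') := by
          intro x
          simp only [Finset.mem_filter, Finset.mem_union, Finset.mem_sdiff, hX']
          tauto
        have h4 := (Finset.card_le_card hsub2).trans (Finset.card_union_le _ _)
        have h5 := Finset.card_sdiff_add_card_eq_card hsub
        have : (q + 1) * t = q * t + t := by ring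
        omega
  have h0 : ∀ X : Finset M, (X : Set M) ⊆ S → 0 ≤ predim k α X - predim k α (tr X) := by
    intro X hX
    have : tr X = X := Finset.filter_true_of_mem fun x hx => hX hx
    rw [this]; simp
  have hstart : predim k α F - predim k α (tr F) ≤ s := by
    have hsplit : tr F ∪ F.filter (· ∉ S) = F := Finset.filter_union_filter_not_eq _ _
    have hempty : tr F ∩ F.filter (· ∉ S) = ∅ := by
      ext x; simp [tr]; tauto
    have s1 := predim_submodular (k := k) hα (tr F) (F.filter (· ∉ S))
    rw [hsplit, hempty] at s1
    have s2 := predim_le_card (k := k) hα (F.filter (· ∉ S))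
    have s3 : ((F.filter (· ∉ S)).card : ℝ) ≤ s := by
      exact_mod_cast (Finset.card_filter_le _ _).trans hF
    have s4 : predim k α (F.filter (· ∉ S)) ≤ s + predim k α (∅ : Finset M) := by
      have : ∀ i, edgeCount k i (∅ : Finset M) ≤ edgeCount k i (F.filter (· ∉ S)) := fun i =>
        edgeCount_mono i (Finset.empty_subset _)
      have h6 : ∑ i, α i * (edgeCount k i (∅ : Finset M) : ℝ) ≤
          ∑ i, α i * (edgeCount k i (F.filter (· ∉ S)) : ℝ) :=
        Finset.sum_le_sum fun i _ => mul_le_mul_of_nonneg_left (by exact_mod_cast this i) (hα i).le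
      unfold predim
      simp only [Finset.card_empty, Nat.cast_zero]
      linarith
    linarith
  obtain ⟨F', h1, h2, h3⟩ := main q F (hstart.trans_lt hq)
  refine ⟨F', h1, h2, ?_⟩
  have : {x | x ∈ F' ∧ x ∉ S} = ((F'.filter (· ∉ S) : Finset M) : Set M) := by ext; simp
  rw [this, Set.ncard_coe_finset]
  have h4 : (F.filter (· ∉ S)).card ≤ s := (Finset.card_filter_le _ _).trans hF
  omega

theorem InClass.predim_empty (hα : ∀ i, 0 < α i) (hM : InClass k α M) :
    predim k α (∅ : Finset M) = 0 :=
  le_antisymm (by simpa using predim_le_card (k := k) hα (∅ : Finset M)) (hM.2 _)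

theorem InClass.tClosed_empty (hα : ∀ i, 0 < α i) (hM : InClass k α M) (t : ℕ) :
    TClosed k α t (∅ : Set M) := by
  intro X Y h _
  rw [Set.inter_empty, Finset.coe_eq_empty] at h
  rw [h, hM.predim_empty hα]
  exact hM.2 _

/-- In structures of the class, finite sets have finite `t`-closures of bounded size. -/
theorem exists_tClosed (hα : ∀ i, 0 < α i) (t s : ℕ) : ∃ b : ℕ,
    ∀ (M : Type) [(lang k).Structure M], InClass k α M → ∀ F : Finset M, F.card ≤ s →
      ∃ F' : Finset M, F ⊆ F' ∧ TClosed k α t (F' : Set M) ∧ F'.card ≤ b := by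
  obtain ⟨b, hb⟩ := exists_tClosed_union (k := k) hα t s
  refine ⟨b, fun M _ hM F hF => ?_⟩
  obtain ⟨F', h1, h2, h3⟩ := hb M ∅ (hM.tClosed_empty hα) F hF
  refine ⟨F', h1, by simpa using h2, ?_⟩
  simpa [Set.ncard_coe_finset] using h3

end Closed

/-! ### Strength of finite sets in terms of the predimension. -/

section Strong

variable {p : ℕ} {k : Fin p → ℕ} {α : Fin p → ℝ}
  {M N : Type} [(lang k).Structure M] [(lang k).Structure N]

/-- `A ≤_s B` for finite `A ⊆ B`, in terms of the predimension. -/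
theorem isStrong_iff (hα : ∀ i, 0 < α i) (hM : InClass k α M) {A : Finset M} {T : Set M} :
    IsStrong k α (A : Set M) T ↔ (A : Set M) ⊆ T ∧
      ∀ X Y : Finset M, (X : Set M) = (Y : Set M) ∩ (A : Set M) → (Y : Set M) ⊆ T →
        predim k α X ≤ predim k α Y := by
  classical
  have hbdd : ∀ (S : Set M) (X : Finset M),
      BddBelow {r : ℝ | ∃ B : Finset M, X ⊆ B ∧ (B : Set M) ⊆ S ∧ predim k α B = r} := by
    rintro S X
    refine ⟨0, ?_⟩
    rintro _ ⟨B, -, -, rfl⟩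
    exact hM.2 B
  refine and_congr_right fun hAT => ⟨fun h X Y hXY hY => ?_, fun h X hX => ?_⟩
  · have h1 := h A subset_rfl
    have h2 : predim k α A ≤ dimIn k α (A : Set M) A := by
      refine le_csInf ⟨_, A, subset_rfl, subset_rfl, rfl⟩ ?_
      rintro _ ⟨B, hB1, hB2, rfl⟩
      rw [Finset.Subset.antisymm hB1 (by exact_mod_cast hB2)]
    have h3 : dimIn k α T A ≤ predim k α (A ∪ Y) :=
      csInf_le (hbdd _ _) ⟨A ∪ Y, Finset.subset_union_left, by simp [hAT, hY], rfl⟩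
    have h4 := predim_submodular (k := k) hα A Y
    have h5 : X = A ∩ Y := by
      rw [← Finset.coe_inj, hXY, Finset.coe_inter, Set.inter_comm]
    rw [h5]
    linarith
  · refine le_antisymm ?_ ?_
    · refine le_csInf ⟨_, X, subset_rfl, hX.trans hAT, rfl⟩ ?_
      rintro _ ⟨B, hB1, hB2, rfl⟩
      refine (csInf_le (hbdd _ _) ⟨B ∩ A, ?_, ?_, rfl⟩).trans (h (B ∩ A) B (by simp) hB2)
      · exact Finset.subset_inter hB1 (by exact_mod_cast hX)
      · simp
    · refine csInf_le_csInf (hbdd _ _) ⟨_, X, subset_rfl, hX, rfl⟩ ?_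
      rintro _ ⟨B, hB1, hB2, rfl⟩
      exact ⟨B, hB1, hB2.trans hAT, rfl⟩

/-- Strength is thereby the conjunction of its finite approximations, each of which can be expressed
by a formula about a finite tuple. -/
theorem isStrong_univ_iff (hα : ∀ i, 0 < α i) (hM : InClass k α M) {S : Set M} (hS : S.Finite) :
    IsStrong k α S Set.univ ↔ ∀ t, TClosed k α t S := by
  lift S to Finset M using hS
  rw [isStrong_iff hα hM]
  constructor
  · rintro ⟨-, h⟩ t X Y hXY -
    exact h X Y hXY (Set.subset_univ _)
  · intro h
    exact ⟨Set.subset_univ _, fun X Y hXY _ => h Y.card X Y hXY (by omega)⟩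

end Strong

/-! ### Back-and-forth between semigeneric structures. -/

section Semigeneric

variable {p : ℕ} {k : Fin p → ℕ} {α : Fin p → ℝ}
  {M N : Type} [(lang k).Structure M] [(lang k).Structure N]

/-- Semigeneric structures: strong extensions of sufficiently closed finite substructures are
realized by `t`-closed substructures. -/
structure Semigeneric (k : Fin p → ℕ) (α : Fin p → ℝ) (M : Type) [(lang k).Structure M] :
    Prop where
  inClass : InClass k α M
  extension : ∀ (t u v : ℕ) (A B : Type) [(lang k).Structure A] [(lang k).Structure B]
    [Finite A] [Finite B], InClass k α B → ∀ (f : A ↪[lang k] M) (g : A ↪[lang k] B),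
      (∀ t, TClosed k α t (Set.range g)) → Nat.card B ≤ Nat.card A + v → t + v ≤ u →
        TClosed k α u (Set.range f) →
          ∃ h : B ↪[lang k] M, TClosed k α t (Set.range h) ∧ ∀ a, h (g a) = f a

/-- A finite structure with `t`-closed embeddings into `M` and `N` which relate the pairs in `R`. -/
def CommonClosed (k : Fin p → ℕ) (α : Fin p → ℝ) {M N : Type} [(lang k).Structure M]
    [(lang k).Structure N] (t : ℕ) (R : Set (M × N)) : Prop :=
  ∃ (E : Type) (_ : (lang k).Structure E) (_ : Finite E) (e₁ : E ↪[lang k] M)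
    (e₂ : E ↪[lang k] N), TClosed k α t (Set.range e₁) ∧ TClosed k α t (Set.range e₂) ∧
      ∀ q ∈ R, ∃ c, e₁ c = q.1 ∧ e₂ c = q.2

theorem CommonClosed.mono {t u : ℕ} (htu : t ≤ u) {R R' : Set (M × N)} (h : CommonClosed k α u R)
    (hR : R' ⊆ R) : CommonClosed k α t R' := by
  obtain ⟨E, i1, i2, e₁, e₂, h1, h2, h3⟩ := h
  exact ⟨E, i1, i2, e₁, e₂, h1.mono htu, h2.mono htu, fun q hq => h3 q (hR hq)⟩

theorem CommonClosed.swap {t : ℕ} {R : Set (M × N)} (h : CommonClosed k α t R) :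
    CommonClosed k α t (Prod.swap '' R) := by
  obtain ⟨E, i1, i2, e₁, e₂, h1, h2, h3⟩ := h
  refine ⟨E, i1, i2, e₂, e₁, h2, h1, ?_⟩
  rintro _ ⟨q, hq, rfl⟩
  obtain ⟨c, hc1, hc2⟩ := h3 q hq
  exact ⟨c, hc2, hc1⟩

/-- The back-and-forth step. -/
theorem exists_forth (hα : ∀ i, 0 < α i) (t s : ℕ) : ∃ u : ℕ, t ≤ u ∧
    ∀ (M N : Type) [(lang k).Structure M] [(lang k).Structure N], InClass k α M →
      Semigeneric k α N → ∀ R : Set (M × N), R.Finite → R.ncard ≤ s → CommonClosed k α u R →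
        ∀ x : M, ∃ y : N, CommonClosed k α t (insert (x, y) R) := by
  classical
  obtain ⟨b, hb⟩ := exists_tClosed (k := k) hα t (s + 1)
  -- Here `b` bounds the `t`-closure of the old first coordinates together with `x`. Closedness at
  -- level `t + b` leaves room for these `b` further points.
  refine ⟨t + b, by omega, fun M N _ _ hM hN R hRf hRs hR x => ?_⟩
  obtain ⟨E, iE, fE, e₁, e₂, h1, h2, h3⟩ := hR
  lift R to Finset (M × N) using hRf
  rw [Set.ncard_coe_finset] at hRs
  obtain ⟨F, hF1, hF2, hF3⟩ := hb M hM (insert x (R.image Prod.fst))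
    ((Finset.card_insert_le _ _).trans (Nat.succ_le_succ (Finset.card_image_le.trans hRs)))
  have hxF : x ∈ F := hF1 (Finset.mem_insert_self _ _)
  have hRF : ∀ q ∈ R, q.1 ∈ F := fun q hq =>
    hF1 (Finset.mem_insert_of_mem (Finset.mem_image_of_mem _ hq))
  let S : Set M := Set.range e₁ ∪ ↑F
  have hSfin : S.Finite := (Set.finite_range e₁).union F.finite_toSet
  let D := sub k S
  have fD : Finite D := hSfin.to_subtype
  let g : E ↪[lang k] D := embOfRel (fun c => ⟨e₁ c, Or.inl ⟨c, rfl⟩⟩)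
    (fun c d h => e₁.injective (congrArg Subtype.val h)) (fun i c => by
      rw [← emb_relMap D.subtype, ← emb_relMap e₁]; rfl)
  have hDc : InClass k α D := hM.of_embedding D.subtype
  have hgr : Set.range g = D.subtype ⁻¹' Set.range e₁ := by
    ext z
    simp only [Set.mem_range, Set.mem_preimage]
    exact ⟨fun ⟨c, hc⟩ => ⟨c, hc ▸ rfl⟩, fun ⟨c, hc⟩ => ⟨c, Subtype.ext hc⟩⟩
  -- All of `D` has at most `b` points beyond the copy of `E`, so closedness at level `t + b` in `M`
  -- gives closedness at every level inside `D`.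
  have hg : ∀ t, TClosed k α t (Set.range g) := by
    intro t' X Y hXY _
    refine (hgr ▸ h1.preimage D.subtype) X Y hXY ?_
    have hsub : Y.map D.subtype.toEmbedding ⊆ X.map D.subtype.toEmbedding ∪ F := by
      intro z hz
      simp only [Finset.mem_map, Finset.mem_union] at hz ⊢
      obtain ⟨y, hy, rfl⟩ := hz
      rcases y.2 with hy' | hy'
      · left
        refine ⟨y, ?_, rfl⟩
        have : y ∈ (X : Set D) := by
          rw [hXY, hgr]; exact ⟨hy, hy'⟩
        exact this
      · exact Or.inr hy'
    have := (Finset.card_le_card hsub).trans (Finset.card_union_le _ _)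
    rw [Finset.card_map, Finset.card_map] at this
    omega
  have hcard : Nat.card D ≤ Nat.card E + b := by
    have : Nat.card D = S.ncard := rfl
    rw [this]
    refine (Set.ncard_union_le _ _).trans (add_le_add ?_ ?_)
    · rw [← Set.image_univ, Set.ncard_image_of_injective _ e₁.injective, Set.ncard_univ]
    · rwa [Set.ncard_coe_finset]
  obtain ⟨h, hh1, hh2⟩ := hN.extension t (t + b) b E D hDc e₂ g hg hcard le_rfl h2
  -- Only `F`, not all of `D`, is kept: it is `t`-closed in `M` by choice, and its image in `N` is
  -- `t`-closed by transitivity through the closed copy of `D`.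
  let F' := sub k (F : Set M)
  let j : F' ↪[lang k] D := embOfRel (fun c => ⟨c.1, Or.inr c.2⟩)
    (fun c d h => Subtype.ext (show c.1 = d.1 from congrArg (fun z : D => z.1) h)) (fun i c => by
      rw [← emb_relMap D.subtype, ← emb_relMap F'.subtype]; rfl)
  have fF' : Finite F' := F.finite_toSet.to_subtype
  refine ⟨h ⟨x, Or.inr hxF⟩, F', inferInstance, fF', F'.subtype, h.comp j, ?_, ?_, ?_⟩
  · have : Set.range F'.subtype = (F : Set M) := Subtype.range_coe
    rwa [this]
  · have hr : Set.range (h.comp j) = h '' (D.subtype ⁻¹' (F : Set M)) := by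
      ext z
      simp only [Set.mem_range, Set.mem_image, Set.mem_preimage]
      constructor
      · rintro ⟨c, rfl⟩; exact ⟨j c, c.2, rfl⟩
      · rintro ⟨d, hd, rfl⟩; exact ⟨⟨d.1, hd⟩, rfl⟩
    rw [hr]
    exact TClosed.trans_range h hh1 (hF2.preimage _)
  · intro q hq
    rcases hq with rfl | hq
    · exact ⟨⟨x, hxF⟩, rfl, rfl⟩
    · obtain ⟨c, hc1, hc2⟩ := h3 q hq
      refine ⟨⟨q.1, hRF q hq⟩, rfl, ?_⟩
      rw [← hc2, ← hh2]
      exact congrArg h (Subtype.ext hc1.symm)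

/-- In a relational language every term is a variable. -/
theorem term_eq_var {β : Type} (τ : (lang k).Term β) : ∃ x, τ = Term.var x := by
  cases τ with
  | var x => exact ⟨x, rfl⟩
  | func f _ => exact f.elim

/-- The truth of a formula in semigeneric structures is determined by sufficiently closed finite
substructures containing the parameters. -/
theorem exists_realize_iff (hα : ∀ i, 0 < α i) {β : Type} {n : ℕ}
    (φ : (lang k).BoundedFormula β n) : ∃ (t : ℕ) (S : Finset β),
      ∀ (M N : Type) [(lang k).Structure M] [(lang k).Structure N], Semigeneric k α M →
        Semigeneric k α N → ∀ (v : β → M) (v' : β → N) (xs : Fin n → M) (xs' : Fin n → N),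
          CommonClosed k α t ((fun i => (v i, v' i)) '' (S : Set β) ∪
            Set.range fun j => (xs j, xs' j)) → (φ.Realize v xs ↔ φ.Realize v' xs') := by
  classical
  have hvar : ∀ {n : ℕ} (x : β ⊕ Fin n), ∃ S : Finset β, ∀ (M N : Type) (v : β → M) (v' : β → N)
      (xs : Fin n → M) (xs' : Fin n → N), (Sum.elim v xs x, Sum.elim v' xs' x) ∈
        ((fun i => (v i, v' i)) '' (S : Set β) ∪ Set.range fun j => (xs j, xs' j)) := by
    rintro n (x | x)
    · exact ⟨{x}, fun M N v v' xs xs' => Or.inl ⟨x, by simp, rfl⟩⟩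
    · exact ⟨∅, fun M N v v' xs xs' => Or.inr ⟨x, rfl⟩⟩
  induction φ with
  | falsum => exact ⟨0, ∅, fun M N _ _ _ _ v v' xs xs' _ => Iff.rfl⟩
  | equal τ₁ τ₂ =>
    obtain ⟨x, rfl⟩ := term_eq_var τ₁
    obtain ⟨y, rfl⟩ := term_eq_var τ₂
    obtain ⟨S, hS⟩ := hvar x
    obtain ⟨S', hS'⟩ := hvar y
    refine ⟨0, S ∪ S', fun M N _ _ _ _ v v' xs xs' h => ?_⟩
    obtain ⟨E, _, _, e₁, e₂, -, -, h3⟩ := h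
    have hsub : ∀ T ⊆ S ∪ S', ((fun i => (v i, v' i)) '' (T : Set β) ∪
        Set.range fun j => (xs j, xs' j)) ⊆ ((fun i => (v i, v' i)) '' ((S ∪ S' : Finset β) : Set β) ∪
        Set.range fun j => (xs j, xs' j)) := fun T hT =>
      Set.union_subset_union_left _ (Set.image_mono (by exact_mod_cast hT))
    obtain ⟨c, hc1, hc2⟩ := h3 _ (hsub S Finset.subset_union_left (hS M N v v' xs xs'))
    obtain ⟨d, hd1, hd2⟩ := h3 _ (hsub S' Finset.subset_union_right (hS' M N v v' xs xs'))
    simp only [BoundedFormula.Realize, Term.realize_var]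
    simp only at hc1 hc2 hd1 hd2
    rw [← hc1, ← hc2, ← hd1, ← hd2, e₁.injective.eq_iff, e₂.injective.eq_iff]
  | rel R ts =>
    obtain ⟨i, rfl⟩ := R
    choose x hx using fun j => term_eq_var (ts j)
    choose S hS using fun j => hvar (x j)
    refine ⟨0, Finset.univ.biUnion S, fun M N _ _ _ _ v v' xs xs' h => ?_⟩
    obtain ⟨E, _, _, e₁, e₂, -, -, h3⟩ := h
    have hsub : ∀ j, ((fun i => (v i, v' i)) '' (S j : Set β) ∪
        Set.range fun j => (xs j, xs' j)) ⊆ ((fun i => (v i, v' i)) ''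
          ((Finset.univ.biUnion S : Finset β) : Set β) ∪ Set.range fun j => (xs j, xs' j)) := fun j =>
      Set.union_subset_union_left _ (Set.image_mono (by
        exact_mod_cast Finset.subset_biUnion_of_mem S (Finset.mem_univ j)))
    choose c hc1 hc2 using fun j => h3 _ (hsub j (hS j M N v v' xs xs'))
    have h1 : (fun j => (ts j).realize (Sum.elim v xs)) = e₁ ∘ c := by
      funext j; rw [hx]; exact (hc1 j).symm
    have h2 : (fun j => (ts j).realize (Sum.elim v' xs')) = e₂ ∘ c := by
      funext j; rw [hx]; exact (hc2 j).symm
    simp only [BoundedFormula.Realize]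
    rw [h1, h2]
    exact (emb_relMap e₁ i c).trans (emb_relMap e₂ i c).symm
  | imp φ ψ ih1 ih2 =>
    obtain ⟨t, S, h⟩ := ih1
    obtain ⟨t', S', h'⟩ := ih2
    refine ⟨max t t', S ∪ S', fun M N _ _ hM hN v v' xs xs' hc => ?_⟩
    have h1 := h M N hM hN v v' xs xs' (hc.mono (le_max_left _ _)
      (Set.union_subset_union_left _ (Set.image_mono (by simp))))
    have h2 := h' M N hM hN v v' xs xs' (hc.mono (le_max_right _ _)
      (Set.union_subset_union_left _ (Set.image_mono (by simp))))
    simp only [BoundedFormula.realize_imp, h1, h2]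
  | @all n φ ih =>
    obtain ⟨t, S, h⟩ := ih
    obtain ⟨u, -, hu⟩ := exists_forth (k := k) hα t (S.card + n)
    refine ⟨u, S, ?_⟩
    -- `CommonClosed` is symmetric in the two structures, so one implication is enough: each element
    -- of `M` is matched by some element of `N` at the cost of passing from level `u` to level `t`.
    have key : ∀ (M N : Type) [(lang k).Structure M] [(lang k).Structure N], Semigeneric k α M →
        Semigeneric k α N → ∀ (v : β → M) (v' : β → N) (xs : Fin n → M) (xs' : Fin n → N),
          CommonClosed k α u ((fun i => (v i, v' i)) '' (S : Set β) ∪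
            Set.range fun j => (xs j, xs' j)) → φ.all.Realize v' xs' → φ.all.Realize v xs := by
      intro M N _ _ hM hN v v' xs xs' hc hr
      rw [BoundedFormula.realize_all] at hr ⊢
      intro a
      obtain ⟨y, hy⟩ := hu M N hM.inClass hN _
        ((S.finite_toSet.image _).union (Set.finite_range _)) (by
          refine (Set.ncard_union_le _ _).trans (add_le_add ?_ ?_)
          · exact (Set.ncard_image_le S.finite_toSet).trans (by rw [Set.ncard_coe_finset])
          · rw [← Set.image_univ]
            exact (Set.ncard_image_le Set.finite_univ).trans (by simp)) hc a
      refine (h M N hM hN v v' (Fin.snoc xs a) (Fin.snoc xs' y) (hy.mono le_rfl ?_)).2 (hr y)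
      rintro q (hq | ⟨j, rfl⟩)
      · exact Or.inr (Or.inl hq)
      · induction j using Fin.lastCases with
        | last => left; simp
        | cast j => right; right; exact ⟨j, by simp⟩
    intro M N _ _ hM hN v v' xs xs' hc
    refine ⟨key N M hN hM v' v xs' xs (hc.swap.mono le_rfl ?_), key M N hM hN v v' xs xs' hc⟩
    rintro q (⟨i, hi, rfl⟩ | ⟨j, rfl⟩)
    · exact ⟨_, Or.inl ⟨i, hi, rfl⟩, rfl⟩
    · exact ⟨_, Or.inr ⟨j, rfl⟩, rfl⟩

/-- Semigeneric structures are elementarily equivalent. -/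
theorem Semigeneric.realize_sentence_iff (hα : ∀ i, 0 < α i) (hM : Semigeneric k α M)
    (hN : Semigeneric k α N) (φ : (lang k).Sentence) : M ⊨ φ ↔ N ⊨ φ := by
  obtain ⟨t, S, h⟩ := exists_realize_iff (k := k) hα φ
  refine h M N hM hN _ _ _ _ ?_
  -- With no parameters, the empty substructure serves as the common closed one.
  let E := sub k (∅ : Set M)
  have : IsEmpty E := ⟨fun x => x.2⟩
  refine ⟨E, inferInstance, inferInstance, E.subtype, embOfRel isEmptyElim
    (fun x => isEmptyElim x) ?_, ?_, ?_, ?_⟩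
  · intro i c
    -- If a symbol of arity zero held, the empty set would be an edge and would have negative
    -- predimension. Such symbols are therefore false in every structure of the class, and the empty
    -- map is an embedding.
    rcases Nat.eq_zero_or_pos (k i) with h0 | h0
    · have hno : ∀ (P : Type) [(lang k).Structure P], InClass k α P → ∀ c : Fin (k i) → P,
          ¬ Structure.RelMap (sym k i) c := by
        intro P _ hP c hc
        have h1 := hP.predim_empty hα
        have h2 : 0 < edgeCount k i (∅ : Finset P) := by
          rw [edgeCount_eq_card, Finset.card_pos]
          refine ⟨∅, mem_edgesIn.2 ⟨subset_rfl, by simp [h0], c, ?_, hc⟩⟩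
          have : IsEmpty (Fin (k i)) := ⟨fun x => (h0 ▸ x : Fin 0).elim0⟩
          rw [Set.range_eq_empty, Finset.coe_empty]
        have h3 : α i * (edgeCount k i (∅ : Finset P) : ℝ) ≤
            ∑ i, α i * (edgeCount k i (∅ : Finset P) : ℝ) :=
          Finset.single_le_sum (f := fun i => α i * (edgeCount k i (∅ : Finset P) : ℝ))
            (fun j _ => mul_nonneg (hα j).le (Nat.cast_nonneg _)) (Finset.mem_univ i)
        have h4 : 0 < α i * (edgeCount k i (∅ : Finset P) : ℝ) :=
          mul_pos (hα i) (by exact_mod_cast h2)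
        unfold predim at h1
        simp only [Finset.card_empty, Nat.cast_zero] at h1
        linarith
      exact iff_of_false (hno N hN.inClass _) (hno E (hM.inClass.of_embedding E.subtype) _)
    · exact isEmptyElim (c ⟨0, h0⟩)
  · rw [Set.range_eq_empty]; exact hM.inClass.tClosed_empty hα t
  · rw [Set.range_eq_empty]; exact hN.inClass.tClosed_empty hα t
  · rintro q (⟨i, -, -⟩ | ⟨j, -⟩)
    · exact i.elim
    · exact j.elim0

/-- Isomorphisms between closed subsets of semigeneric structures are elementary. -/
theorem Semigeneric.realize_iff_of_closed (hα : ∀ i, 0 < α i) (hM : Semigeneric k α M)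
    (hN : Semigeneric k α N) {X : Type} [(lang k).Structure X] (e₁ : X ↪[lang k] M)
    (e₂ : X ↪[lang k] N) (h₁ : ∀ t, TClosed k α t (Set.range e₁))
    (h₂ : ∀ t, TClosed k α t (Set.range e₂)) {β : Type} (φ : (lang k).Formula β) (x : β → X) :
    φ.Realize (e₁ ∘ x) ↔ φ.Realize (e₂ ∘ x) := by
  classical
  obtain ⟨t, S, h⟩ := exists_realize_iff (k := k) hα φ
  refine h M N hM hN _ _ _ _ ?_
  -- A finite `t`-closure taken inside `X` remains `t`-closed in both structures by transitivity.
  obtain ⟨b, hb⟩ := exists_tClosed (k := k) hα t S.card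
  obtain ⟨F, hF1, hF2, -⟩ := hb X (hM.inClass.of_embedding e₁) (S.image x) Finset.card_image_le
  let E := sub k (F : Set X)
  have hr : Set.range E.subtype = (F : Set X) := Subtype.range_coe
  refine ⟨E, inferInstance, F.finite_toSet.to_subtype, e₁.comp E.subtype, e₂.comp E.subtype,
    ?_, ?_, ?_⟩
  · have : Set.range (e₁.comp E.subtype) = e₁ '' F := by
      rw [← hr, ← Set.range_comp]; rfl
    rw [this]; exact TClosed.trans_range e₁ (h₁ t) hF2
  · have : Set.range (e₂.comp E.subtype) = e₂ '' F := by
      rw [← hr, ← Set.range_comp]; rfl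
    rw [this]; exact TClosed.trans_range e₂ (h₂ t) hF2
  · rintro q (⟨i, hi, rfl⟩ | ⟨j, rfl⟩)
    · exact ⟨⟨x i, hF1 (Finset.mem_image_of_mem _ hi)⟩, rfl, rfl⟩
    · exact j.elim0

end Semigeneric

/-! ### Closures determined by existential types. -/

section Atomic

variable {p : ℕ} {k : Fin p → ℕ} {α : Fin p → ℝ}
  {M N : Type} [(lang k).Structure M] [(lang k).Structure N]

/-- Two tuples satisfy the same atomic formulas. -/
def SameAtomic (k : Fin p → ℕ) {M N : Type} [(lang k).Structure M] [(lang k).Structure N]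
    {ι : Type} (x : ι → M) (y : ι → N) : Prop :=
  (∀ i j, x i = x j ↔ y i = y j) ∧ ∀ r (c : Fin (k r) → ι),
    Structure.RelMap (sym k r) (x ∘ c) ↔ Structure.RelMap (sym k r) (y ∘ c)

theorem SameAtomic.symm {ι : Type} {x : ι → M} {y : ι → N} (h : SameAtomic k x y) :
    SameAtomic k y x :=
  ⟨fun i j => (h.1 i j).symm, fun r c => (h.2 r c).symm⟩

theorem SameAtomic.comp {ι κ : Type} {x : ι → M} {y : ι → N} (h : SameAtomic k x y) (f : κ → ι) :
    SameAtomic k (x ∘ f) (y ∘ f) :=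
  ⟨fun i j => h.1 (f i) (f j), fun r c => h.2 r (f ∘ c)⟩

theorem SameAtomic.exists_embedding {ι : Type} {x : ι → M} {y : ι → N} (h : SameAtomic k x y) :
    ∃ e : sub k (Set.range x) ↪[lang k] N, ∀ i, e ⟨x i, i, rfl⟩ = y i := by
  choose f hf using fun z : sub k (Set.range x) => z.2
  have hfx : ∀ i, y (f ⟨x i, i, rfl⟩) = y i := fun i => (h.1 _ _).1 (hf ⟨x i, i, rfl⟩)
  refine ⟨embOfRel (fun z => y (f z)) ?_ ?_, hfx⟩
  · intro z w hzw
    have := (h.1 _ _).2 hzw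
    rw [hf, hf] at this
    exact Subtype.ext this
  · intro i c
    rw [← emb_relMap (sub k (Set.range x)).subtype]
    have : (sub k (Set.range x)).subtype ∘ c = x ∘ (f ∘ c) := by
      funext j; exact (hf (c j)).symm
    rw [this, h.2 i]
    rfl

theorem SameAtomic.predim_image_eq [DecidableEq M] [DecidableEq N] {ι : Type} {x : ι → M}
    {y : ι → N} (h : SameAtomic k x y) (S : Finset ι) :
    predim k α (S.image x) = predim k α (S.image y) := by
  classical
  obtain ⟨e, he⟩ := h.exists_embedding
  let Z : Finset (sub k (Set.range x)) := S.image fun i => ⟨x i, i, rfl⟩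
  have h1 : Z.map (sub k (Set.range x)).subtype.toEmbedding = S.image x := by
    rw [Finset.map_eq_image, Finset.image_image]
    exact Finset.image_congr fun i _ => rfl
  have h2 : Z.map e.toEmbedding = S.image y := by
    rw [Finset.map_eq_image, Finset.image_image]
    exact Finset.image_congr fun i _ => he i
  rw [← h1, ← h2, predim_map, predim_map]

/-- Tuples with the same existential type have isomorphic closures. -/
theorem exists_commonClosed (hα : ∀ i, 0 < α i) (t s : ℕ) : ∃ b : ℕ,
    ∀ (M N : Type) [(lang k).Structure M] [(lang k).Structure N], InClass k α M → InClass k α N →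
      ∀ (x : Fin s → M) (y : Fin s → N),
        (∀ c ≤ b, ∀ z : Fin c → M, ∃ w : Fin c → N, SameAtomic k (Sum.elim x z) (Sum.elim y w)) →
        (∀ c ≤ b, ∀ w : Fin c → N, ∃ z : Fin c → M, SameAtomic k (Sum.elim x z) (Sum.elim y w)) →
          CommonClosed k α t (Set.range fun j => (x j, y j)) := by
  classical
  obtain ⟨b, hb⟩ := exists_tClosed (k := k) hα t s
  refine ⟨b, ?_⟩
  -- A `t`-closed set of least cardinality around the tuple has at most `b` elements, so it is
  -- enumerated by one of the tuples to which the hypothesis applies.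
  have hmin : ∀ (M : Type) [(lang k).Structure M], InClass k α M → ∀ x : Fin s → M,
      ∃ F : Finset M, Finset.univ.image x ⊆ F ∧ TClosed k α t (F : Set M) ∧ F.card ≤ b ∧
        ∀ F' : Finset M, Finset.univ.image x ⊆ F' → TClosed k α t (F' : Set M) →
          F.card ≤ F'.card := by
    intro M _ hM x
    obtain ⟨F₀, h1, h2, h3⟩ := hb M hM (Finset.univ.image x)
      (Finset.card_image_le.trans (by simp))
    have hex : ∃ m, ∃ F : Finset M, F.card = m ∧ Finset.univ.image x ⊆ F ∧
        TClosed k α t (F : Set M) := ⟨_, F₀, rfl, h1, h2⟩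
    obtain ⟨F, hF, hF1, hF2⟩ := Nat.find_spec hex
    have hle : ∀ F' : Finset M, Finset.univ.image x ⊆ F' → TClosed k α t (F' : Set M) →
          F.card ≤ F'.card := fun F' h h' => hF ▸ Nat.find_min' hex ⟨F', rfl, h, h'⟩
    exact ⟨F, hF1, hF2, (hle F₀ h1 h2).trans h3, hle⟩
  have key : ∀ (M N : Type) [(lang k).Structure M] [(lang k).Structure N], ∀ (x : Fin s → M)
      (y : Fin s → N), (∀ c ≤ b, ∀ z : Fin c → M, ∃ w : Fin c → N,
        SameAtomic k (Sum.elim x z) (Sum.elim y w)) → ∀ (F : Finset M) (G : Finset N),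
        Finset.univ.image x ⊆ F → TClosed k α t (F : Set M) → F.card ≤ b →
        (∀ F' : Finset M, Finset.univ.image x ⊆ F' → TClosed k α t (F' : Set M) →
          F.card ≤ F'.card) → Finset.univ.image y ⊆ G → TClosed k α t (G : Set N) →
        G.card ≤ F.card → CommonClosed k α t (Set.range fun j => (x j, y j)) := by
    intro M N _ _ x y hxy F G hF1 hF2 hF3 hF4 hG1 hG2 hGF
    obtain ⟨c, hcb, z, hz⟩ : ∃ c ≤ b, ∃ z : Fin c → M, Set.range z = (F : Set M) := by
      refine ⟨F.card, hF3, Subtype.val ∘ F.equivFin.symm, ?_⟩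
      rw [Set.range_comp, F.equivFin.symm.surjective.range_eq, Set.image_univ]
      exact Subtype.range_coe
    obtain ⟨w, hw⟩ := hxy _ hcb z
    have hxF : ∀ j, x j ∈ F := fun j => hF1 (Finset.mem_image_of_mem _ (Finset.mem_univ _))
    obtain ⟨e, he⟩ := hw.exists_embedding
    have hr : Set.range (Sum.elim x z) = (F : Set M) := by
      rw [Set.Sum.elim_range, hz]
      exact Set.union_eq_self_of_subset_left (by rintro _ ⟨j, rfl⟩; exact hxF j)
    let E := sub k (Set.range (Sum.elim x z))
    have hE : Set.range E.subtype = (F : Set M) := hr ▸ Subtype.range_coe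
    have fE : Finite E := (hr ▸ F.finite_toSet : (Set.range (Sum.elim x z)).Finite).to_subtype
    -- The preimage of `G` is `t`-closed in the structure on `F`, hence in `M`, and it contains the
    -- tuple `x`; minimality of `F` makes it everything. So `e` maps into `G`, and onto `G` because
    -- `G` is no larger than `F`.
    have hFin : (e ⁻¹' (G : Set N)) = Set.univ := by
      have h1 : TClosed k α t (E.subtype '' (e ⁻¹' (G : Set N))) :=
        TClosed.trans_range E.subtype (hE ▸ hF2) (hG2.preimage e)
      have h2 : (E.subtype '' (e ⁻¹' (G : Set N))) ⊆ F := hE ▸ Set.image_subset_range _ _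
      have h3 : (E.subtype '' (e ⁻¹' (G : Set N))).Finite := F.finite_toSet.subset h2
      have h4 := hF4 h3.toFinset (by
        intro a ha
        obtain ⟨j, -, rfl⟩ := Finset.mem_image.1 ha
        rw [Set.Finite.mem_toFinset]
        refine ⟨⟨x j, Sum.inl j, rfl⟩, ?_, rfl⟩
        have : e ⟨x j, Sum.inl j, rfl⟩ = y j := he (Sum.inl j)
        rw [Set.mem_preimage, this]
        exact hG1 (Finset.mem_image_of_mem _ (Finset.mem_univ _))) (by simpa using h1)
      have h5 : h3.toFinset = F := Finset.eq_of_subset_of_card_le (by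
        intro a ha; exact h2 (h3.mem_toFinset.1 ha)) h4
      have h6 : (E.subtype '' (e ⁻¹' (G : Set N))) = Set.range E.subtype := by
        rw [hE, ← h5]; simp
      exact Set.image_injective.2 E.subtype.injective (h6.trans Set.image_univ.symm)
    have hrange : Set.range e = (G : Set N) := by
      have h1 : Set.range e ⊆ G := by
        rintro _ ⟨a, rfl⟩
        have : a ∈ (e ⁻¹' (G : Set N)) := hFin ▸ Set.mem_univ a
        exact this
      refine Set.eq_of_subset_of_ncard_le h1 ?_ G.finite_toSet
      rw [Set.ncard_coe_finset, ← Set.image_univ, Set.ncard_image_of_injective _ e.injective,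
        Set.ncard_univ]
      refine hGF.trans (le_of_eq ?_)
      rw [← Set.ncard_coe_finset, ← hr, ← Nat.card_coe_set_eq]
      rfl
    refine ⟨E, inferInstance, fE, E.subtype, e, hE ▸ hF2, hrange ▸ hG2, ?_⟩
    rintro _ ⟨j, rfl⟩
    exact ⟨⟨x j, Sum.inl j, rfl⟩, rfl, he (Sum.inl j)⟩
  intro M N _ _ hM hN x y h1 h2
  obtain ⟨F, hF1, hF2, hF3, hF4⟩ := hmin M hM x
  obtain ⟨G, hG1, hG2, hG3, hG4⟩ := hmin N hN y
  rcases le_total G.card F.card with h | h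
  · exact key M N x y h1 F G hF1 hF2 hF3 hF4 hG1 hG2 h
  · refine (key N M y x (fun c hc w => ?_) G F hG1 hG2 hG3 hG4 hF1 hF2 h).swap.mono le_rfl ?_
    · obtain ⟨z, hz⟩ := h2 c hc w
      exact ⟨z, hz.symm⟩
    · rintro _ ⟨j, rfl⟩
      exact ⟨_, ⟨j, rfl⟩, rfl⟩

end Atomic

/-! ### Structures given by edges, and free amalgamation. -/

section Amalgam

variable {p : ℕ} {k : Fin p → ℕ} {α : Fin p → ℝ}

/-- The symmetric structure with given edges. -/
@[reducible] def ofEdges {V : Type} (k : Fin p → ℕ) (H : Fin p → Set (Finset V)) :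
    (lang k).Structure V where
  funMap f := f.elim
  RelMap r c := Function.Injective c ∧ ∃ C ∈ H r.1, (C : Set V) = Set.range c

theorem isSymmetric_ofEdges {V : Type} (H : Fin p → Set (Finset V)) :
    @IsSymmetric p k V (ofEdges k H) := by
  let _ := ofEdges k H
  rintro i c ⟨hc, C, hC, h⟩
  refine ⟨hc, fun σ => ⟨hc.comp σ.injective, C, hC, ?_⟩⟩
  rw [h, σ.surjective.range_comp]

theorem mem_edges_ofEdges {V : Type} (H : Fin p → Set (Finset V)) (i : Fin p) (C : Finset V) :
    C ∈ @edges p k V (ofEdges k H) i ↔ C.card = k i ∧ C ∈ H i := by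
  let _ := ofEdges k H
  refine and_congr_right fun hcard => ⟨?_, fun h => ?_⟩
  · rintro ⟨c, hc, -, C', hC', h⟩
    rw [hc, Finset.coe_inj] at h
    exact h ▸ hC'
  · let c : Fin (k i) → V := Subtype.val ∘ (C.equivFinOfCardEq hcard).symm
    have hr : Set.range c = (C : Set V) := by
      rw [Set.range_comp, (C.equivFinOfCardEq hcard).symm.surjective.range_eq, Set.image_univ]
      exact Subtype.range_coe
    exact ⟨c, hr, Subtype.val_injective.comp (Equiv.injective _), C, h, hr.symm⟩

theorem toStructure_eq {n : ℕ} (G : Config k n) :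
    G.toStructure = ofEdges k fun i => {C | ∃ h, (⟨C, h⟩ : {C : Finset (Fin n) // C.card = k i}) ∈ G i} := by
  ext
  · rename_i f _
    exact f.elim
  · rename_i r c
    refine and_congr_right fun _ => ⟨?_, ?_⟩
    · rintro ⟨C, hC, h⟩; exact ⟨C.1, ⟨C.2, hC⟩, h⟩
    · rintro ⟨C, ⟨h1, hC⟩, h⟩; exact ⟨⟨C, h1⟩, hC, h⟩

theorem isSymmetric_toStructure {n : ℕ} (G : Config k n) :
    @IsSymmetric p k (Fin n) G.toStructure := by
  rw [toStructure_eq]; exact isSymmetric_ofEdges _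

theorem mem_edges_toStructure {n : ℕ} (G : Config k n) (i : Fin p) (C : Finset (Fin n)) :
    C ∈ @edges p k (Fin n) G.toStructure i ↔ ∃ h, (⟨C, h⟩ : {C : Finset (Fin n) // C.card = k i}) ∈ G i := by
  rw [toStructure_eq, mem_edges_ofEdges]
  exact ⟨fun h => h.2, fun h => ⟨h.1, h⟩⟩

variable {A B C D : Type} [(lang k).Structure A] [(lang k).Structure B] [(lang k).Structure C]
  [(lang k).Structure D]

/-- Predimension is intrinsic to a substructure, so for sets inside a copy of `B` the inequality is
read off in `B`. It is applied to the two halves of an amalgam. -/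
theorem TClosed.predim_le_of_subset_range {t : ℕ} {S : Set B} (hS : TClosed k α t S)
    (j : B ↪[lang k] D) {X Y : Finset D} (hY : (Y : Set D) ⊆ Set.range j)
    (hX : (X : Set D) = ↑Y ∩ j '' S) (hc : Y.card ≤ X.card + t) :
    predim k α X ≤ predim k α Y := by
  have hlift : ∀ Z : Finset D, (Z : Set D) ⊆ Set.range j →
      (Z.preimage j j.injective.injOn).map j.toEmbedding = Z := by
    intro Z hZ
    ext z
    simp only [Finset.mem_map, Finset.mem_preimage]
    constructor
    · rintro ⟨x, hx, rfl⟩; exact hx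
    · intro hz
      obtain ⟨x, rfl⟩ := hZ hz
      exact ⟨x, hz, rfl⟩
  have h1 := hlift Y hY
  have h2 := hlift X (hX ▸ Set.inter_subset_left.trans hY)
  rw [← h1, ← h2, predim_map, predim_map]
  refine hS _ _ ?_ ?_
  · rw [Finset.coe_preimage, hX, Set.preimage_inter, Set.preimage_image_eq _ j.injective,
      Finset.coe_preimage]
  · rwa [← Finset.card_map j.toEmbedding, h1, ← Finset.card_map (s := X.preimage _ _) j.toEmbedding,
      h2]

open Classical in
/-- The free amalgam of two symmetric structures over a common substructure. -/
theorem exists_freeAmalgam (hB : IsSymmetric k B) (hC : IsSymmetric k C) [Finite B] [Finite C]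
    (f : A ↪[lang k] C) (g : A ↪[lang k] B) :
    ∃ (D : Type) (_ : (lang k).Structure D) (_ : Finite D) (i : C ↪[lang k] D)
      (j : B ↪[lang k] D), IsSymmetric k D ∧ (∀ a, i (f a) = j (g a)) ∧
      (Set.range i ∪ Set.range j = Set.univ) ∧
      (Set.range i ∩ Set.range j = i '' Set.range f) ∧
      ∀ Y : Finset D, predim k α Y + predim k α (Y.filter (· ∈ i '' Set.range f)) =
        predim k α (Y.filter (· ∈ Set.range i)) + predim k α (Y.filter (· ∈ Set.range j)) := by
  let D := C ⊕ {b : B // b ∉ Set.range g}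
  let iF : C ↪ D := ⟨Sum.inl, Sum.inl_injective⟩
  let jF : B → D := fun b => if h : b ∈ Set.range g then Sum.inl (f h.choose) else Sum.inr ⟨b, h⟩
  have hjg : ∀ a, jF (g a) = Sum.inl (f a) := by
    intro a
    have h : g a ∈ Set.range g := ⟨a, rfl⟩
    simp only [jF, dif_pos h]
    rw [g.injective h.choose_spec]
  have hjn : ∀ b (h : b ∉ Set.range g), jF b = Sum.inr ⟨b, h⟩ := fun b h => dif_neg h
  have hjinj : Function.Injective jF := by
    intro b b' hbb
    by_cases h : b ∈ Set.range g <;> by_cases h' : b' ∈ Set.range g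
    · obtain ⟨a, rfl⟩ := h
      obtain ⟨a', rfl⟩ := h'
      rw [hjg, hjg] at hbb
      rw [f.injective (Sum.inl_injective hbb)]
    · obtain ⟨a, rfl⟩ := h
      rw [hjg, hjn _ h'] at hbb
      exact absurd hbb (by simp)
    · obtain ⟨a', rfl⟩ := h'
      rw [hjg, hjn _ h] at hbb
      exact absurd hbb (by simp)
    · rw [hjn _ h, hjn _ h'] at hbb
      exact congrArg Subtype.val (Sum.inr_injective hbb)
  let jE : B ↪ D := ⟨jF, hjinj⟩
  have hjl : ∀ b c, jE b = iF c → ∃ a, g a = b ∧ f a = c := by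
    intro b c h
    by_cases hb : b ∈ Set.range g
    · obtain ⟨a, rfl⟩ := hb
      have : (Sum.inl (f a) : D) = Sum.inl c := (hjg a).symm.trans h
      exact ⟨a, rfl, Sum.inl_injective this⟩
    · have : (Sum.inr ⟨b, hb⟩ : D) = Sum.inl c := (hjn b hb).symm.trans h
      exact absurd this (by simp)
  -- No edge joins the two sides. This is what turns submodularity into an equality over the common
  -- part.
  let H : Fin p → Set (Finset D) := fun r =>
    (fun X => Finset.map iF X) '' edges k C r ∪ (fun X => Finset.map jE X) '' edges k B r
  let iD : (lang k).Structure D := ofEdges k H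
  have hD : IsSymmetric k D := isSymmetric_ofEdges H
  have hmem : ∀ r X, X ∈ edges k D r ↔ X ∈ H r := by
    intro r X
    rw [mem_edges_ofEdges]
    refine ⟨fun h => h.2, fun h => ⟨?_, h⟩⟩
    rcases h with ⟨Z, hZ, rfl⟩ | ⟨Z, hZ, rfl⟩
    · simpa using hZ.1
    · simpa using hZ.1
  have hcross : ∀ (X : Finset C) (Y : Finset B), X.map iF = Y.map jE →
      ∃ Z : Finset A, Z.map f.toEmbedding = X ∧ Z.map g.toEmbedding = Y := by
    intro X Y h
    have h1 : ∀ c ∈ X, ∃ a, f a = c ∧ g a ∈ Y := by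
      intro c hc
      have : iF c ∈ Y.map jE := h ▸ Finset.mem_map_of_mem _ hc
      obtain ⟨b, hb, hbc⟩ := Finset.mem_map.1 this
      obtain ⟨a, rfl, ha⟩ := hjl b c hbc
      exact ⟨a, ha, hb⟩
    have h2 : ∀ b ∈ Y, ∃ a, g a = b ∧ f a ∈ X := by
      intro b hb
      have : jE b ∈ X.map iF := h ▸ Finset.mem_map_of_mem _ hb
      obtain ⟨c, hc, hbc⟩ := Finset.mem_map.1 this
      obtain ⟨a, ha, rfl⟩ := hjl b c hbc.symm
      exact ⟨a, ha, hc⟩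
    refine ⟨X.preimage f f.injective.injOn, ?_, ?_⟩
    · ext c
      simp only [Finset.mem_map, Finset.mem_preimage]
      constructor
      · rintro ⟨a, ha, rfl⟩; exact ha
      · intro hc
        obtain ⟨a, rfl, -⟩ := h1 c hc
        exact ⟨a, hc, rfl⟩
    · ext b
      simp only [Finset.mem_map, Finset.mem_preimage]
      constructor
      · rintro ⟨a, ha, rfl⟩
        obtain ⟨a', h3, h4⟩ := h1 _ ha
        rw [f.injective h3] at h4
        exact h4
      · intro hb
        obtain ⟨a, rfl, ha⟩ := h2 b hb
        exact ⟨a, ha, rfl⟩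
  let i : C ↪[lang k] D := embOfEdges hC hD iF (by
    intro r X
    rw [hmem]
    constructor
    · rintro (⟨Z, hZ, h⟩ | ⟨Z, hZ, h⟩)
      · rwa [← Finset.map_injective _ h]
      · obtain ⟨W, rfl, rfl⟩ := hcross X Z h.symm
        rw [map_mem_edges] at hZ ⊢
        exact hZ
    · exact fun h => Or.inl ⟨X, h, rfl⟩)
  let j : B ↪[lang k] D := embOfEdges hB hD jE (by
    intro r X
    rw [hmem]
    constructor
    · rintro (⟨Z, hZ, h⟩ | ⟨Z, hZ, h⟩)
      · obtain ⟨W, rfl, rfl⟩ := hcross Z X h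
        rw [map_mem_edges] at hZ ⊢
        exact hZ
      · rwa [← Finset.map_injective _ h]
    · exact fun h => Or.inr ⟨X, h, rfl⟩)
  have hcomm : ∀ a, i (f a) = j (g a) := fun a => (hjg a).symm
  have hunion : Set.range i ∪ Set.range j = Set.univ := by
    refine Set.eq_univ_of_forall ?_
    rintro (c | ⟨b, hb⟩)
    · exact Or.inl ⟨c, rfl⟩
    · exact Or.inr ⟨b, hjn b hb⟩
  have hinter : Set.range i ∩ Set.range j = i '' Set.range f := by
    ext d
    constructor
    · rintro ⟨⟨c, rfl⟩, b, hb⟩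
      obtain ⟨a, -, rfl⟩ := hjl b c hb
      exact ⟨f a, ⟨a, rfl⟩, rfl⟩
    · rintro ⟨_, ⟨a, rfl⟩, rfl⟩
      exact ⟨⟨f a, rfl⟩, g a, (hcomm a).symm⟩
  refine ⟨D, iD, inferInstance, i, j, hD, hcomm, hunion, hinter, fun Y => ?_⟩
  have hYu : Y.filter (· ∈ Set.range i) ∪ Y.filter (· ∈ Set.range j) = Y := by
    ext d
    have : d ∈ Set.range i ∪ Set.range j := hunion ▸ Set.mem_univ d
    have : d ∈ Set.range i ∨ d ∈ Set.range j := this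
    simp only [Finset.mem_union, Finset.mem_filter]
    tauto
  have hYi : Y.filter (· ∈ Set.range i) ∩ Y.filter (· ∈ Set.range j) =
      Y.filter (· ∈ i '' Set.range f) := by
    ext d
    rw [← hinter]
    simp only [Finset.mem_inter, Finset.mem_filter, Set.mem_inter_iff]
    tauto
  have hw : ∀ r, edgeCount k r Y + edgeCount k r (Y.filter (· ∈ i '' Set.range f)) =
      edgeCount k r (Y.filter (· ∈ Set.range i)) + edgeCount k r (Y.filter (· ∈ Set.range j)) := by
    intro r
    simp only [edgeCount_eq_card]
    rw [← Finset.card_union_add_card_inter (edgesIn k r (Y.filter (· ∈ Set.range i)))]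
    congr 2
    · ext X
      simp only [Finset.mem_union, mem_edgesIn]
      constructor
      · rintro ⟨h1, h2⟩
        rcases (hmem r X).1 h2 with ⟨Z, -, rfl⟩ | ⟨Z, -, rfl⟩
        · refine Or.inl ⟨fun d hd => Finset.mem_filter.2 ⟨h1 hd, ?_⟩, h2⟩
          obtain ⟨c, -, rfl⟩ := Finset.mem_map.1 hd
          exact ⟨c, rfl⟩
        · refine Or.inr ⟨fun d hd => Finset.mem_filter.2 ⟨h1 hd, ?_⟩, h2⟩
          obtain ⟨c, -, rfl⟩ := Finset.mem_map.1 hd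
          exact ⟨c, rfl⟩
      · rintro (⟨h1, h2⟩ | ⟨h1, h2⟩)
        · exact ⟨h1.trans (Finset.filter_subset _ _), h2⟩
        · exact ⟨h1.trans (Finset.filter_subset _ _), h2⟩
    · ext X
      simp only [Finset.mem_inter, mem_edgesIn, ← hYi, Finset.subset_inter_iff]
      tauto
  have hc : (Y.card : ℝ) + (Y.filter (· ∈ i '' Set.range f)).card =
      (Y.filter (· ∈ Set.range i)).card + (Y.filter (· ∈ Set.range j)).card := by
    have := Finset.card_union_add_card_inter (Y.filter (· ∈ Set.range i))
      (Y.filter (· ∈ Set.range j))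
    rw [hYu, hYi] at this
    exact_mod_cast this
  have hw' : ∑ r, α r * (edgeCount k r Y : ℝ) +
      ∑ r, α r * (edgeCount k r (Y.filter (· ∈ i '' Set.range f)) : ℝ) =
      ∑ r, α r * (edgeCount k r (Y.filter (· ∈ Set.range i)) : ℝ) +
      ∑ r, α r * (edgeCount k r (Y.filter (· ∈ Set.range j)) : ℝ) := by
    rw [← Finset.sum_add_distrib, ← Finset.sum_add_distrib]
    refine Finset.sum_congr rfl fun r _ => ?_
    rw [← mul_add, ← mul_add]
    congr 1
    exact_mod_cast hw r
  unfold predim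
  linarith

/-- Amalgamation: strong extensions can be amalgamated freely, and relative closedness is kept. -/
theorem exists_strong_amalgam (hB : InClass k α B) (hC : InClass k α C) [Finite B] [Finite C]
    (f : A ↪[lang k] C) (g : A ↪[lang k] B) (hg : ∀ t, TClosed k α t (Set.range g)) :
    ∃ (D : Type) (_ : (lang k).Structure D) (_ : Finite D) (i : C ↪[lang k] D)
      (j : B ↪[lang k] D), InClass k α D ∧ (∀ a, i (f a) = j (g a)) ∧
      (∀ t, TClosed k α t (Set.range i)) ∧
      ∀ t, TClosed k α t (Set.range f) → TClosed k α t (Set.range j) := by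
  classical
  obtain ⟨D, iD, fD, i, j, hD, hcomm, hunion, hinter, hY⟩ :=
    exists_freeAmalgam (α := α) hB.1 hC.1 f g
  have himg : i '' Set.range f = j '' Set.range g := by
    rw [← Set.range_comp, ← Set.range_comp]
    congr 1
    exact funext hcomm
  have hmem : ∀ d, d ∈ Set.range i ∨ d ∈ Set.range j := by
    intro d
    have : d ∈ Set.range i ∪ Set.range j := hunion ▸ Set.mem_univ d
    exact this
  have hmemi : ∀ d, d ∈ i '' Set.range f ↔ d ∈ Set.range i ∧ d ∈ Set.range j := by
    intro d; rw [← hinter]; rfl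
  -- By modularity over the common part, the change in predimension from `Y ∩ C` to `Y` equals the
  -- change from `Y ∩ A` to `Y ∩ B`. Thus closedness of `A` in `B` gives closedness of `C` in `D`;
  -- the last clause exchanges the roles of `B` and `C`.
  have hi : ∀ t, TClosed k α t (Set.range i) := by
    intro t X Y hXY _
    have hX : X = Y.filter (· ∈ Set.range i) := by
      rw [← Finset.coe_inj, hXY]; ext; simp
    have h1 := hY Y
    have h2 : predim k α (Y.filter (· ∈ i '' Set.range f)) ≤
        predim k α (Y.filter (· ∈ Set.range j)) := by
      refine (hg (Y.filter (· ∈ Set.range j)).card).predim_le_of_subset_range j ?_ ?_ (by omega)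
      · intro d hd; exact (Finset.mem_filter.1 hd).2
      · ext d
        simp only [Finset.coe_filter, ← himg, Set.mem_ofPred_eq, Set.mem_inter_iff, hmemi]
        tauto
    rw [hX]
    linarith
  refine ⟨D, iD, fD, i, j, ⟨hD, fun Y => ?_⟩, hcomm, hi, ?_⟩
  · have h1 := hi Y.card (Y.filter (· ∈ Set.range i)) Y (by ext; simp) (by omega)
    refine le_trans ?_ h1
    have h2 := (tClosed_univ (k := k) (α := α) (M := C) 0)
    have : (((Y.filter (· ∈ Set.range i)).preimage i i.injective.injOn).map i.toEmbedding) =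
        Y.filter (· ∈ Set.range i) := by
      ext z
      simp only [Finset.mem_map, Finset.mem_preimage, Finset.mem_filter]
      constructor
      · rintro ⟨x, hx, rfl⟩; exact hx
      · rintro ⟨hz, x, rfl⟩
        exact ⟨x, ⟨hz, x, rfl⟩, rfl⟩
    rw [← this, predim_map]
    exact hC.2 _
  · intro t ht X Y hXY hc
    have hX : X = Y.filter (· ∈ Set.range j) := by
      rw [← Finset.coe_inj, hXY]; ext; simp
    have h1 := hY Y
    have h2 : predim k α (Y.filter (· ∈ i '' Set.range f)) ≤
        predim k α (Y.filter (· ∈ Set.range i)) := by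
      refine ht.predim_le_of_subset_range i ?_ ?_ ?_
      · intro d hd; exact (Finset.mem_filter.1 hd).2
      · ext d
        simp only [Finset.coe_filter, Set.mem_ofPred_eq, Set.mem_inter_iff, hmemi]
        tauto
      · have e1 := Finset.card_union_add_card_inter (Y.filter (· ∈ Set.range i))
          (Y.filter (· ∈ Set.range j))
        have e2 : Y.filter (· ∈ Set.range i) ∪ Y.filter (· ∈ Set.range j) = Y := by
          ext d
          have := hmem d
          simp only [Finset.mem_union, Finset.mem_filter]
          tauto
        have e3 : Y.filter (· ∈ Set.range i) ∩ Y.filter (· ∈ Set.range j) =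
            Y.filter (· ∈ i '' Set.range f) := by
          ext d
          simp only [Finset.mem_inter, Finset.mem_filter, hmemi]
          tauto
        rw [e2, e3] at e1
        rw [hX] at hc
        omega
    rw [hX]
    linarith

end Amalgam

/-! ### Generic structures are semigeneric. -/

section Generic

variable {p : ℕ} {k : Fin p → ℕ} {α : Fin p → ℝ} {M : Type} [(lang k).Structure M]

/-- The members of an exhausting `≤_s`-chain are closed. -/
theorem tClosed_of_chain (hα : ∀ i, 0 < α i) (hM : InClass k α M) {A : ℕ → Finset M}
    (hA : ∀ n, IsStrong k α (A n : Set M) (A (n + 1) : Set M)) (hx : ∀ x, ∃ n, x ∈ A n) (n t : ℕ) :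
    TClosed k α t (A n : Set M) := by
  classical
  have hmono : Monotone A := monotone_nat_of_le_succ fun n => by
    exact_mod_cast (hA n).1
  have key : ∀ m (Y : Finset M), Y ⊆ A (n + m) → predim k α (Y ∩ A n) ≤ predim k α Y := by
    intro m
    induction m with
    | zero =>
      intro Y hY
      rw [Finset.inter_eq_left.2 (show Y ⊆ A n from hY)]
    | succ m ih =>
      intro Y hY
      have h1 := ((isStrong_iff hα hM).1 (hA (n + m))).2 (Y ∩ A (n + m)) Y (by simp)
        (by exact_mod_cast hY)
      have h2 := ih (Y ∩ A (n + m)) Finset.inter_subset_right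
      have h3 : Y ∩ A (n + m) ∩ A n = Y ∩ A n := by
        ext x
        simp only [Finset.mem_inter]
        have := @hmono n (n + m) (by omega) x
        tauto
      rw [h3] at h2
      exact h2.trans h1
  intro X Y hXY _
  choose N hN using hx
  have hX : X = Y ∩ A n := by rw [← Finset.coe_inj, hXY, Finset.coe_inter]
  rw [hX]
  refine key (Y.sup N) Y fun y hy => hmono ?_ (hN y)
  exact (Finset.le_sup hy).trans (by omega)

theorem exists_chain_superset {A : ℕ → Finset M} (hmono : Monotone A) (hx : ∀ x, ∃ n, x ∈ A n)
    {S : Set M} (hS : S.Finite) : ∃ n, S ⊆ A n := by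
  choose N hN using hx
  lift S to Finset M using hS
  exact ⟨S.sup N, fun y hy => hmono (Finset.le_sup hy) (hN y)⟩

/-- Generic structures are semigeneric. -/
theorem IsGeneric.semigeneric (hα : ∀ i, 0 < α i) (hM : IsGeneric k α M) : Semigeneric k α M := by
  refine ⟨hM.inClass, fun t u v A B _ _ _ _ hB f g hg _ htu hf => ?_⟩
  obtain ⟨A', hA', hx⟩ := hM.chain
  have hmono : Monotone A' := monotone_nat_of_le_succ fun n => by exact_mod_cast (hA' n).1
  obtain ⟨n, hn⟩ := exists_chain_superset hmono hx (Set.finite_range f)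
  let C := sub k (A' n : Set M)
  have fC : Finite C := (A' n).finite_toSet.to_subtype
  let f' : A ↪[lang k] C := embOfRel (fun a => ⟨f a, hn ⟨a, rfl⟩⟩)
    (fun a b h => f.injective (congrArg Subtype.val h)) (fun i c => by
      rw [← emb_relMap C.subtype, ← emb_relMap f]; rfl)
  have hC : InClass k α C := hM.inClass.of_embedding C.subtype
  -- The copy of `A` is only `u`-closed in `M`, so genericity does not apply to it directly. It
  -- applies to the strong set `A' n` containing it, and the amalgam carries `B` along as a
  -- `t`-closed subset.
  obtain ⟨D, iD, fD, i, j, hD, hcomm, hi, hj⟩ := exists_strong_amalgam hB hC f' g hg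
  have hCr : Set.range C.subtype = (A' n : Set M) := Subtype.range_coe
  obtain ⟨h, hh1, hh2⟩ := hM.extension C D hD C.subtype i
    ((isStrong_univ_iff hα hM.inClass (Set.finite_range _)).2 fun t =>
      hCr ▸ tClosed_of_chain hα hM.inClass hA' hx n t)
    ((isStrong_univ_iff hα hD (Set.finite_range _)).2 hi)
  have hhc := (isStrong_univ_iff hα hM.inClass (Set.finite_range _)).1 hh1
  refine ⟨h.comp j, ?_, fun a => ?_⟩
  · have : Set.range (h.comp j) = h '' Set.range j := by rw [← Set.range_comp]; rfl
    rw [this]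
    refine TClosed.trans_range h (hhc t) (hj t ?_)
    have hf' : Set.range f' = C.subtype ⁻¹' Set.range f := by
      ext z
      simp only [Set.mem_range, Set.mem_preimage]
      exact ⟨fun ⟨c, hc⟩ => ⟨c, hc ▸ rfl⟩, fun ⟨c, hc⟩ => ⟨c, Subtype.ext hc⟩⟩
    rw [hf']
    exact (hf.mono (by omega)).preimage _
  · change h (j (g a)) = f a
    rw [← hcomm, hh2]
    rfl

end Generic

/-! ### Finite stages and extension tasks for a generic structure. -/

section Existence

variable {p : ℕ} {k : Fin p → ℕ} {α : Fin p → ℝ}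

/-- The universe of a configuration, as a structure. -/
def Config.Carrier {n : ℕ} (_ : Config k n) : Type := Fin n

instance {n : ℕ} (G : Config k n) : (lang k).Structure G.Carrier := G.toStructure

instance {n : ℕ} (G : Config k n) : Fintype G.Carrier := inferInstanceAs (Fintype (Fin n))

instance {n : ℕ} (G : Config k n) : DecidableEq G.Carrier := inferInstanceAs (DecidableEq (Fin n))

/-- Every finite symmetric structure is isomorphic to a configuration. -/
theorem exists_config {B : Type} [(lang k).Structure B] [Finite B] (hB : IsSymmetric k B) :
    ∃ (n : ℕ) (G : Config k n) (e : B ≃ Fin n) (e₁ : B ↪[lang k] G.Carrier)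
      (e₂ : G.Carrier ↪[lang k] B), (∀ b, e₁ b = e b) ∧ ∀ x, e₂ x = e.symm x := by
  classical
  obtain ⟨n, ⟨e⟩⟩ := Finite.exists_equiv_fin B
  let G : Config k n := fun i =>
    Finset.univ.filter fun C => C.1.map e.symm.toEmbedding ∈ edges k B i
  have hG : ∀ i (C : Finset G.Carrier), C ∈ edges k G.Carrier i ↔
      C.map e.symm.toEmbedding ∈ edges k B i := by
    intro i C
    refine (mem_edges_toStructure G i C).trans ⟨?_, fun h => ?_⟩
    · rintro ⟨h, hC⟩; exact (Finset.mem_filter.1 hC).2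
    · exact ⟨(Finset.card_map _).symm.trans h.1, Finset.mem_filter.2 ⟨Finset.mem_univ _, h⟩⟩
  refine ⟨n, G, e, embOfEdges hB (isSymmetric_toStructure G) e.toEmbedding ?_,
    embOfEdges (isSymmetric_toStructure G) hB e.symm.toEmbedding ?_, fun b => rfl, fun x => rfl⟩
  · intro i C
    have h1 : (C.map e.toEmbedding).map e.symm.toEmbedding = C := by
      rw [Finset.map_map]
      have : (e.toEmbedding.trans e.symm.toEmbedding) = Function.Embedding.refl B := by
        ext b; simp
      rw [this, Finset.map_refl]
    exact (hG i _).trans (iff_of_eq (congrArg (· ∈ edges k B i) h1))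
  · intro i C
    exact (hG i C).symm

/-- A finite approximation of the generic structure: only the first `N` elements matter. -/
structure Stage (k : Fin p → ℕ) (α : Fin p → ℝ) where
  N : ℕ
  str : (lang k).Structure ℕ
  inClass : @InClass p k α ℕ str
  closed : ∀ t, @TClosed p k α ℕ str t {x | x < N}

/-- The universe of a stage, as a structure. -/
def Stage.Carrier (_ : Stage k α) : Type := ℕ

instance (P : Stage k α) : (lang k).Structure P.Carrier := P.str

/-- The substructure on the first `N` elements. -/
def Stage.base (P : Stage k α) : (lang k).Substructure P.Carrier :=
  sub k {x : ℕ | x < P.N}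

theorem Stage.finite_base (P : Stage k α) : Finite P.base := (Set.finite_lt_nat P.N).to_subtype

theorem Stage.range_base (P : Stage k α) : Set.range P.base.subtype = {x : ℕ | x < P.N} :=
  Subtype.range_coe

/-- Agreement on the first `P.N` elements, with the initial part remaining closed. -/
def Stage.Ext (P Q : Stage k α) : Prop :=
  P.N ≤ Q.N ∧ (∀ i (c : Fin (k i) → ℕ), (∀ j, c j < P.N) →
    (P.str.RelMap (sym k i) c ↔ Q.str.RelMap (sym k i) c)) ∧
      ∀ t, @TClosed p k α ℕ Q.str t {x | x < P.N}

/-- The inclusion of the initial part of a stage in an extension. -/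
def Stage.Ext.emb {P Q : Stage k α} (h : P.Ext Q) : P.base ↪[lang k] Q.Carrier :=
  embOfRel (fun x => (x.1 : ℕ)) (fun x y h => Subtype.ext h) (fun i c => by
    rw [← emb_relMap P.base.subtype]
    exact (h.2.1 i (fun j => (c j).1) fun j => (c j).2).symm)

theorem Stage.Ext.range_emb {P Q : Stage k α} (h : P.Ext Q) :
    Set.range h.emb = {x : ℕ | x < P.N} := by
  ext x
  exact ⟨fun ⟨y, hy⟩ => hy ▸ y.2, fun hx => ⟨⟨x, hx⟩, rfl⟩⟩

instance : Preorder (Stage k α) where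
  le P Q := P.Ext Q
  le_refl P := ⟨le_rfl, fun _ _ _ => Iff.rfl, P.closed⟩
  le_trans P Q R h₁ h₂ := by
    refine ⟨h₁.1.trans h₂.1, fun i c hc => (h₁.2.1 i c hc).trans
      (h₂.2.1 i c fun j => (hc j).trans_le h₁.1), fun t => ?_⟩
    have h3 : TClosed k α t ({x : ℕ | x < P.N} : Set Q.Carrier) := h₁.2.2 t
    have h4 : TClosed k α t (Set.range (Stage.Ext.emb h₂)) := by
      rw [Stage.Ext.range_emb]; exact h₂.2.2 t
    have h5 := TClosed.trans_range (Stage.Ext.emb h₂) h4 (h3.preimage Q.base.subtype)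
    have h6 : Stage.Ext.emb h₂ '' (Q.base.subtype ⁻¹' {x : ℕ | x < P.N}) = {x : ℕ | x < P.N} := by
      ext x
      constructor
      · rintro ⟨y, hy, rfl⟩; exact hy
      · intro hx; exact ⟨⟨x, lt_of_lt_of_le hx h₁.1⟩, hx, rfl⟩
    rw [h6] at h5
    exact h5

/-- Transport of a structure along an injection, without further relations. -/
@[reducible] def pushStructure {D V : Type} [(lang k).Structure D] (θ : D ↪ V) :
    (lang k).Structure V where
  funMap f := f.elim
  RelMap r c := ∃ c', c = θ ∘ c' ∧ Structure.RelMap r c'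

theorem isSymmetric_pushStructure {D V : Type} [(lang k).Structure D] (hD : IsSymmetric k D)
    (θ : D ↪ V) : @IsSymmetric p k V (pushStructure θ) := by
  let _ : (lang k).Structure V := pushStructure θ
  rintro i _ ⟨c, rfl, hc⟩
  obtain ⟨h1, h2⟩ := hD i c hc
  exact ⟨θ.injective.comp h1, fun σ => ⟨c ∘ σ, rfl, h2 σ⟩⟩

/-- A point outside the range of `θ` lies on no edge, so it merely adds one to the predimension. -/
theorem pushStructure_predim_le {D V : Type} [(lang k).Structure D] (θ : D ↪ V)
    {X Y : Finset V} (hXY : X ⊆ Y) (h : ∀ y ∈ Y, y ∈ Set.range θ → y ∈ X) :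
    @predim p k α V (pushStructure θ) X ≤ @predim p k α V (pushStructure θ) Y := by
  let _ : (lang k).Structure V := pushStructure θ
  have he : ∀ i, edgeCount k i X = edgeCount k i Y := by
    intro i
    simp only [edgeCount_eq_card]
    congr 1
    ext C
    simp only [mem_edgesIn]
    refine ⟨fun h => ⟨h.1.trans hXY, h.2⟩, fun hC => ⟨fun y hy => h y (hC.1 hy) ?_, hC.2⟩⟩
    obtain ⟨-, c, hc, c', rfl, -⟩ := hC.2
    have : y ∈ Set.range (θ ∘ c') := hc ▸ hy
    obtain ⟨j, rfl⟩ := this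
    exact ⟨c' j, rfl⟩
  unfold predim
  simp only [he]
  have := Finset.card_le_card hXY
  have : (X.card : ℝ) ≤ Y.card := by exact_mod_cast this
  linarith

/-- Amalgamation over a stage. -/
theorem Stage.exists_extend (P : Stage k α) {A B : Type} [(lang k).Structure A]
    [(lang k).Structure B] [Finite B] (hB : InClass k α B) (f : A ↪[lang k] P.base)
    (g : A ↪[lang k] B) (hg : ∀ t, TClosed k α t (Set.range g)) :
    ∃ Q : Stage k α, P ≤ Q ∧ P.N < Q.N ∧ ∃ j : B ↪[lang k] Q.Carrier,
      (∀ b, (show ℕ from j b) < Q.N) ∧ (∀ a, j (g a) = (f a).1) ∧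
      ((∀ t, TClosed k α t (Set.range f)) → ∀ t, TClosed k α t (Set.range j)) := by
  classical
  have := P.finite_base
  have hC : InClass k α P.base := InClass.of_embedding (N := P.Carrier) P.inClass P.base.subtype
  obtain ⟨D, iD, fD, i, j, hD, hcomm, hi, hj⟩ := exists_strong_amalgam hB hC f g hg
  obtain ⟨m, ⟨e⟩⟩ := Finite.exists_equiv_fin D
  -- The old base keeps its names, and the new points are placed at or beyond `P.N`.
  let θF : D → ℕ := fun d => if h : ∃ c, i c = d then h.choose.1 else P.N + (e d : ℕ)
  have hθi : ∀ c, θF (i c) = c.1 := by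
    intro c
    have h : ∃ c', i c' = i c := ⟨c, rfl⟩
    have h' : θF (i c) = h.choose.1 := dif_pos h
    rw [h', i.injective h.choose_spec]
  have hθn : ∀ d, d ∉ Set.range i → θF d = P.N + (e d : ℕ) := fun d h => dif_neg h
  have hinj : Function.Injective θF := by
    intro d d' h
    by_cases h1 : d ∈ Set.range i <;> by_cases h2 : d' ∈ Set.range i
    · obtain ⟨c, rfl⟩ := h1
      obtain ⟨c', rfl⟩ := h2
      rw [hθi, hθi] at h
      rw [Subtype.ext h]
    · obtain ⟨c, rfl⟩ := h1
      rw [hθi, hθn _ h2] at h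
      have h3 : (show ℕ from c.1) < P.N := c.2
      have h4 : (show ℕ from c.1) = P.N + (e d' : ℕ) := h
      omega
    · obtain ⟨c, rfl⟩ := h2
      rw [hθi, hθn _ h1] at h
      have h3 : (show ℕ from c.1) < P.N := c.2
      have h4 : P.N + (e d : ℕ) = (show ℕ from c.1) := h
      omega
    · rw [hθn _ h1, hθn _ h2] at h
      exact e.injective (Fin.ext (by omega))
  let θ : D ↪ ℕ := ⟨θF, hinj⟩
  have hθlt : ∀ d, θ d < P.N + m + 1 := by
    intro d
    change θF d < _
    by_cases h1 : d ∈ Set.range i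
    · obtain ⟨c, rfl⟩ := h1
      rw [hθi]
      have h3 : (show ℕ from c.1) < P.N := c.2
      exact h3.trans (by omega)
    · rw [hθn _ h1]
      have := (e d).2
      omega
  let S : (lang k).Structure ℕ := pushStructure θ
  let θL : D ↪[lang k] ℕ := embOfRel θ θ.injective (fun r c => by
    constructor
    · rintro ⟨c', h1, h2⟩
      rwa [θ.injective.comp_left h1]
    · exact fun h => ⟨c, rfl, h⟩)
  have hle : ∀ X Y : Finset ℕ, X ⊆ Y → (∀ y ∈ Y, y ∈ Set.range θ → y ∈ X) →
      predim k α X ≤ predim k α Y := fun X Y => pushStructure_predim_le θ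
  have hθc : ∀ t, TClosed k α t (Set.range θL) := by
    intro t X Y hXY _
    refine hle X Y ?_ ?_
    · rw [← Finset.coe_subset, hXY]; exact Set.inter_subset_left
    · intro y hy hy'
      have : y ∈ (X : Set ℕ) := hXY ▸ ⟨hy, hy'⟩
      exact this
  have hS : InClass k α ℕ := by
    refine ⟨isSymmetric_pushStructure hD.1 θ, fun Y => ?_⟩
    have h1 := hle (Y.filter (· ∈ Set.range θ)) Y (Finset.filter_subset _ _) (by
      intro y hy hy'; exact Finset.mem_filter.2 ⟨hy, hy'⟩)
    refine le_trans ?_ h1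
    have h2 : ((Y.preimage θ θ.injective.injOn).map θL.toEmbedding) =
        Y.filter (· ∈ Set.range θ) := by
      ext z
      simp only [Finset.mem_map, Finset.mem_preimage, Finset.mem_filter]
      constructor
      · rintro ⟨x, hx, rfl⟩; exact ⟨hx, x, rfl⟩
      · rintro ⟨hz, x, rfl⟩; exact ⟨x, hz, rfl⟩
    rw [← h2, predim_map]
    exact hD.2 _
  have himg : θL '' Set.range i = {x : ℕ | x < P.N} := by
    ext x
    constructor
    · rintro ⟨_, ⟨c, rfl⟩, rfl⟩
      change θF (i c) < P.N
      rw [hθi]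
      exact c.2
    · intro hx
      exact ⟨_, ⟨⟨x, hx⟩, rfl⟩, hθi _⟩
  -- The additional 1 makes the stage grow strictly even when `D` is empty; `Stage.exists_ge` relies
  -- on this.
  let Q : Stage k α := ⟨P.N + m + 1, S, hS, fun t X Y hXY _ => by
    refine hle X Y ?_ ?_
    · rw [← Finset.coe_subset, hXY]; exact Set.inter_subset_left
    · rintro y hy ⟨d, rfl⟩
      have : θ d ∈ (X : Set ℕ) := hXY ▸ ⟨hy, hθlt d⟩
      exact this⟩
  refine ⟨Q, ⟨by simp only [Q]; omega, ?_, ?_⟩, by simp only [Q]; omega, θL.comp j, ?_, ?_, ?_⟩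
  · intro r c hc
    let c' : Fin (k r) → P.base := fun x => ⟨c x, hc x⟩
    have h1 : P.str.RelMap (sym k r) c ↔ Structure.RelMap (sym k r) c' :=
      emb_relMap P.base.subtype r c'
    have h2 : Structure.RelMap (sym k r) (θL ∘ (i ∘ c')) ↔ Structure.RelMap (sym k r) c' :=
      (emb_relMap θL r _).trans (emb_relMap i r c')
    have h3 : θL ∘ (i ∘ c') = c := funext fun x => hθi (c' x)
    rw [h3] at h2
    exact h1.trans h2.symm
  · intro t
    have := TClosed.trans_range θL (hθc t) (hi t)
    rw [himg] at this
    exact this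
  · intro b; exact hθlt (j b)
  · intro a
    change θF (j (g a)) = _
    rw [← hcomm, hθi]
  · intro hf t
    have := TClosed.trans_range θL (hθc t) (hj t (hf t))
    rw [← Set.range_comp] at this
    exact this

theorem Stage.exists_ge (P : Stage k α) (n : ℕ) : ∃ Q : Stage k α, P ≤ Q ∧ n ≤ Q.N := by
  induction n with
  | zero => exact ⟨P, le_rfl, Nat.zero_le _⟩
  | succ n ih =>
    obtain ⟨Q, h1, h2⟩ := ih
    have := Q.finite_base
    obtain ⟨R, h3, h4, -⟩ := Q.exists_extend (B := Q.base)
      (InClass.of_embedding (N := Q.Carrier) Q.inClass Q.base.subtype) (Embedding.refl _ _)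
      (Embedding.refl _ _) (fun t => by
        have : Set.range (Embedding.refl (lang k) Q.base) = Set.univ :=
          Set.range_eq_univ.2 fun x => ⟨x, rfl⟩
        rw [this]; exact tClosed_univ t)
    exact ⟨R, h1.trans h3, by omega⟩

/-- The empty stage. -/
theorem Stage.nonempty (hα : ∀ i, 0 < α i) : Nonempty (Stage k α) := by
  let S : (lang k).Structure ℕ := ofEdges k fun _ => ∅
  have hS : InClass k α ℕ := by
    refine ⟨isSymmetric_ofEdges _, fun A => ?_⟩
    have : ∀ i, edgeCount k i A = 0 := by
      intro i
      rw [edgeCount_eq_card, Finset.card_eq_zero, Finset.eq_empty_iff_forall_notMem]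
      intro C hC
      exact ((mem_edges_ofEdges _ i C).1 (mem_edgesIn.1 hC).2).2
    simp [predim, this]
  refine ⟨⟨0, S, hS, fun t => ?_⟩⟩
  have : ({x | x < 0} : Set ℕ) = ∅ := by ext; simp
  rw [this]
  exact hS.tClosed_empty hα t

/-- Extension problems over finite subsets of `ℕ`. -/
abbrev Task (k : Fin p → ℕ) : Type := Σ n : ℕ, Config k n × Finset (Fin n) × (Fin n → ℕ)

/-- The task consists of a strong extension of a closed substructure of the stage. -/
def Task.Valid (τ : Task k) (P : Stage k α) : Prop :=
  InClass k α τ.2.1.Carrier ∧ (∀ t, TClosed k α t ({x | x ∈ τ.2.2.1} : Set τ.2.1.Carrier)) ∧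
    ∃ F : sub k ({x | x ∈ τ.2.2.1} : Set τ.2.1.Carrier) ↪[lang k] P.Carrier,
      (∀ x, F x = τ.2.2.2 x.1) ∧ ∀ t, TClosed k α t (Set.range F)

/-- The extension asked for is realized by a closed substructure of the stage. -/
def Task.Solved (τ : Task k) (P : Stage k α) : Prop :=
  ∃ j : τ.2.1.Carrier ↪[lang k] P.Carrier, (∀ x, (show ℕ from j x) < P.N) ∧
    (∀ x ∈ τ.2.2.1, j x = τ.2.2.2 x) ∧ ∀ t, TClosed k α t (Set.range j)

/-- Once the prescribed values lie in the base, a valid task is solved by amalgamation over the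
stage, and an invalid one asks for nothing. -/
theorem Task.isCofinal (τ : Task k) : IsCofinal {P : Stage k α |
    (∀ x ∈ τ.2.2.1, τ.2.2.2 x < P.N) ∧ (τ.Valid P → τ.Solved P)} := by
  intro P
  obtain ⟨P', h1, h2⟩ := P.exists_ge (τ.2.2.1.sup τ.2.2.2 + 1)
  have h3 : ∀ x ∈ τ.2.2.1, τ.2.2.2 x < P'.N := fun x hx =>
    lt_of_lt_of_le (Nat.lt_succ_of_le (Finset.le_sup hx)) h2
  by_cases hv : τ.Valid P'
  · obtain ⟨hB, hA, F, hF, hFc⟩ := hv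
    let A := sub k ({x | x ∈ τ.2.2.1} : Set τ.2.1.Carrier)
    let f : A ↪[lang k] P'.base := embOfRel
      (fun x => ⟨F x, show F x ∈ {x : ℕ | x < P'.N} by rw [hF]; exact h3 _ x.2⟩)
      (fun x y h => F.injective (congrArg Subtype.val h)) (fun i c => by
        rw [← emb_relMap P'.base.subtype, ← emb_relMap F]; rfl)
    have hAr : Set.range A.subtype = {x | x ∈ τ.2.2.1} := Subtype.range_coe
    have hfr : Set.range f = P'.base.subtype ⁻¹' Set.range F := by
      ext z
      simp only [Set.mem_range, Set.mem_preimage]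
      exact ⟨fun ⟨c, hc⟩ => ⟨c, hc ▸ rfl⟩, fun ⟨c, hc⟩ => ⟨c, Subtype.ext hc⟩⟩
    obtain ⟨Q, hQ1, hQ2, j, hj1, hj2, hj3⟩ := P'.exists_extend hB f A.subtype (hAr ▸ hA)
    refine ⟨Q, ⟨fun x hx => (h3 x hx).trans hQ2, fun _ => ⟨j, hj1, fun x hx => ?_, ?_⟩⟩,
      h1.trans hQ1⟩
    · rw [← hF ⟨x, hx⟩]
      exact hj2 ⟨x, hx⟩
    · exact hj3 fun t => hfr ▸ (hFc t).preimage _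
  · exact ⟨P', ⟨h3, fun h => absurd h hv⟩, h1⟩

end Existence

/-! ### The limit of the stages is generic. -/

section Limit

variable {p : ℕ} {k : Fin p → ℕ} {α : Fin p → ℝ}

/-- The union of a sequence of stages. -/
@[reducible] def limitStructure (P : ℕ → Stage k α) : (lang k).Structure ℕ where
  funMap f := f.elim
  RelMap r c := ∃ n, (∀ j, c j < (P n).N) ∧ (P n).str.RelMap r c

theorem limitStructure_relMap_iff {P : ℕ → Stage k α} (hP : Monotone P) (n : ℕ) (i : Fin p)
    (c : Fin (k i) → ℕ) (hc : ∀ j, c j < (P n).N) :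
    (limitStructure P).RelMap (sym k i) c ↔ (P n).str.RelMap (sym k i) c := by
  refine ⟨fun ⟨m, hm, h⟩ => ?_, fun h => ⟨n, hc, h⟩⟩
  rcases le_total n m with h1 | h1
  · exact ((hP h1).2.1 i c hc).2 h
  · exact ((hP h1).2.1 i c hm).1 h

/-- A sequence of stages meeting all tasks yields a generic structure. -/
theorem exists_isGeneric (hα : ∀ i, 0 < α i) :
    ∃ (M : Type) (_ : (lang k).Structure M), IsGeneric k α M := by
  classical
  obtain ⟨P₀⟩ := Stage.nonempty (k := k) hα
  have hct : Countable (Task k) := inferInstance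
  let _ : Encodable (Task k) := Encodable.ofCountable _
  let 𝒟 : Task k → Order.Cofinal (Stage k α) := fun τ => ⟨_, τ.isCofinal⟩
  let P : ℕ → Stage k α := Order.sequenceOfCofinals P₀ 𝒟
  have hP : Monotone P := Order.sequenceOfCofinals.monotone P₀ 𝒟
  have hτ : ∀ τ : Task k, ∃ n, (∀ x ∈ τ.2.2.1, τ.2.2.2 x < (P n).N) ∧
      (τ.Valid (P n) → τ.Solved (P n)) := fun τ =>
    ⟨_, Order.sequenceOfCofinals.encode_mem P₀ 𝒟 τ⟩
  have hunb : ∀ x, ∃ n, x < (P n).N := by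
    intro x
    -- Only the first clause of this one-point task matters: it forces `x` into the base of some
    -- stage.
    obtain ⟨n, hn, -⟩ := hτ ⟨1, fun _ => ∅, Finset.univ, fun _ => x⟩
    exact ⟨n, hn 0 (Finset.mem_univ _)⟩
  have hNmono : Monotone fun n => (P n).N := fun n m h => (hP h).1
  have hfin : ∀ Y : Finset ℕ, ∀ n₀, ∃ n ≥ n₀, ∀ y ∈ Y, y < (P n).N := by
    intro Y n₀
    choose N hN using hunb
    exact ⟨max n₀ (Y.sup N), le_max_left _ _, fun y hy =>
      lt_of_lt_of_le (hN y) (hNmono ((Finset.le_sup hy).trans (le_max_right _ _)))⟩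
  let S : (lang k).Structure ℕ := limitStructure P
  let emb : ∀ n, (P n).base ↪[lang k] ℕ := fun n => embOfRel (fun x => (x.1 : ℕ))
    (fun x y h => Subtype.ext h) (fun i c => by
      rw [← emb_relMap (P n).base.subtype]
      exact limitStructure_relMap_iff hP n i (fun j => (c j).1) fun j => (c j).2)
  have hembr : ∀ n, Set.range (emb n) = {x : ℕ | x < (P n).N} := by
    intro n
    ext x
    exact ⟨fun ⟨y, hy⟩ => hy ▸ y.2, fun hx => ⟨⟨x, hx⟩, rfl⟩⟩
  have hclass : InClass k α ℕ := by
    constructor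
    · rintro i c ⟨n, hn, h⟩
      obtain ⟨h1, h2⟩ := (P n).inClass.1 i c h
      exact ⟨h1, fun σ => ⟨n, fun j => hn (σ j), h2 σ⟩⟩
    · intro Y
      obtain ⟨n, -, hn⟩ := hfin Y 0
      have h1 : ((Y.preimage (emb n) (emb n).injective.injOn).map (emb n).toEmbedding) = Y := by
        ext z
        simp only [Finset.mem_map, Finset.mem_preimage]
        constructor
        · rintro ⟨x, hx, rfl⟩; exact hx
        · intro hz
          have : z ∈ Set.range (emb n) := by rw [hembr]; exact hn z hz
          obtain ⟨x, rfl⟩ := this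
          exact ⟨x, hz, rfl⟩
      rw [← h1, predim_map]
      exact (InClass.of_embedding (N := (P n).Carrier) (P n).inClass (P n).base.subtype).2 _
  -- A finite set lies in the base of some later stage, in which the earlier base was kept closed.
  have hclosed : ∀ n t, TClosed k α t (Set.range (emb n)) := by
    intro n t X Y hXY hc
    obtain ⟨m, hm, hY⟩ := hfin Y n
    have h1 : TClosed k α t ({x : ℕ | x < (P n).N} : Set (P m).Carrier) := (hP hm).2.2 t
    refine (h1.preimage (P m).base.subtype).predim_le_of_subset_range (emb m) ?_ ?_ hc
    · intro y hy; rw [hembr]; exact hY y hy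
    · rw [hXY, hembr]
      ext x
      simp only [Set.mem_inter_iff]
      refine and_congr_right fun hx => ⟨fun h => ⟨⟨x, hY x hx⟩, h, rfl⟩, ?_⟩
      rintro ⟨y, hy, rfl⟩
      exact hy
  refine ⟨ℕ, S, ⟨inferInstance, hclass, ?_, ?_⟩⟩
  · intro A B _ _ _ _ hB f g hf hg
    rw [isStrong_univ_iff hα hclass (Set.finite_range _)] at hf
    rw [isStrong_univ_iff hα hB (Set.finite_range _)] at hg
    obtain ⟨b, G, e, e₁, e₂, he₁, he₂⟩ := exists_config hB.1
    have hinj : Function.Injective fun a => e (g a) := e.injective.comp g.injective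
    -- The value 0 off the image of `A` is harmless, since validity and solutions look only at `As`.
    let f₀ : Fin b → ℕ := Function.extend (fun a => e (g a)) f fun _ => 0
    have hf₀ : ∀ a, f₀ (e (g a)) = f a := fun a => hinj.extend_apply _ _ a
    let As : Finset (Fin b) := Finset.univ.filter fun x => ∃ a, e (g a) = x
    let τ : Task k := ⟨b, G, As, f₀⟩
    obtain ⟨n, hn1, hn2⟩ := hτ τ
    have hAs : ∀ x, x ∈ As ↔ ∃ a, e (g a) = x := by simp [As]
    have hfn : ∀ a, f a < (P n).N := by
      intro a
      have := hn1 (e (g a)) ((hAs _).2 ⟨a, rfl⟩)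
      rwa [show τ.2.2.2 = f₀ from rfl, hf₀] at this
    have hG : InClass k α G.Carrier := hB.of_embedding e₂
    -- A strong copy of `A` in the limit is closed in the base of stage `n` by restriction, hence in
    -- the whole stage because that base is closed there. So every genuine extension problem is
    -- valid at the stage that handles it.
    have hval : τ.Valid (P n) := by
      refine ⟨hG, fun t => ?_, ?_⟩
      · have h1 : ({x | x ∈ As} : Set G.Carrier) = e₂ ⁻¹' Set.range g := by
          ext x
          refine (hAs x).trans ?_
          simp only [Set.mem_preimage, Set.mem_range, he₂]
          exact exists_congr fun a => (Equiv.eq_symm_apply e).symm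
        exact h1 ▸ (hg t).preimage e₂
      · have hA : ∀ x : sub k ({x | x ∈ As} : Set G.Carrier), ∃ a, e (g a) = x.1 := fun x =>
          (hAs x.1).1 x.2
        choose a ha using hA
        let F : sub k ({x | x ∈ As} : Set G.Carrier) ↪[lang k] (P n).Carrier :=
          embOfRel (fun x => f (a x)) (fun x y h => by
              have h1 : a x = a y := f.injective h
              exact Subtype.ext ((ha x).symm.trans (h1 ▸ ha y))) (fun i c => by
            have h1 : (P n).str.RelMap (sym k i) (fun j => f (a (c j))) ↔
                S.RelMap (sym k i) (fun j => f (a (c j))) :=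
              (limitStructure_relMap_iff hP n i _ fun j => hfn _).symm
            have h2 : S.RelMap (sym k i) (fun j => f (a (c j))) ↔
                Structure.RelMap (sym k i) (fun j => a (c j)) := emb_relMap f i _
            have h3 := emb_relMap (e₁.comp g) i (fun j => a (c j))
            have h4 : e₁.comp g ∘ (fun j => a (c j)) =
                (sub k ({x | x ∈ As} : Set G.Carrier)).subtype ∘ c :=
              funext fun j => (he₁ _).trans (ha (c j))
            rw [h4, emb_relMap] at h3
            exact h1.trans (h2.trans h3.symm))
        refine ⟨F, fun x => ?_, fun t => ?_⟩
        · change f (a x) = f₀ x.1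
          rw [← ha x, hf₀]
        · have h1 := (hf t).preimage (emb n)
          have h2 : TClosed k α t (Set.range (P n).base.subtype) := by
            rw [Stage.range_base]; exact (P n).closed t
          have h3 := TClosed.trans_range (P n).base.subtype h2 h1
          have h4 : (P n).base.subtype '' (emb n ⁻¹' Set.range f) = Set.range F := by
            ext x
            constructor
            · rintro ⟨y, ⟨a', ha'⟩, rfl⟩
              refine ⟨⟨e (g a'), (hAs _).2 ⟨a', rfl⟩⟩, ?_⟩
              have : a ⟨e (g a'), (hAs _).2 ⟨a', rfl⟩⟩ = a' := hinj (ha _)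
              change f (a _) = y.1
              rw [this]
              exact ha'
            · rintro ⟨y, rfl⟩
              exact ⟨⟨f (a y), hfn _⟩, ⟨a y, rfl⟩, rfl⟩
          rw [h4] at h3
          exact h3
    obtain ⟨j, hj1, hj2, hj3⟩ := hn2 hval
    let j' : G.Carrier ↪[lang k] (P n).base := embOfRel (fun x => ⟨j x, hj1 x⟩)
      (fun x y h => j.injective (congrArg Subtype.val h)) (fun i c => by
        rw [← emb_relMap (P n).base.subtype]
        exact emb_relMap j i c)
    refine ⟨(emb n).comp (j'.comp e₁), ?_, fun a => ?_⟩
    · rw [isStrong_univ_iff hα hclass (Set.finite_range _)]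
      intro t
      have h1 := TClosed.trans_range (emb n) (hclosed n t) ((hj3 t).preimage (P n).base.subtype)
      have h2 : emb n '' ((P n).base.subtype ⁻¹' Set.range j) =
          Set.range ((emb n).comp (j'.comp e₁)) := by
        ext x
        constructor
        · rintro ⟨y, ⟨z, hz⟩, rfl⟩
          refine ⟨e.symm z, ?_⟩
          have hz' : e₁ (e.symm z) = z := (he₁ _).trans (e.apply_symm_apply z)
          change emb n (j' (e₁ (e.symm z))) = emb n y
          rw [hz']
          exact congrArg (emb n) (Subtype.ext hz)
        · rintro ⟨y, rfl⟩
          exact ⟨j' (e₁ y), ⟨e₁ y, rfl⟩, rfl⟩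
      rw [h2] at h1
      exact h1
    · change j (e₁ (g a)) = f a
      rw [he₁]
      exact (hj2 (e (g a)) ((hAs _).2 ⟨a, rfl⟩)).trans (hf₀ a)
  · refine ⟨fun n => Finset.range (P n).N, fun n => ?_, fun x => ?_⟩
    · rw [isStrong_iff hα hclass]
      refine ⟨?_, fun X Y hXY _ => ?_⟩
      · exact_mod_cast Finset.range_mono (hNmono n.le_succ)
      · refine hclosed n Y.card X Y ?_ (by omega)
        rw [hXY, hembr]
        ext; simp
    · obtain ⟨n, hn⟩ := hunb x
      exact ⟨n, Finset.mem_range.2 hn⟩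

end Limit

/-! ### Definability of closedness, axioms, and near model completeness. -/

section Definability

variable {L : FirstOrder.Language.{0, 0}} {β : Type}

theorem isQF_iInf {ι : Type} [Finite ι] {n : ℕ} {f : ι → L.BoundedFormula β n}
    (h : ∀ i, (f i).IsQF) : (BoundedFormula.iInf f).IsQF := by
  unfold BoundedFormula.iInf
  extract_lets _
  generalize (Finset.univ : Finset ι).toList = l
  induction l with
  | nil => exact BoundedFormula.IsQF.top
  | cons a l ih => exact (h a).inf ih

theorem isQF_iSup {ι : Type} [Finite ι] {n : ℕ} {f : ι → L.BoundedFormula β n}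
    (h : ∀ i, (f i).IsQF) : (BoundedFormula.iSup f).IsQF := by
  unfold BoundedFormula.iSup
  extract_lets _
  generalize (Finset.univ : Finset ι).toList = l
  induction l with
  | nil => exact BoundedFormula.isQF_bot
  | cons a l ih => exact (h a).sup ih

theorem isBoolCombExistential_iInf {ι : Type} [Finite ι] {f : ι → L.Formula β}
    (h : ∀ i, IsBoolCombExistential (f i)) : IsBoolCombExistential (Formula.iInf f) := by
  unfold Formula.iInf BoundedFormula.iInf
  extract_lets _
  generalize (Finset.univ : Finset ι).toList = l
  induction l with
  | nil => exact .existential BoundedFormula.IsQF.top.isExistential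
  | cons a l ih => exact .and (h a) ih

theorem isBoolCombExistential_iSup {ι : Type} [Finite ι] {f : ι → L.Formula β}
    (h : ∀ i, IsBoolCombExistential (f i)) : IsBoolCombExistential (Formula.iSup f) := by
  unfold Formula.iSup BoundedFormula.iSup
  extract_lets _
  generalize (Finset.univ : Finset ι).toList = l
  induction l with
  | nil => exact .existential BoundedFormula.isQF_bot.isExistential
  | cons a l ih => exact .or (h a) ih

theorem isExistential_exs {n : ℕ} {φ : L.BoundedFormula β n} (h : φ.IsExistential) :
    BoundedFormula.IsExistential φ.exs := by
  induction n with
  | zero => exact h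
  | succ n ih => exact ih h.ex

theorem isExistential_iExs {γ : Type} [Finite γ] {φ : L.Formula (β ⊕ γ)}
    (h : BoundedFormula.IsQF φ) : BoundedFormula.IsExistential (φ.iExs γ) :=
  isExistential_exs (h.relabel _).isExistential

/-- A formula whose truth in models of `T` is determined by the truth values of finitely many
existential formulas is equivalent to a Boolean combination of them. -/
theorem exists_boolComb_iff {T : L.Theory} {m : ℕ} {J : Type} [Finite J] (ψ : J → L.Formula (Fin m))
    (hψ : ∀ j, BoundedFormula.IsExistential (ψ j)) (φ : L.Formula (Fin m))
    (h : ∀ (M N : Type) [L.Structure M] [L.Structure N] [Nonempty M] [Nonempty N], M ⊨ T → N ⊨ T →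
      ∀ (x : Fin m → M) (y : Fin m → N), (∀ j, (ψ j).Realize x ↔ (ψ j).Realize y) →
        φ.Realize x → φ.Realize y) :
    ∃ χ : L.Formula (Fin m), IsBoolCombExistential χ ∧ T.Iff φ χ := by
  classical
  let lit : Set J → J → L.Formula (Fin m) := fun s j => if j ∈ s then ψ j else (ψ j).not
  -- These are the sign patterns realized together with `φ`. There are finitely many, and `φ` is
  -- equivalent to the disjunction of their conjunctions of literals.
  let G : Set (Set J) := {s | ∃ (M : Type) (_ : L.Structure M) (_ : Nonempty M) (_ : M ⊨ T)
    (x : Fin m → M), φ.Realize x ∧ s = {j | (ψ j).Realize x}}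
  refine ⟨Formula.iSup fun s : G => Formula.iInf fun j => lit s.1 j, ?_, ?_⟩
  · refine isBoolCombExistential_iSup fun s => isBoolCombExistential_iInf fun j => ?_
    simp only [lit]
    split_ifs
    · exact .existential (hψ j)
    · exact .not (.existential (hψ j))
  · have hlit : ∀ (M : Type) [L.Structure M] (x : Fin m → M) (s : Set J),
        (∀ j, (lit s j).Realize x) ↔ s = {j | (ψ j).Realize x} := by
      intro M _ x s
      rw [Set.ext_iff]
      refine forall_congr' fun j => ?_
      by_cases hj : j ∈ s
      · simp [lit, hj]
      · simp [lit, hj, Formula.realize_not]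
    refine fun M v xs => ?_
    rw [BoundedFormula.realize_iff]
    rw [Subsingleton.elim xs default]
    change φ.Realize v ↔ (Formula.iSup fun s : G => Formula.iInf fun j => lit s.1 j).Realize v
    rw [Formula.realize_iSup]
    simp only [Formula.realize_iInf, hlit]
    constructor
    · intro hφ
      exact ⟨⟨_, M, inferInstance, inferInstance, M.is_model, v, hφ, rfl⟩, rfl⟩
    · rintro ⟨⟨s, N, _, _, hN, y, hy, rfl⟩, hs⟩
      exact h N M hN M.is_model y v (fun j => Set.ext_iff.1 hs j) hy

variable {p : ℕ} {k : Fin p → ℕ} {α : Fin p → ℝ}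

/-- Indices for the atomic formulas in the variables `ι`. -/
abbrev Atoms (k : Fin p → ℕ) (ι : Type) : Type := (ι × ι) ⊕ (Σ r : Fin p, Fin (k r) → ι)

/-- The atomic formula with a given index. -/
def atomFormula {ι : Type} : Atoms k ι → (lang k).Formula ι
  | .inl q => Term.equal (Term.var q.1) (Term.var q.2)
  | .inr q => (sym k q.1).formula fun j => Term.var (q.2 j)

/-- The set of atomic formulas satisfied by a tuple. -/
def atomicType (k : Fin p → ℕ) {ι M : Type} [(lang k).Structure M] (x : ι → M) :
    Set (Atoms k ι) :=
  {a | (atomFormula a).Realize x}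

theorem isQF_atomFormula {ι : Type} (a : Atoms k ι) : BoundedFormula.IsQF (atomFormula a) := by
  rcases a with q | q
  · exact (BoundedFormula.IsAtomic.equal _ _).isQF
  · exact (BoundedFormula.IsAtomic.rel _ _).isQF

theorem sameAtomic_of_eq {ι M N : Type} [(lang k).Structure M] [(lang k).Structure N] {x : ι → M}
    {y : ι → N} (h : atomicType k x = atomicType k y) : SameAtomic k x y := by
  have h' : ∀ a : Atoms k ι, (atomFormula a).Realize x ↔ (atomFormula a).Realize y :=
    fun a => Set.ext_iff.1 h a
  refine ⟨fun i j => ?_, fun r c => ?_⟩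
  · simpa [atomFormula] using h' (.inl (i, j))
  · have := h' (.inr ⟨r, c⟩)
    simp only [atomFormula, Formula.realize_rel, Term.realize_var] at this
    exact this

/-- Properties of finite tuples depending only on the atomic type are quantifier-free definable. -/
theorem exists_qf_formula {ι : Type} [Finite ι]
    (Q : ∀ (M : Type) [(lang k).Structure M], (ι → M) → Prop)
    (hQ : ∀ (M N : Type) [(lang k).Structure M] [(lang k).Structure N] (x : ι → M) (y : ι → N),
      SameAtomic k x y → Q M x → Q N y) :
    ∃ φ : (lang k).Formula ι, BoundedFormula.IsQF φ ∧
      ∀ (M : Type) [(lang k).Structure M] (x : ι → M), φ.Realize x ↔ Q M x := by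
  classical
  let lit : Set (Atoms k ι) → Atoms k ι → (lang k).Formula ι := fun s a =>
    if a ∈ s then atomFormula a else (atomFormula a).not
  -- The language and the tuple are finite, so there are finitely many atomic types and the
  -- disjunction over those allowed by `Q` is a formula.
  let G : Set (Set (Atoms k ι)) := {s | ∃ (M : Type) (_ : (lang k).Structure M) (x : ι → M),
    Q M x ∧ s = atomicType k x}
  refine ⟨Formula.iSup fun s : G => Formula.iInf fun j => lit s.1 j, ?_, ?_⟩
  · refine isQF_iSup fun s => isQF_iInf fun a => ?_
    simp only [lit]
    split_ifs
    · exact isQF_atomFormula a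
    · exact (isQF_atomFormula a).not
  · intro M _ x
    have hlit : ∀ s : Set (Atoms k ι),
        (∀ a, (lit s a).Realize x) ↔ s = atomicType k x := by
      intro s
      rw [Set.ext_iff]
      refine forall_congr' fun j => ?_
      by_cases hj : j ∈ s
      · simp [lit, hj, atomicType]
      · simp [lit, hj, Formula.realize_not, atomicType]
    simp only [Formula.realize_iSup, Formula.realize_iInf, hlit]
    constructor
    · rintro ⟨⟨s, N, _, y, hy, rfl⟩, hs⟩
      exact hQ N M y x (sameAtomic_of_eq hs) hy
    · intro h
      exact ⟨⟨_, M, inferInstance, x, h, rfl⟩, rfl⟩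

theorem exists_universal_sentence {ι : Type} [Finite ι]
    (Q : ∀ (M : Type) [(lang k).Structure M], (ι → M) → Prop)
    (hQ : ∀ (M N : Type) [(lang k).Structure M] [(lang k).Structure N] (x : ι → M) (y : ι → N),
      SameAtomic k x y → Q M x → Q N y) :
    ∃ σ : (lang k).Sentence, ∀ (M : Type) [(lang k).Structure M], M ⊨ σ ↔ ∀ x, Q M x := by
  obtain ⟨φ, -, hφ⟩ := exists_qf_formula Q hQ
  refine ⟨(φ.relabel Sum.inr : (lang k).Formula (Empty ⊕ ι)).iAlls ι, fun M _ => ?_⟩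
  simp only [Sentence.Realize, Formula.realize_iAlls, Formula.realize_relabel, hφ]
  rfl

/-- `t`-closedness of finite tuples is definable. -/
theorem exists_tClosed_formula (hα : ∀ i, 0 < α i) (ι : Type) [Finite ι] (t : ℕ) :
    ∃ φ : (lang k).Formula ι, ∀ (M : Type) [(lang k).Structure M] (x : ι → M),
      φ.Realize x ↔ TClosed k α t (Set.range x) := by
  classical
  have := Fintype.ofFinite ι
  have h1 : ∀ s : ℕ, ∃ φ : (lang k).Formula (ι ⊕ Fin s), ∀ (M : Type) [(lang k).Structure M]
      (x : ι ⊕ Fin s → M), φ.Realize x ↔ predim k α (Finset.univ.image (x ∘ Sum.inl)) ≤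
        predim k α (Finset.univ.image x) := by
    intro s
    obtain ⟨φ, -, hφ⟩ := exists_qf_formula (k := k) (ι := ι ⊕ Fin s)
      (fun M _ x => predim k α (Finset.univ.image (x ∘ Sum.inl)) ≤
        predim k α (Finset.univ.image x)) (by
        intro M N _ _ x y hxy h
        rwa [← (hxy.comp Sum.inl).predim_image_eq, ← hxy.predim_image_eq])
    exact ⟨φ, hφ⟩
  choose φ hφ using h1
  refine ⟨Formula.iInf fun s : Fin (t + 1) => (φ s).iAlls (Fin s), fun M _ x => ?_⟩
  have hr : Set.range x = ((Finset.univ.image x : Finset M) : Set M) := by simp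
  rw [hr, tClosed_coe_iff hα]
  simp only [Formula.realize_iInf, Formula.realize_iAlls, hφ]
  have himg : ∀ (s : ℕ) (z : Fin s → M), Finset.univ.image (Sum.elim x z) =
      Finset.univ.image x ∪ Finset.univ.image z := by
    intro s z
    ext a
    simp
  constructor
  · intro h F hF
    have := h ⟨F.card, by omega⟩ (Subtype.val ∘ F.equivFin.symm)
    have hF' : Finset.univ.image (Subtype.val ∘ F.equivFin.symm) = F := by
      rw [← Finset.coe_inj, Finset.coe_image, Finset.coe_univ, Set.image_univ, Set.range_comp,
        F.equivFin.symm.surjective.range_eq, Set.image_univ]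
      exact Subtype.range_coe
    rwa [himg, hF', Sum.elim_comp_inl] at this
  · intro h s z
    rw [himg, Sum.elim_comp_inl]
    exact h _ (Finset.card_image_le.trans (by simpa using Nat.le_of_lt_succ s.2))

theorem exists_embedding_formula (A : Type) [(lang k).Structure A] [Finite A] :
    ∃ φ : (lang k).Formula A, ∀ (M : Type) [(lang k).Structure M] (x : A → M),
      φ.Realize x ↔ ∃ f : A ↪[lang k] M, ⇑f = x := by
  obtain ⟨φ, -, hφ⟩ := exists_qf_formula (k := k) (ι := A)
    (fun M _ x => ∃ f : A ↪[lang k] M, ⇑f = x) (by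
      rintro M N _ _ _ y hxy ⟨f, rfl⟩
      refine ⟨embOfRel y (fun a b h => f.injective ((hxy.1 a b).2 h)) fun i c => ?_, rfl⟩
      rw [← hxy.2, emb_relMap])
  exact ⟨φ, hφ⟩

/-- The extension property for a pair `A ⊆ B` and numbers `t`, `u` is a first-order property. -/
theorem exists_extension_sentence (hα : ∀ i, 0 < α i) {A B : Type} [(lang k).Structure A]
    [(lang k).Structure B] [Finite A] [Finite B] (g : A ↪[lang k] B) (t u : ℕ) :
    ∃ σ : (lang k).Sentence, ∀ (M : Type) [(lang k).Structure M], M ⊨ σ ↔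
      ∀ f : A ↪[lang k] M, TClosed k α u (Set.range f) →
        ∃ h : B ↪[lang k] M, TClosed k α t (Set.range h) ∧ ∀ a, h (g a) = f a := by
  obtain ⟨eA, heA⟩ := exists_embedding_formula (k := k) A
  obtain ⟨eB, heB⟩ := exists_embedding_formula (k := k) B
  obtain ⟨cA, hcA⟩ := exists_tClosed_formula (k := k) hα A u
  obtain ⟨cB, hcB⟩ := exists_tClosed_formula (k := k) hα B t
  let ext : (lang k).Formula (A ⊕ B) :=
    (eB.relabel Sum.inr) ⊓ ((cB.relabel Sum.inr) ⊓
      Formula.iInf fun a => Term.equal (Term.var (Sum.inr (g a))) (Term.var (Sum.inl a)))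
  let body : (lang k).Formula A := (eA ⊓ cA).imp (ext.iExs B)
  refine ⟨(body.relabel Sum.inr : (lang k).Formula (Empty ⊕ A)).iAlls A, fun M _ => ?_⟩
  simp only [Sentence.Realize, Formula.realize_iAlls, Formula.realize_relabel, body, ext,
    Formula.realize_imp, Formula.realize_inf, Formula.realize_iExs, Formula.realize_iInf,
    Formula.realize_equal, Term.realize_var, heA, hcA, heB, hcB, Sum.elim_comp_inr, Sum.elim_inr,
    Sum.elim_inl]
  constructor
  · intro h f hf
    obtain ⟨y, ⟨⟨e, rfl⟩, h1, h2⟩⟩ := h f ⟨⟨f, rfl⟩, hf⟩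
    exact ⟨e, h1, h2⟩
  · rintro h _ ⟨⟨f, rfl⟩, hf⟩
    obtain ⟨e, h1, h2⟩ := h f hf
    exact ⟨e, ⟨e, rfl⟩, h1, h2⟩

/-- The axioms of semigeneric structures. -/
def semigenericTheory (k : Fin p → ℕ) (α : Fin p → ℝ) : (lang k).Theory :=
  {σ | (∀ (M : Type) [(lang k).Structure M], M ⊨ σ ↔ IsSymmetric k M) ∨
    (∃ s : ℕ, ∀ (M : Type) [(lang k).Structure M], M ⊨ σ ↔
      ∀ A : Finset M, A.card ≤ s → 0 ≤ predim k α A) ∨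
    ∃ (t u v : ℕ) (A B : Type) (_ : (lang k).Structure A) (_ : (lang k).Structure B)
      (_ : Finite A) (_ : Finite B) (g : A ↪[lang k] B), InClass k α B ∧
      (∀ t, TClosed k α t (Set.range g)) ∧ Nat.card B ≤ Nat.card A + v ∧ t + v ≤ u ∧
      ∀ (M : Type) [(lang k).Structure M], M ⊨ σ ↔
        ∀ f : A ↪[lang k] M, TClosed k α u (Set.range f) →
          ∃ h : B ↪[lang k] M, TClosed k α t (Set.range h) ∧ ∀ a, h (g a) = f a}

theorem exists_symmetric_sentence : ∃ σ : (lang k).Sentence,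
    ∀ (M : Type) [(lang k).Structure M], M ⊨ σ ↔ IsSymmetric k M := by
  have h1 : ∀ i : Fin p, ∃ σ : (lang k).Sentence, ∀ (M : Type) [(lang k).Structure M], M ⊨ σ ↔
      ∀ c : Fin (k i) → M, Structure.RelMap (sym k i) c →
        Function.Injective c ∧ ∀ τ : Equiv.Perm (Fin (k i)), Structure.RelMap (sym k i) (c ∘ τ) := by
    intro i
    refine exists_universal_sentence (fun M _ c => Structure.RelMap (sym k i) c →
        Function.Injective c ∧ ∀ τ : Equiv.Perm (Fin (k i)), Structure.RelMap (sym k i) (c ∘ τ)) ?_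
    intro M N _ _ x y hxy h hy
    obtain ⟨h1, h2⟩ := h ((hxy.2 i id).2 hy)
    exact ⟨fun a b hab => h1 ((hxy.1 a b).2 hab), fun τ => (hxy.2 i τ).1 (h2 τ)⟩
  choose σ hσ using h1
  refine ⟨Formula.iInf σ, fun M _ => ?_⟩
  simp only [Sentence.Realize, Formula.realize_iInf] at hσ ⊢
  simp only [hσ]
  rfl

theorem exists_predim_sentence (s : ℕ) : ∃ σ : (lang k).Sentence,
    ∀ (M : Type) [(lang k).Structure M], M ⊨ σ ↔
      ∀ A : Finset M, A.card ≤ s → 0 ≤ predim k α A := by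
  classical
  have h1 : ∀ m : ℕ, ∃ σ : (lang k).Sentence, ∀ (M : Type) [(lang k).Structure M], M ⊨ σ ↔
      ∀ x : Fin m → M, 0 ≤ predim k α (Finset.univ.image x) := by
    intro m
    refine exists_universal_sentence
      (fun M _ (x : Fin m → M) => 0 ≤ predim k α (Finset.univ.image x)) ?_
    intro M N _ _ x y hxy h
    rwa [← hxy.predim_image_eq]
  choose σ hσ using h1
  refine ⟨Formula.iInf fun m : Fin (s + 1) => σ m, fun M _ => ?_⟩
  simp only [Sentence.Realize, Formula.realize_iInf] at hσ ⊢
  simp only [hσ]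
  constructor
  · intro h A hA
    have := h ⟨A.card, by omega⟩ (Subtype.val ∘ A.equivFin.symm)
    have hA' : Finset.univ.image (Subtype.val ∘ A.equivFin.symm) = A := by
      rw [← Finset.coe_inj, Finset.coe_image, Finset.coe_univ, Set.image_univ, Set.range_comp,
        A.equivFin.symm.surjective.range_eq, Set.image_univ]
      exact Subtype.range_coe
    rwa [hA'] at this
  · intro h m x
    exact h _ (Finset.card_image_le.trans (by simpa using Nat.le_of_lt_succ m.2))

theorem model_semigenericTheory_iff (hα : ∀ i, 0 < α i) {M : Type} [(lang k).Structure M] :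
    M ⊨ semigenericTheory k α ↔ Semigeneric k α M := by
  rw [Theory.model_iff]
  constructor
  · intro h
    refine ⟨⟨?_, fun A => ?_⟩, fun t u v A B _ _ _ _ hB f g hg hc htu hf => ?_⟩
    · obtain ⟨σ, hσ⟩ := exists_symmetric_sentence (k := k)
      exact (hσ M).1 (h σ (Or.inl hσ))
    · obtain ⟨σ, hσ⟩ := exists_predim_sentence (k := k) (α := α) A.card
      exact (hσ M).1 (h σ (Or.inr (Or.inl ⟨_, hσ⟩))) A le_rfl
    · obtain ⟨σ, hσ⟩ := exists_extension_sentence (k := k) hα g t u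
      exact (hσ M).1 (h σ (Or.inr (Or.inr ⟨t, u, v, A, B, _, _, inferInstance, inferInstance, g, hB,
        hg, hc, htu, hσ⟩))) f hf
  · rintro h σ (hσ | ⟨s, hσ⟩ | ⟨t, u, v, A, B, _, _, _, _, g, hB, hg, hc, htu, hσ⟩)
    · exact (hσ M).2 h.inClass.1
    · exact (hσ M).2 fun A _ => h.inClass.2 A
    · exact (hσ M).2 fun f hf => h.extension t u v A B hB f g hg hc htu hf

/-- Near model completeness of theories of semigeneric structures. -/
theorem nearlyModelComplete_of_semigeneric (hα : ∀ i, 0 < α i) {T : (lang k).Theory}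
    (hT : ∀ (M : Type) [(lang k).Structure M], M ⊨ T → Semigeneric k α M) :
    NearlyModelComplete T := by
  classical
  intro m φ
  obtain ⟨t, S, h⟩ := exists_realize_iff (k := k) hα φ
  obtain ⟨b, hb⟩ := exists_commonClosed (k := k) hα t m
  have h1 : ∀ (c : ℕ) (s : Set (Atoms k (Fin m ⊕ Fin c))),
      ∃ ψ : (lang k).Formula (Fin m ⊕ Fin c), BoundedFormula.IsQF ψ ∧
        ∀ (M : Type) [(lang k).Structure M] (x : Fin m ⊕ Fin c → M),
          ψ.Realize x ↔ atomicType k x = s := by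
    intro c s
    refine exists_qf_formula (fun M _ x => atomicType k x = s) ?_
    rintro M N _ _ x y hxy rfl
    ext (q | q)
    · simpa [atomicType, atomFormula] using (hxy.1 q.1 q.2).symm
    · simp only [atomicType, atomFormula, Set.mem_ofPred_eq, Formula.realize_rel, Term.realize_var]
      exact (hxy.2 q.1 q.2).symm
  choose ψ hψ1 hψ2 using h1
  -- The existential formulas say that the tuple extends by `c ≤ b` elements to a tuple of a given
  -- atomic type. Agreement on all of them is what `exists_commonClosed` requires.
  refine exists_boolComb_iff
    (J := Σ c : Fin (b + 1), Set (Atoms k (Fin m ⊕ Fin c)))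
    (fun j => (ψ j.1 j.2).iExs (Fin j.1)) (fun j => isExistential_iExs (hψ1 _ _)) φ ?_
  intro M N _ _ _ _ hM hN x y hxy hx
  simp only [Formula.realize_iExs, hψ2] at hxy
  have hC := hb M N (hT M hM).inClass (hT N hN).inClass x y (fun c hc z => by
    obtain ⟨w, hw⟩ := (hxy ⟨⟨c, by omega⟩, atomicType k (Sum.elim x z)⟩).1 ⟨z, rfl⟩
    exact ⟨w, sameAtomic_of_eq hw.symm⟩) (fun c hc w => by
    obtain ⟨z, hz⟩ := (hxy ⟨⟨c, by omega⟩, atomicType k (Sum.elim y w)⟩).2 ⟨w, rfl⟩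
    exact ⟨z, sameAtomic_of_eq hz⟩)
  refine (h M N (hT M hM) (hT N hN) x y _ _ (hC.mono le_rfl ?_)).1 hx
  rintro q (⟨i, -, rfl⟩ | ⟨j, rfl⟩)
  · exact ⟨i, rfl⟩
  · exact j.elim0

end Definability

/-! ### Realizing types in ultrapowers. -/

section Ultrapower

variable {L : FirstOrder.Language.{0, 0}} {M : Type} [L.Structure M]

/-- A type over a set of parameters is finitely satisfiable. -/
theorem exists_realize_finset (A : Set M) {m : ℕ}
    (q : (L[[A]].completeTheory M).CompleteType (Fin m)) (Δ : Finset (L[[A]][[Fin m]].Sentence))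
    (hΔ : ∀ φ ∈ Δ, φ ∈ q) :
    ∃ b : Fin m → M, ∀ φ ∈ Δ, (Formula.equivSentence.symm φ).Realize b := by
  obtain ⟨N, v, hv⟩ := Theory.exists_modelType_is_realized_in _ q
  have hN : ∀ φ ∈ Δ, (Formula.equivSentence.symm φ).Realize v := by
    intro φ hφ
    have := hΔ φ hφ
    rw [← hv] at this
    exact Theory.CompleteType.mem_typeOf.1 this
  let ψ : L[[A]].Formula (Empty ⊕ Fin m) :=
    (Formula.iInf fun φ : Δ => Formula.equivSentence.symm φ.1).relabel Sum.inr
  have h1 : N ⊨ ψ.iExs (Fin m) := by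
    simp only [Sentence.Realize, Formula.realize_iExs, ψ, Formula.realize_relabel,
      Formula.realize_iInf]
    exact ⟨v, fun φ => hN φ.1 φ.2⟩
  have h2 : M ⊨ ψ.iExs (Fin m) := by
    -- Otherwise the negation is in the complete theory of `M` with constants for `A`, and `N` is a
    -- model of that theory.
    by_contra hcon
    have h3 : (Formula.not (ψ.iExs (Fin m)) : L[[A]].Sentence) ∈ L[[A]].completeTheory M := by
      rw [mem_completeTheory]
      exact (Sentence.realize_not M).2 hcon
    exact (Sentence.realize_not N).1 (N.is_model.realize_of_mem _ h3) h1
  simp only [Sentence.Realize, Formula.realize_iExs, ψ, Formula.realize_relabel,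
    Formula.realize_iInf] at h2
  obtain ⟨b, hb⟩ := h2
  exact ⟨b, fun φ hφ => hb ⟨φ, hφ⟩⟩

/-- Every type over a set of parameters is realized in an ultrapower. -/
theorem exists_ultrapower_realization [Nonempty M] (A : Set M) {m : ℕ}
    (q : (L[[A]].completeTheory M).CompleteType (Fin m)) :
    ∃ (N : Type) (_ : L.Structure N) (j : M → N) (b : Fin m → N),
      (∀ (β : Type) (φ : L.Formula β) (x : β → M), φ.Realize (j ∘ x) ↔ φ.Realize x) ∧
      ∀ φ : L[[A]][[Fin m]].Sentence, φ ∈ q ↔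
        Formula.Realize (BoundedFormula.constantsVarsEquiv (Formula.equivSentence.symm φ))
          (Sum.elim (fun a : A => j a) b) := by
  classical
  let I := Finset {φ // φ ∈ q}
  -- The ultrafilter contains every cone of finite sets above a given formula, so the coordinatewise
  -- realizations `b Δ` satisfy each formula of `q` almost everywhere.
  let u : Ultrafilter I := Ultrafilter.of Filter.atTop
  have hu : (u : Filter I) ≤ Filter.atTop := Ultrafilter.of_le _
  have hb : ∀ Δ : I, ∃ b : Fin m → M, ∀ φ ∈ Δ, (Formula.equivSentence.symm φ.1).Realize b := by
    intro Δ
    obtain ⟨b, hb⟩ := exists_realize_finset A q (Δ.image Subtype.val) (by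
      intro φ hφ
      obtain ⟨φ', -, rfl⟩ := Finset.mem_image.1 hφ
      exact φ'.2)
    exact ⟨b, fun φ hφ => hb _ (Finset.mem_image_of_mem _ hφ)⟩
  choose b hb using hb
  let N := (u : Filter I).Product fun _ => M
  let j : M → N := fun a => ((fun _ => a : I → M) : (u : Filter I).Product fun _ => M)
  let b' : Fin m → N := fun i => ((fun Δ => b Δ i : I → M) : (u : Filter I).Product fun _ => M)
  refine ⟨N, Ultraproduct.structure, j, b', fun β φ x => ?_, fun φ => ?_⟩
  · have := Ultraproduct.realize_formula_cast (u := u) φ (fun i (_ : I) => x i)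
    refine this.trans ?_
    simp
  · have h1 := Ultraproduct.realize_formula_cast (u := u)
      (BoundedFormula.constantsVarsEquiv (Formula.equivSentence.symm φ) : L.Formula (A ⊕ Fin m))
      (Sum.elim (fun (a : A) (_ : I) => (a : M)) fun i Δ => b Δ i)
    have h2 : (fun i => ((Sum.elim (fun (a : A) (_ : I) => (a : M)) (fun i Δ => b Δ i) i :
        I → M) : (u : Filter I).Product fun _ => M)) = Sum.elim (fun a : A => j a) b' := by
      funext i
      rcases i with i | i <;> rfl
    rw [h2] at h1
    refine Iff.trans ?_ h1.symm
    have h3 : ∀ (φ : L[[A]][[Fin m]].Sentence) (Δ : I), Formula.Realize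
        (BoundedFormula.constantsVarsEquiv (Formula.equivSentence.symm φ) : L.Formula (A ⊕ Fin m))
        (fun i => Sum.elim (fun (a : A) (_ : I) => (a : M)) (fun i Δ => b Δ i) i Δ) ↔
        (Formula.equivSentence.symm φ).Realize (b Δ) := by
      intro φ Δ
      have h4 : (fun i => Sum.elim (fun (a : A) (_ : I) => (a : M)) (fun i Δ => b Δ i) i Δ) =
          Sum.elim (fun a : A => ((L.con a : L[[A]].Constants) : M)) (b Δ) := by
        funext i
        rcases i with i | i
        · exact (coe_con (L := L) (A := A)).symm
        · rfl
      rw [h4]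
      exact BoundedFormula.realize_constantsVarsEquiv
    simp only [h3]
    have h5 : ∀ φ : L[[A]][[Fin m]].Sentence, φ ∈ q →
        ∀ᶠ Δ in (u : Filter I), (Formula.equivSentence.symm φ).Realize (b Δ) := by
      intro φ hφ
      refine hu ?_
      filter_upwards [Filter.eventually_ge_atTop {⟨φ, hφ⟩}] with Δ hΔ
      exact hb Δ ⟨φ, hφ⟩ (hΔ (Finset.mem_singleton_self _))
    refine ⟨h5 φ, fun h => ?_⟩
    by_contra hcon
    have h6 := h5 _ ((Theory.CompleteType.not_mem_iff q φ).2 hcon)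
    obtain ⟨Δ, h7, h8⟩ := (h.and h6).exists
    rw [Formula.realize_equivSentence_symm] at h7 h8
    exact h8 h7

end Ultrapower

/-! ### Counting types over closed sets. -/

section Stability

variable {p : ℕ} {k : Fin p → ℕ} {α : Fin p → ℝ}
  {N : Type} [(lang k).Structure N]

/-- Over a closed set, a finite set has a countable closure. -/
theorem exists_countable_closure (hα : ∀ i, 0 < α i) {Z : Set N} (hZ : ∀ t, TClosed k α t Z)
    (F : Finset N) : ∃ E : Set N, E.Countable ∧ (F : Set N) ⊆ E ∧ ∀ t, TClosed k α t (Z ∪ E) := by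
  classical
  have h1 : ∀ (t : ℕ) (G : Finset N), ∃ G' : Finset N, G ⊆ G' ∧ TClosed k α t (Z ∪ ↑G') := by
    intro t G
    obtain ⟨b, hb⟩ := exists_tClosed_union (k := k) hα t G.card
    obtain ⟨G', h1, h2, -⟩ := hb N Z hZ G le_rfl
    exact ⟨G', h1, h2⟩
  choose cl hcl1 hcl2 using h1
  -- Step `n` closes up at level `n`, so each fixed level is attained at all late steps.
  obtain ⟨Fs, hF0, hFs⟩ : ∃ Fs : ℕ → Finset N, Fs 0 = F ∧ ∀ n, Fs (n + 1) = cl n (Fs n) :=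
    ⟨fun n => Nat.rec F (fun t G => cl t G) n, rfl, fun _ => rfl⟩
  have hmono : Monotone Fs := monotone_nat_of_le_succ fun n => hFs n ▸ hcl1 n (Fs n)
  have hcount : (⋃ n, (Fs n : Set N)).Countable :=
    Set.countable_iUnion fun n => (Fs n).countable_toSet
  have hsub : (F : Set N) ⊆ ⋃ n, (Fs n : Set N) := fun x hx => Set.mem_iUnion.2 ⟨0, hF0 ▸ hx⟩
  refine ⟨_, hcount, hsub, fun t X Y hXY _ => ?_⟩
  have h2 : ∀ y : N, ∃ n, y ∈ ⋃ n, (Fs n : Set N) → y ∈ Fs n := by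
    intro y
    by_cases hy : y ∈ ⋃ n, (Fs n : Set N)
    · obtain ⟨n, hn⟩ := Set.mem_iUnion.1 hy
      exact ⟨n, fun _ => hn⟩
    · exact ⟨0, fun h => absurd h hy⟩
  choose n hn using h2
  let s := max (Y.sup n) Y.card
  -- By step `s + 1` every point of `Y` in the union has already appeared, so `Y` has the same trace
  -- there as on the union; and `s ≥ Y.card` makes the size condition automatic.
  have h3 : TClosed k α s (Z ∪ ↑(Fs (s + 1))) := hFs s ▸ hcl2 s (Fs s)
  refine h3 X Y ?_ (by have : Y.card ≤ s := le_max_right _ _; omega)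
  rw [hXY]
  ext y
  simp only [Set.mem_inter_iff, Set.mem_union, Finset.mem_coe]
  refine and_congr_right fun hy => or_congr_right ⟨fun h => ?_, fun h => Set.mem_iUnion.2 ⟨_, h⟩⟩
  refine hmono ?_ (hn y h)
  have : n y ≤ s := (Finset.le_sup hy).trans (le_max_left _ _)
  omega

/-- Only finitely many edges over a closed set meet a given finite set. -/
theorem finite_edges_over_closed (hα : ∀ i, 0 < α i) {Z : Set N} (hZ : ∀ t, TClosed k α t Z)
    (F : Finset N) (i : Fin p) :
    {C : Finset N | C ∈ edges k N i ∧ (C : Set N) ⊆ Z ∪ ↑F ∧ ¬ (C : Set N) ⊆ Z}.Finite := by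
  classical
  by_contra hinf
  -- Each edge not inside `Z` costs `α i`, while at most `F.card` points are added to the trace on
  -- `Z`. Closedness of `Z` therefore allows at most `F.card / α i` such edges.
  obtain ⟨n, hn⟩ := exists_nat_gt ((F.card : ℝ) / α i)
  obtain ⟨𝒞, h1, h2⟩ := Set.Infinite.exists_subset_card_eq hinf n
  let U := 𝒞.biUnion id
  let V := U.filter (· ∈ Z)
  have hVU : V ⊆ U := Finset.filter_subset _ _
  have hpre : predim k α V ≤ predim k α U := hZ U.card V U (by ext; simp [V]) (by omega)
  have hcard : (U.card : ℝ) ≤ V.card + F.card := by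
    have : U ⊆ V ∪ F := by
      intro x hx
      obtain ⟨C, hC, hxC⟩ := Finset.mem_biUnion.1 hx
      rcases (h1 hC).2.1 hxC with h | h
      · exact Finset.mem_union_left _ (Finset.mem_filter.2 ⟨hx, h⟩)
      · exact Finset.mem_union_right _ h
    exact_mod_cast (Finset.card_le_card this).trans (Finset.card_union_le _ _)
  have hcount : edgeCount k i V + n ≤ edgeCount k i U := by
    rw [edgeCount_eq_card, edgeCount_eq_card, ← h2, ← Finset.card_union_of_disjoint]
    · refine Finset.card_le_card (Finset.union_subset (fun C hC => ?_) fun C hC => ?_)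
      · rw [mem_edgesIn] at hC ⊢
        exact ⟨hC.1.trans hVU, hC.2⟩
      · exact mem_edgesIn.2 ⟨Finset.subset_biUnion_of_mem id hC, (h1 hC).1⟩
    · rw [Finset.disjoint_left]
      intro C hC hC'
      refine (h1 hC').2.2 fun x hx => ?_
      exact (Finset.mem_filter.1 ((mem_edgesIn.1 hC).1 hx)).2
  have hsum : ∑ r, α r * (edgeCount k r V : ℝ) + α i * n ≤ ∑ r, α r * (edgeCount k r U : ℝ) := by
    have h3 : ∑ r, α r * (edgeCount k r V : ℝ) + α i * n =
        ∑ r, (α r * (edgeCount k r V : ℝ) + if r = i then α i * n else 0) := by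
      rw [Finset.sum_add_distrib]; simp
    rw [h3]
    refine Finset.sum_le_sum fun r _ => ?_
    have hm : (edgeCount k r V : ℝ) ≤ edgeCount k r U := by
      exact_mod_cast edgeCount_mono r hVU
    split_ifs with hr
    · subst hr
      rw [← mul_add]
      exact mul_le_mul_of_nonneg_left (by exact_mod_cast hcount) (hα r).le
    · rw [add_zero]
      exact mul_le_mul_of_nonneg_left hm (hα r).le
  rw [div_lt_iff₀ (hα i)] at hn
  unfold predim at hpre
  linarith

/-- Each edge meets `E` in one of its countably many finite subsets, and only finitely many edges
belong to each of these. -/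
theorem countable_edges_over_closed (hα : ∀ i, 0 < α i) {Z : Set N} (hZ : ∀ t, TClosed k α t Z)
    {E : Set N} (hE : E.Countable) :
    {q : Fin p × Finset N | q.2 ∈ edges k N q.1 ∧ (q.2 : Set N) ⊆ Z ∪ E ∧
      ¬ (q.2 : Set N) ⊆ Z}.Countable := by
  classical
  have h1 : {S : Set N | S.Finite ∧ S ⊆ E}.Countable := Set.countable_ofPred_finite_subset hE
  have h2 : (⋃ S ∈ {S : Set N | S.Finite ∧ S ⊆ E}, ⋃ i : Fin p, (fun C => (i, C)) ''
      {C : Finset N | C ∈ edges k N i ∧ (C : Set N) ⊆ Z ∪ S ∧ ¬ (C : Set N) ⊆ Z}).Countable := by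
    refine h1.biUnion fun S hS => Set.countable_iUnion fun i => Set.Countable.image ?_ _
    have hS' := hS.1
    lift S to Finset N using hS'
    exact (finite_edges_over_closed hα hZ S i).countable
  refine h2.mono ?_
  rintro ⟨i, C⟩ ⟨hC1, hC2, hC3⟩
  refine Set.mem_biUnion (x := (C : Set N) ∩ E)
    ⟨C.finite_toSet.inter_of_left _, Set.inter_subset_right⟩ (Set.mem_iUnion.2 ⟨i, C, ⟨hC1, ?_, hC3⟩, rfl⟩)
  intro x hx
  rcases hC2 hx with h | h
  · exact Or.inl h
  · exact Or.inr ⟨hx, h⟩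

/-- The codes for elements of a closed set `S ∪ E` with `E` countable. -/
def codes (S : Type) (I : Set ℕ) : Set (S ⊕ ℕ) := {w | ∀ n, w = Sum.inr n → n ∈ I}

/-- Countable data determining a type over `S`. -/
abbrev TypeData (p m : ℕ) (S : Type) : Type :=
  Set ℕ × (Fin m → S ⊕ ℕ) × {D : Set (Fin p × Finset (S ⊕ ℕ)) // Cardinal.mk D ≤ Cardinal.aleph0}

open Classical in
/-- The tuple `b` has the given data over the closed substructure `S` of `N`. -/
def HasData {S : Type} [(lang k).Structure S] {m : ℕ} (α : Fin p → ℝ) (j : S ↪[lang k] N)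
    (b : Fin m → N) (D : TypeData p m S) : Prop :=
  ∃ d : S ⊕ ℕ → N, (∀ s, d (Sum.inl s) = j s) ∧ Set.InjOn d (codes S D.1) ∧
    (∀ t, TClosed k α t (d '' codes S D.1)) ∧ (∀ i, D.2.1 i ∈ codes S D.1 ∧ d (D.2.1 i) = b i) ∧
    ∀ (i : Fin p) (C : Finset (S ⊕ ℕ)), (C : Set (S ⊕ ℕ)) ⊆ codes S D.1 → (∃ n, Sum.inr n ∈ C) →
      (C.image d ∈ edges k N i ↔ (i, C) ∈ D.2.2.1)

/-- The closure of `S` and `b` adds a countable set to `S`, which is coded by natural numbers, and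
only countably many edges involve coded points. -/
theorem exists_hasData (hα : ∀ i, 0 < α i) {S : Type} [(lang k).Structure S] {m : ℕ}
    (j : S ↪[lang k] N) (hj : ∀ t, TClosed k α t (Set.range j)) (b : Fin m → N) [Nonempty N] :
    ∃ D : TypeData p m S, HasData α j b D := by
  classical
  obtain ⟨E, hE, hbE, hcl⟩ := exists_countable_closure hα hj (Finset.univ.image b)
  let E' : Set N := E \ Set.range j
  have hE' : E'.Countable := hE.mono Set.sdiff_subset
  obtain ⟨c, hc⟩ := hE'.exists_injective_nat
  let I : Set ℕ := Set.range c
  let d : S ⊕ ℕ → N := Sum.elim j fun n =>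
    if h : ∃ e : E', c e = n then (h.choose : N) else Classical.arbitrary N
  have hdc : ∀ e : E', d (Sum.inr (c e)) = e := by
    intro e
    have h : ∃ e' : E', c e' = c e := ⟨e, rfl⟩
    have : d (Sum.inr (c e)) = h.choose := dif_pos h
    rw [this, hc h.choose_spec]
  have hcodes : ∀ w ∈ codes S I, (∃ s, w = Sum.inl s) ∨ ∃ e : E', w = Sum.inr (c e) := by
    rintro (s | n) hw
    · exact Or.inl ⟨s, rfl⟩
    · obtain ⟨e, rfl⟩ := hw n rfl
      exact Or.inr ⟨e, rfl⟩
  have hinl : ∀ s : S, (Sum.inl s : S ⊕ ℕ) ∈ codes S I := fun s n h => by simp at h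
  have hinr : ∀ e : E', (Sum.inr (c e) : S ⊕ ℕ) ∈ codes S I := fun e n h => by
    rw [← Sum.inr_injective h]; exact ⟨e, rfl⟩
  have hinj : Set.InjOn d (codes S I) := by
    intro w hw w' hw' h
    rcases hcodes w hw with ⟨s, rfl⟩ | ⟨e, rfl⟩ <;> rcases hcodes w' hw' with ⟨s', rfl⟩ | ⟨e', rfl⟩
    · rw [j.injective h]
    · rw [hdc] at h
      exact absurd ⟨s, h⟩ e'.2.2
    · rw [hdc] at h
      exact absurd ⟨s', h.symm⟩ e.2.2
    · rw [hdc, hdc] at h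
      rw [Subtype.ext h]
  have himg : d '' codes S I = Set.range j ∪ E := by
    ext x
    constructor
    · rintro ⟨w, hw, rfl⟩
      rcases hcodes w hw with ⟨s, rfl⟩ | ⟨e, rfl⟩
      · exact Or.inl ⟨s, rfl⟩
      · rw [hdc]; exact Or.inr e.2.1
    · intro hx
      by_cases hx' : x ∈ Set.range j
      · obtain ⟨s, rfl⟩ := hx'
        exact ⟨Sum.inl s, hinl s, rfl⟩
      · have : x ∈ E' := ⟨hx.resolve_left hx', hx'⟩
        exact ⟨Sum.inr (c ⟨x, this⟩), hinr _, hdc ⟨x, this⟩⟩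
  have hbc : ∀ i, ∃ w ∈ codes S I, d w = b i := by
    intro i
    have : b i ∈ d '' codes S I := himg ▸ Or.inr (hbE (by simp))
    exact this
  choose bc hbc1 hbc2 using hbc
  let D : Set (Fin p × Finset (S ⊕ ℕ)) := {q | (q.2 : Set (S ⊕ ℕ)) ⊆ codes S I ∧
    (∃ n, Sum.inr n ∈ q.2) ∧ q.2.image d ∈ edges k N q.1}
  have hD : D.Countable := by
    refine Set.MapsTo.countable_of_injOn (f := fun q => (q.1, q.2.image d)) ?_ ?_
      (countable_edges_over_closed hα hj hE)
    · rintro ⟨i, C⟩ ⟨h1, ⟨n, hn⟩, h3⟩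
      refine ⟨h3, ?_, fun h => ?_⟩
      · rw [← himg, Finset.coe_image]
        exact Set.image_mono h1
      · obtain ⟨e, he⟩ : ∃ e : E', (Sum.inr n : S ⊕ ℕ) = Sum.inr (c e) := by
          rcases hcodes _ (h1 hn) with ⟨s, hs⟩ | he
          · simp at hs
          · exact he
        have h4 : (e : N) ∈ Set.range j := h (by
          rw [Finset.coe_image]
          exact ⟨_, hn, by rw [he, hdc]⟩)
        exact e.2.2 h4
    · rintro ⟨i, C⟩ ⟨h1, -, -⟩ ⟨i', C'⟩ ⟨h1', -, -⟩ h
      simp only [Prod.mk.injEq] at h ⊢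
      refine ⟨h.1, ?_⟩
      have h5 := h.2
      rw [← Finset.coe_inj, Finset.coe_image, Finset.coe_image,
        hinj.image_eq_image_iff h1 h1', Finset.coe_inj] at h5
      exact h5
  refine ⟨(I, bc, ⟨D, Cardinal.le_aleph0_iff_set_countable.2 hD⟩), d, fun s => rfl, hinj, ?_,
    fun i => ⟨hbc1 i, hbc2 i⟩, fun i C h1 h2 => ⟨fun h => ⟨h1, h2, h⟩, fun h => h.2.2⟩⟩
  intro t
  change TClosed k α t (d '' codes S I)
  rw [himg]
  exact hcl t

/-- Tuples with the same data satisfy the same formulas over `S`. -/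
theorem HasData.realize_iff (hα : ∀ i, 0 < α i) {N' : Type} [(lang k).Structure N']
    (hN : Semigeneric k α N) (hN' : Semigeneric k α N') {S : Type} [(lang k).Structure S] {m : ℕ}
    {j : S ↪[lang k] N} {j' : S ↪[lang k] N'} {b : Fin m → N} {b' : Fin m → N'}
    {D : TypeData p m S} (h : HasData α j b D) (h' : HasData α j' b' D) {β : Type} (f : β → S)
    (φ : (lang k).Formula (β ⊕ Fin m)) :
    φ.Realize (Sum.elim (j ∘ f) b) ↔ φ.Realize (Sum.elim (j' ∘ f) b') := by
  classical
  obtain ⟨d, h1, h2, h3, h4, h5⟩ := h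
  obtain ⟨d', h1', h2', h3', h4', h5'⟩ := h'
  let X : Type := codes S D.1
  let e : X ↪ N := ⟨fun x => d x.1, fun x y h => Subtype.ext (h2 x.2 y.2 h)⟩
  let e' : X ↪ N' := ⟨fun x => d' x.1, fun x y h => Subtype.ext (h2' x.2 y.2 h)⟩
  let _ : (lang k).Structure X := ofEdges k fun i => {C | C.map e ∈ edges k N i}
  have hX : IsSymmetric k X := isSymmetric_ofEdges _
  have hXe : ∀ i (C : Finset X), C.map e ∈ edges k N i ↔ C ∈ edges k X i := by
    intro i C
    rw [mem_edges_ofEdges]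
    exact ⟨fun h => ⟨by simpa using h.1, h⟩, fun h => h.2⟩
  have hee : ∀ i (C : Finset X), C.map e' ∈ edges k N' i ↔ C.map e ∈ edges k N i := by
    intro i C
    let C' : Finset (S ⊕ ℕ) := C.map (Function.Embedding.subtype _)
    have hC' : (C' : Set (S ⊕ ℕ)) ⊆ codes S D.1 := by
      intro w hw
      obtain ⟨x, -, rfl⟩ := Finset.mem_map.1 hw
      exact x.2
    have hCe : C.map e = C'.image d := by
      simp only [C', Finset.map_eq_image, Finset.image_image]; rfl
    have hCe' : C.map e' = C'.image d' := by
      simp only [C', Finset.map_eq_image, Finset.image_image]; rfl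
    rw [hCe, hCe']
    -- A set with a coded point is decided by the data. One without lies in `S`, where both
    -- structures induce the same edges.
    by_cases hn : ∃ n, Sum.inr n ∈ C'
    · rw [h5 i C' hC' hn, h5' i C' hC' hn]
    · have hl : ∀ w ∈ C', ∃ s : S, w = Sum.inl s := by
        rintro (s | n) hw
        · exact ⟨s, rfl⟩
        · exact absurd ⟨n, hw⟩ hn
      let F : Finset S := C'.preimage Sum.inl Sum.inl_injective.injOn
      have hF : C' = F.map ⟨Sum.inl, Sum.inl_injective⟩ := by
        ext w
        simp only [F, Finset.mem_map, Finset.mem_preimage, Function.Embedding.coeFn_mk]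
        constructor
        · intro hw
          obtain ⟨s, rfl⟩ := hl w hw
          exact ⟨s, hw, rfl⟩
        · rintro ⟨s, hs, rfl⟩; exact hs
      have q1 : C'.image d = F.map j.toEmbedding := by
        rw [hF, Finset.map_eq_image, Finset.map_eq_image, Finset.image_image]
        exact Finset.image_congr fun s _ => h1 s
      have q2 : C'.image d' = F.map j'.toEmbedding := by
        rw [hF, Finset.map_eq_image, Finset.map_eq_image, Finset.image_image]
        exact Finset.image_congr fun s _ => h1' s
      rw [q1, q2, map_mem_edges, map_mem_edges]
  let E : X ↪[lang k] N := embOfEdges hX hN.inClass.1 e hXe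
  let E' : X ↪[lang k] N' := embOfEdges hX hN'.inClass.1 e' fun i C => (hee i C).trans (hXe i C)
  let x : β ⊕ Fin m → X := Sum.elim (fun a => ⟨Sum.inl (f a), fun n h => by simp at h⟩)
    fun i => ⟨D.2.1 i, (h4 i).1⟩
  have hr : Set.range E = d '' codes S D.1 := by
    ext y
    exact ⟨fun ⟨x, hx⟩ => ⟨x.1, x.2, hx⟩, fun ⟨w, hw, h⟩ => ⟨⟨w, hw⟩, h⟩⟩
  have hr' : Set.range E' = d' '' codes S D.1 := by
    ext y
    exact ⟨fun ⟨x, hx⟩ => ⟨x.1, x.2, hx⟩, fun ⟨w, hw, h⟩ => ⟨⟨w, hw⟩, h⟩⟩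
  have key := hN.realize_iff_of_closed hα hN' E E' (hr ▸ h3) (hr' ▸ h3') φ x
  have e1 : E ∘ x = Sum.elim (j ∘ f) b := by
    funext i
    rcases i with a | i
    · exact h1 _
    · exact (h4 i).2
  have e2 : E' ∘ x = Sum.elim (j' ∘ f) b' := by
    funext i
    rcases i with a | i
    · exact h1' _
    · exact (h4' i).2
  rwa [e1, e2] at key

/-- Since `𝔠 ^ ℵ₀ = 𝔠`, countable subsets of a set of size at most the continuum are at most
continuum many. This is why stability is witnessed at the continuum. -/
theorem mk_typeData_le (p m : ℕ) (S : Type) (hS : Cardinal.mk S ≤ Cardinal.continuum) :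
    Cardinal.mk (TypeData p m S) ≤ Cardinal.continuum := by
  have hW : Cardinal.mk (S ⊕ ℕ) ≤ Cardinal.continuum := by
    rw [Cardinal.mk_sum, Cardinal.lift_id, Cardinal.lift_id]
    exact Cardinal.add_le_of_le Cardinal.aleph0_le_continuum hS (Cardinal.mk_le_aleph0.trans Cardinal.aleph0_le_continuum)
  have hF : Cardinal.mk (Finset (S ⊕ ℕ)) ≤ Cardinal.continuum := by
    rw [Cardinal.mk_finset_of_infinite]; exact hW
  have hP : Cardinal.mk (Fin p × Finset (S ⊕ ℕ)) ≤ Cardinal.continuum := by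
    rw [Cardinal.mk_prod, Cardinal.lift_id, Cardinal.lift_id]
    refine (mul_le_mul' (Cardinal.mk_le_aleph0.trans Cardinal.aleph0_le_continuum) hF).trans ?_
    rw [Cardinal.mul_eq_self Cardinal.aleph0_le_continuum]
  have hD : Cardinal.mk {D : Set (Fin p × Finset (S ⊕ ℕ)) // Cardinal.mk D ≤ Cardinal.aleph0} ≤
      Cardinal.continuum := by
    refine (Cardinal.mk_bounded_set_le _ _).trans ?_
    refine (Cardinal.power_le_power_right (max_le hP Cardinal.aleph0_le_continuum)).trans ?_
    rw [Cardinal.continuum_power_aleph0]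
  have hb : Cardinal.mk (Fin m → S ⊕ ℕ) ≤ Cardinal.continuum := by
    rw [Cardinal.mk_pi]
    simp only [Cardinal.prod_const, Cardinal.lift_id]
    refine (Cardinal.power_le_power_right hW).trans ?_
    refine (Cardinal.power_le_power_left Cardinal.continuum_ne_zero Cardinal.mk_le_aleph0).trans ?_
    rw [Cardinal.continuum_power_aleph0]
  have hI : Cardinal.mk (Set ℕ) ≤ Cardinal.continuum := by
    rw [Cardinal.mk_set, Cardinal.mk_nat, Cardinal.two_power_aleph0]
  rw [Cardinal.mk_prod, Cardinal.mk_prod]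
  simp only [Cardinal.lift_id]
  exact (mul_le_mul' hI ((mul_le_mul' hb hD).trans
    (Cardinal.mul_eq_self Cardinal.aleph0_le_continuum).le)).trans
    (Cardinal.mul_eq_self Cardinal.aleph0_le_continuum).le

/-- Theories of semigeneric structures are stable. -/
theorem isStable_of_semigeneric (hα : ∀ i, 0 < α i) {T : (lang k).Theory}
    (hT : ∀ (M : Type) [(lang k).Structure M], M ⊨ T → Semigeneric k α M) : IsStable T := by
  classical
  refine ⟨Cardinal.continuum, Cardinal.aleph0_le_continuum, fun M _ _ hM A hA m => ?_⟩
  -- Replacing the parameters by an elementary submodel of size at most the continuum makes the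
  -- parameter set closed in every elementary extension, as `hJ` shows.
  have hS : ∃ S : (lang k).ElementarySubstructure M, A ⊆ S ∧ Cardinal.mk S ≤ Cardinal.continuum := by
    rcases le_total (Cardinal.mk M) Cardinal.continuum with h | h
    · exact ⟨⊤, fun _ _ => trivial, (Cardinal.mk_subtype_le _).trans h⟩
    · obtain ⟨S, h1, h2⟩ := exists_elementarySubstructure_card_eq (lang k) A Cardinal.continuum
        Cardinal.aleph0_le_continuum (by simpa using hA) (by
          have : Countable (lang k).Symbols := by
            unfold Language.Symbols lang
            infer_instance
          rw [Cardinal.lift_id, Cardinal.lift_id]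
          exact (Cardinal.mk_le_aleph0 (α := (lang k).Symbols)).trans
            Cardinal.aleph0_le_continuum) (by simpa using h)
      exact ⟨S, h1, by simpa using h2.le⟩
  obtain ⟨S, hAS, hSc⟩ := hS
  have hST : S ⊨ T := (S.theory_model_iff T).2 hM
  have hSg := hT S hST
  choose N iN j b hj hb using exists_ultrapower_realization (L := lang k) A (m := m)
  let jS : ∀ q, S → N q := fun q s => j q s.1
  have hjS : ∀ q (β : Type) (φ : (lang k).Formula β) (x : β → S),
      φ.Realize (jS q ∘ x) ↔ φ.Realize x := by
    intro q β φ x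
    refine (hj q β φ (Subtype.val ∘ x)).trans ?_
    exact S.subtype.map_formula φ x
  have hNT : ∀ q, N q ⊨ T := by
    intro q
    rw [Theory.model_iff]
    intro φ hφ
    have h1 := hj q Empty φ default
    have h2 : M ⊨ φ := hM.realize_of_mem φ hφ
    have h3 : j q ∘ (default : Empty → M) = default := Subsingleton.elim _ _
    rw [h3] at h1
    exact h1.2 h2
  have hinj : ∀ q, Function.Injective (jS q) := by
    intro q s s' h
    have := (hjS q (Fin 2) (Term.equal (Term.var 0) (Term.var 1)) ![s, s']).1 (by
      simpa [Formula.realize_equal] using h)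
    simpa [Formula.realize_equal] using this
  let J : ∀ q, S ↪[lang k] N q := fun q => embOfRel (jS q) (hinj q) fun i c => by
    have := hjS q (Fin (k i)) ((sym k i).formula fun l => Term.var l) c
    simp only [Formula.realize_rel, Term.realize_var] at this
    exact this
  -- The trace of `Y` on `S` lies in a finite set `C` that is closed in `S` at level `Y.card`. A
  -- formula expresses this closedness, so it passes to the ultrapower, where `Y` has the same trace
  -- on `C`.
  have hJ : ∀ q t, TClosed k α t (Set.range (J q)) := by
    intro q t X Y hXY _
    let F : Finset S := X.preimage (J q) (J q).injective.injOn
    obtain ⟨c, hc⟩ := exists_tClosed (k := k) hα Y.card F.card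
    obtain ⟨C, hC1, hC2, -⟩ := hc S hSg.inClass F le_rfl
    obtain ⟨φ, hφ⟩ := exists_tClosed_formula (k := k) hα C Y.card
    have h1 : TClosed k α Y.card (Set.range (jS q ∘ (Subtype.val : C → S))) := by
      rw [← hφ, hjS, hφ]
      have : Set.range (Subtype.val : C → S) = (C : Set S) := Subtype.range_coe
      rwa [this]
    refine h1 X Y ?_ (by omega)
    ext y
    constructor
    · intro hy
      have hy' : y ∈ (Y : Set (N q)) ∩ Set.range (J q) := hXY ▸ hy
      obtain ⟨hyY, s, rfl⟩ := hy'
      exact ⟨hyY, ⟨s, hC1 (Finset.mem_preimage.2 hy)⟩, rfl⟩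
    · rintro ⟨hyY, s, rfl⟩
      rw [hXY]
      exact ⟨hyY, s.1, rfl⟩
  have hne : ∀ q, Nonempty (N q) := fun q => ⟨j q (Classical.arbitrary M)⟩
  choose D hD using fun q => exists_hasData hα (J q) (hJ q) (b q)
  refine (Cardinal.mk_le_of_injective (f := D) fun q q' hqq => ?_).trans (mk_typeData_le p m S hSc)
  refine SetLike.ext fun φ => ?_
  rw [hb, hb]
  have h1 := hD q
  rw [hqq] at h1
  exact h1.realize_iff hα (hT _ (hNT q)) (hT _ (hNT q')) (hD q') (fun a : A => ⟨a.1, hAS a.2⟩) _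

end Stability

/-! ### Functions of a set of coordinates. -/

section DependsOnly

variable {E : Type} {F : Finset E → ℝ}

/-- The function `F` depends only on the coordinates in `S`. -/
def DependsOnly (S : Set E) (F : Finset E → ℝ) : Prop :=
  ∀ ω ω' : Finset E, (∀ e ∈ S, e ∈ ω ↔ e ∈ ω') → F ω = F ω'

theorem DependsOnly.mono {S S' : Set E} (h : DependsOnly S F) (hS : S ⊆ S') : DependsOnly S' F :=
  fun ω ω' hω => h ω ω' fun e he => hω e (hS he)

theorem DependsOnly.prod {ι : Type*} {s : Finset ι} {S : Set E} {G : ι → Finset E → ℝ}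
    (h : ∀ j ∈ s, DependsOnly S (G j)) : DependsOnly S fun ω => ∏ j ∈ s, G j ω :=
  fun ω ω' hω => Finset.prod_congr rfl fun j hj => h j hj ω ω' hω

end DependsOnly

/-! ### Expectations over independent random coordinates. -/

section Bernoulli

variable {E : Type} [DecidableEq E]

/-- The expectation of `F ω`, where the random subset `ω` of `W` contains each `e ∈ W` with
probability `q e`, independently. -/
def expect (q : E → ℝ) (W : Finset E) (F : Finset E → ℝ) : ℝ :=
  ∑ ω ∈ W.powerset, (∏ e ∈ ω, q e) * (∏ e ∈ W \ ω, (1 - q e)) * F ω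

variable {q : E → ℝ} {W : Finset E} {F F' : Finset E → ℝ}

theorem expect_empty : expect q ∅ F = F ∅ := by simp [expect]

/-- This conditions on the single coordinate `e`. Independence and the product formula for inclusion
follow from it by induction on `W`. -/
theorem expect_insert {e : E} (he : e ∉ W) : expect q (insert e W) F =
    (1 - q e) * expect q W F + q e * expect q W (fun ω => F (insert e ω)) := by
  unfold expect
  rw [Finset.sum_powerset_insert he, Finset.mul_sum, Finset.mul_sum]
  congr 1 <;> refine Finset.sum_congr rfl fun ω hω => ?_
  · have h1 : e ∉ ω := fun h => he (Finset.mem_powerset.1 hω h)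
    rw [Finset.insert_sdiff_of_notMem _ h1,
      Finset.prod_insert fun h => he (Finset.mem_sdiff.1 h).1]
    ring
  · have h1 : e ∉ ω := fun h => he (Finset.mem_powerset.1 hω h)
    have h2 : insert e W \ insert e ω = W \ ω := by
      ext x
      simp only [Finset.mem_sdiff, Finset.mem_insert]
      constructor
      · rintro ⟨h | h, h'⟩
        · exact absurd (Or.inl h) h'
        · exact ⟨h, fun hx => h' (Or.inr hx)⟩
      · rintro ⟨h, h'⟩
        exact ⟨Or.inr h, fun hx => hx.elim (fun hx => he (hx ▸ h)) h'⟩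
    rw [h2, Finset.prod_insert h1]
    ring

theorem expect_add : expect q W (fun ω => F ω + F' ω) = expect q W F + expect q W F' := by
  simp only [expect, mul_add, Finset.sum_add_distrib]

theorem expect_const_mul (c : ℝ) : expect q W (fun ω => c * F ω) = c * expect q W F := by
  unfold expect
  rw [Finset.mul_sum]
  exact Finset.sum_congr rfl fun ω _ => by ring

theorem expect_sum {ι : Type*} (s : Finset ι) (G : ι → Finset E → ℝ) :
    expect q W (fun ω => ∑ x ∈ s, G x ω) = ∑ x ∈ s, expect q W (G x) := by
  unfold expect
  simp only [Finset.mul_sum]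
  rw [Finset.sum_comm]

theorem expect_congr (h : ∀ ω ⊆ W, F ω = F' ω) : expect q W F = expect q W F' :=
  Finset.sum_congr rfl fun ω hω => by rw [h ω (Finset.mem_powerset.1 hω)]

theorem expect_mono (hq : ∀ e ∈ W, 0 ≤ q e ∧ q e ≤ 1) (h : ∀ ω ⊆ W, F ω ≤ F' ω) :
    expect q W F ≤ expect q W F' := by
  refine Finset.sum_le_sum fun ω hω => mul_le_mul_of_nonneg_left (h ω (Finset.mem_powerset.1 hω)) ?_
  refine mul_nonneg (Finset.prod_nonneg fun e he => (hq e (Finset.mem_powerset.1 hω he)).1)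
    (Finset.prod_nonneg fun e he => ?_)
  linarith [(hq e (Finset.mem_sdiff.1 he).1).2]

theorem expect_const (c : ℝ) : expect q W (fun _ => c) = c := by
  induction W using Finset.induction_on with
  | empty => exact expect_empty
  | insert e W he ih => rw [expect_insert he, ih]; ring

theorem expect_nonneg (hq : ∀ e ∈ W, 0 ≤ q e ∧ q e ≤ 1) (h : ∀ ω ⊆ W, 0 ≤ F ω) :
    0 ≤ expect q W F := by
  have := expect_mono (F := fun _ => 0) hq h
  rwa [expect_const] at this

theorem DependsOnly.insert {S : Set E} (h : DependsOnly S F) (e : E) :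
    DependsOnly S fun ω => F (insert e ω) := fun ω ω' hω => h _ _ fun x hx => by
  simp only [Finset.mem_insert, hω x hx]

theorem DependsOnly.insert_eq {S : Set E} (h : DependsOnly S F) {e : E} (he : e ∉ S)
    (ω : Finset E) : F (Insert.insert e ω) = F ω := h _ _ fun x hx => by
  simp only [Finset.mem_insert, or_iff_right_iff_imp]
  rintro rfl
  exact absurd hx he

/-- Functions of disjoint sets of coordinates are independent. -/
theorem expect_mul {S S' : Set E} (hS : Disjoint S S') (h : DependsOnly S F)
    (h' : DependsOnly S' F') :
    expect q W (fun ω => F ω * F' ω) = expect q W F * expect q W F' := by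
  induction W using Finset.induction_on generalizing F F' with
  | empty => simp only [expect_empty]
  | insert e W he ih =>
    rw [expect_insert he, expect_insert he, expect_insert he, ih h h',
      ih (h.insert e) (h'.insert e)]
    by_cases heS : e ∈ S
    · have h1 : ∀ ω, F' (insert e ω) = F' ω := h'.insert_eq fun h => Set.disjoint_left.1 hS heS h
      simp only [h1]
      ring
    · have h1 : ∀ ω, F (insert e ω) = F ω := h.insert_eq heS
      simp only [h1]
      ring

theorem expect_prod {ι : Type*} [DecidableEq ι] (s : Finset ι) {S : ι → Set E}
    {G : ι → Finset E → ℝ} (hS : ∀ j j', j ≠ j' → Disjoint (S j) (S j'))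
    (h : ∀ j, DependsOnly (S j) (G j)) :
    expect q W (fun ω => ∏ j ∈ s, G j ω) = ∏ j ∈ s, expect q W (G j) := by
  induction s using Finset.induction_on with
  | empty => simp [expect_const]
  | insert j s hj ih =>
    simp only [Finset.prod_insert hj]
    rw [← ih]
    refine expect_mul (S := S j) (S' := ⋃ j' ∈ s, S j') ?_ (h j)
      (DependsOnly.prod fun j' hj' => (h j').mono (Set.subset_biUnion_of_mem (u := S) hj'))
    rw [Set.disjoint_iUnion₂_right]
    exact fun j' hj' => hS j j' fun h => hj (h ▸ hj')

/-- The probability that a given set of coordinates is contained in the random set. -/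
theorem expect_subset {S : Finset E} (hS : S ⊆ W) :
    expect q W (fun ω => if S ⊆ ω then 1 else 0) = ∏ e ∈ S, q e := by
  induction W using Finset.induction_on generalizing S with
  | empty =>
    rw [Finset.subset_empty.1 hS, expect_empty]
    simp
  | insert e W he ih =>
    rw [expect_insert he]
    by_cases heS : e ∈ S
    · have h1 : expect q W (fun ω => if S ⊆ ω then (1 : ℝ) else 0) = 0 := by
        rw [expect_congr (F' := fun _ => 0), expect_const]
        exact fun ω hω => if_neg fun h => he (hω (h heS))
      have h2 : ∀ ω : Finset E, S ⊆ insert e ω ↔ S.erase e ⊆ ω := fun ω =>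
        Finset.subset_insert_iff
      simp only [h2]
      rw [h1, ih (Finset.subset_insert_iff.1 hS), Finset.mul_prod_erase _ _ heS]
      ring
    · have h2 : ∀ ω : Finset E, S ⊆ insert e ω ↔ S ⊆ ω := fun ω =>
        Finset.subset_insert_iff_of_notMem heS
      simp only [h2]
      rw [ih ((Finset.subset_insert_iff_of_notMem heS).1 hS)]
      ring

/-- The Chebyshev inequality. -/
theorem expect_chebyshev (hq : ∀ e ∈ W, 0 ≤ q e ∧ q e ≤ 1) {μ v : ℝ} (hμ : 0 < μ)
    (h1 : expect q W F = μ) (h2 : expect q W (fun ω => F ω * F ω) ≤ μ ^ 2 * (1 + v)) :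
    expect q W (fun ω => if F ω < μ / 2 then 1 else 0) ≤ 4 * v := by
  -- Where `F ω < μ / 2`, the squared deviation is at least `μ ^ 2 / 4`, so the indicator is at most
  -- `4 / μ ^ 2` times it.
  have h3 : expect q W (fun ω => if F ω < μ / 2 then 1 else 0) ≤
      expect q W (fun ω => 4 / μ ^ 2 * (F ω * F ω + ((-2 * μ) * F ω + μ ^ 2))) := by
    refine expect_mono hq fun ω _ => ?_
    have h4 : F ω * F ω + ((-2 * μ) * F ω + μ ^ 2) = (F ω - μ) ^ 2 := by ring
    rw [h4]
    split_ifs with h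
    · rw [div_mul_eq_mul_div, le_div_iff₀ (by positivity)]
      nlinarith
    · positivity
  refine h3.trans ?_
  rw [expect_const_mul, expect_add, expect_add, expect_const_mul, expect_const, h1,
    div_mul_eq_mul_div, div_le_iff₀ (by positivity)]
  nlinarith

end Bernoulli

/-! ### The random structure and first moment bounds. -/

section RandomConfig

variable {p : ℕ} {k : Fin p → ℕ} {α γ : Fin p → ℝ} {n : ℕ}

/-- The places at which a configuration may have an edge. -/
def slots (k : Fin p → ℕ) (n : ℕ) : Finset (Fin p × Finset (Fin n)) :=
  Finset.univ.filter fun e => e.2.card = k e.1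

theorem mem_slots {e : Fin p × Finset (Fin n)} : e ∈ slots k n ↔ e.2.card = k e.1 := by
  simp [slots]

/-- The probability of an edge. -/
def slotProb (α γ : Fin p → ℝ) (n : ℕ) (e : Fin p × Finset (Fin n)) : ℝ :=
  γ e.1 * (n : ℝ) ^ (-α e.1)

/-- The configuration with a given set of edges. -/
def cfg (k : Fin p → ℕ) (ω : Finset (Fin p × Finset (Fin n))) : Config k n :=
  fun i => Finset.univ.filter fun C => (i, C.1) ∈ ω

theorem mem_edges_cfg (ω : Finset (Fin p × Finset (Fin n))) (i : Fin p) (C : Finset (Fin n)) :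
    C ∈ edges k (cfg k ω).Carrier i ↔ C.card = k i ∧ (i, C) ∈ ω := by
  refine (mem_edges_toStructure (cfg k ω) i C).trans ?_
  simp [cfg]

theorem slotProb_mem (hα : ∀ i, 0 < α i) (hγ : ∀ i, 0 < γ i ∧ γ i ≤ 1) (hn : 0 < n)
    (e : Fin p × Finset (Fin n)) : 0 < slotProb α γ n e ∧ slotProb α γ n e ≤ 1 := by
  have hn' : (1 : ℝ) ≤ n := by exact_mod_cast hn
  have h1 : (n : ℝ) ^ (-α e.1) ≤ 1 :=
    Real.rpow_le_one_of_one_le_of_nonpos hn' (by linarith [hα e.1])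
  have h2 : 0 < (n : ℝ) ^ (-α e.1) := Real.rpow_pos_of_pos (by linarith) _
  exact ⟨mul_pos (hγ _).1 h2, mul_le_one₀ (hγ _).2 h2.le h1⟩

theorem slotProb_le_rpow (hγ : ∀ i, 0 < γ i ∧ γ i ≤ 1) (e : Fin p × Finset (Fin n)) :
    slotProb α γ n e ≤ (n : ℝ) ^ (-α e.1) :=
  mul_le_of_le_one_left (Real.rpow_nonneg (Nat.cast_nonneg _) _) (hγ _).2

theorem weight_cfg {ω : Finset (Fin p × Finset (Fin n))} (hω : ω ⊆ slots k n) :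
    weight α γ (cfg k ω) =
      (∏ e ∈ ω, slotProb α γ n e) * ∏ e ∈ slots k n \ ω, (1 - slotProb α γ n e) := by
  have h1 : weight α γ (cfg k ω) =
      ∏ e ∈ slots k n, if e ∈ ω then slotProb α γ n e else 1 - slotProb α γ n e := by
    unfold weight slots
    rw [Finset.prod_filter, Fintype.prod_prod_type]
    refine Finset.prod_congr rfl fun i _ => ?_
    rw [← Finset.prod_filter]
    symm
    refine (Finset.prod_subtype (F := inferInstance) _ (p := fun C => C.card = k i) (by simp) _).trans ?_
    refine Finset.prod_congr rfl fun C _ => ?_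
    simp only [cfg, Finset.mem_filter, Finset.mem_univ, true_and]
    rfl
  rw [h1, Finset.prod_ite]
  congr 1
  · refine Finset.prod_congr ?_ fun _ _ => rfl
    ext e
    simp only [Finset.mem_filter]
    exact ⟨fun h => h.2, fun h => ⟨hω h, h⟩⟩
  · refine Finset.prod_congr ?_ fun _ _ => rfl
    ext e
    simp

-- Configurations correspond to subsets of the set of slots, which turns the weights into a product
-- measure with independent slots.
open Classical in
theorem prob_eq_expect (φ : (lang k).Sentence) : prob α γ n φ =
    expect (slotProb α γ n) (slots k n) fun ω => if (cfg k ω).Carrier ⊨ φ then 1 else 0 := by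
  unfold prob expect
  symm
  refine Finset.sum_bij' (fun ω _ => cfg k ω)
    (fun G _ => (slots k n).filter fun e => ∃ h, (⟨e.2, h⟩ : {C : Finset (Fin n) // C.card = k e.1}) ∈ G e.1)
    (fun _ _ => Finset.mem_univ _) (fun G _ => Finset.mem_powerset.2 (Finset.filter_subset _ _))
    ?_ ?_ ?_
  · intro ω hω
    rw [Finset.mem_powerset] at hω
    ext e
    simp only [cfg, Finset.mem_filter, Finset.mem_univ, true_and, exists_prop, mem_slots]
    exact ⟨fun h => h.2.2, fun h => ⟨mem_slots.1 (hω h), mem_slots.1 (hω h), h⟩⟩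
  · intro G _
    funext i
    ext C
    simp only [cfg, Finset.mem_filter, Finset.mem_univ, true_and, mem_slots]
    exact ⟨fun h => h.2.2, fun h => ⟨C.2, C.2, h⟩⟩
  · intro ω hω
    rw [← weight_cfg (Finset.mem_powerset.1 hω)]
    by_cases h : (cfg k ω).Carrier ⊨ φ
    · exact (congrArg _ (if_pos h)).trans ((mul_one _).trans (if_pos h).symm)
    · exact (congrArg _ (if_neg h)).trans ((mul_zero _).trans (if_neg h).symm)

theorem predim_cfg {ω : Finset (Fin p × Finset (Fin n))} (hω : ω ⊆ slots k n)
    (V : Finset (Fin n)) : predim k α (M := (cfg k ω).Carrier) V =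
      V.card - ∑ e ∈ ω.filter (·.2 ⊆ V), α e.1 := by
  classical
  unfold predim
  congr 1
  rw [← Finset.sum_fiberwise (s := ω.filter (·.2 ⊆ V)) (g := fun e => e.1)]
  refine Finset.sum_congr rfl fun i _ => ?_
  rw [Finset.sum_congr rfl (g := fun _ => α i) fun e he => by rw [(Finset.mem_filter.1 he).2],
    Finset.sum_const, nsmul_eq_mul, mul_comm]
  congr 2
  refine (edgeCount_eq_card (M := (cfg k ω).Carrier) i V).trans ?_
  refine Finset.card_bij (fun C _ => (i, C)) ?_ ?_ ?_
  · intro C hC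
    have h := mem_edgesIn.1 hC
    simp only [Finset.mem_filter, and_true]
    exact ⟨((mem_edges_cfg ω i C).1 h.2).2, h.1⟩
  · intro C _ C' _ h
    exact (Prod.mk.inj h).2
  · rintro ⟨j, C⟩ h
    simp only [Finset.mem_filter] at h
    obtain ⟨⟨h1, h2⟩, rfl⟩ := h
    exact ⟨C, mem_edgesIn.2 ⟨h2, (mem_edges_cfg ω j C).2 ⟨mem_slots.1 (hω h1), h1⟩⟩, rfl⟩

open Classical in
/-- The sets of at most `s` vertices with predimension at most `D`. -/
def lowSets (k : Fin p → ℕ) (α : Fin p → ℝ) (s : ℕ) (D : ℝ)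
    (ω : Finset (Fin p × Finset (Fin n))) : Finset (Finset (Fin n)) :=
  Finset.univ.filter fun V => V.card ≤ s ∧ predim k α (M := (cfg k ω).Carrier) V ≤ D

theorem mem_lowSets {s : ℕ} {D : ℝ} {ω : Finset (Fin p × Finset (Fin n))} {V : Finset (Fin n)} :
    V ∈ lowSets k α s D ω ↔ V.card ≤ s ∧ predim k α (M := (cfg k ω).Carrier) V ≤ D := by
  simp [lowSets]

-- The edges inside `V` form a set `T` of slots with `V.card - ∑ e ∈ T, α e.1 ≤ D`, present with
-- probability at most `n ^ (-∑ α) ≤ n ^ (D - V.card)`. The factor in front bounds the number of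
-- candidates `T`.
open Classical in
theorem expect_predim_le (hα : ∀ i, 0 < α i) (hγ : ∀ i, 0 < γ i ∧ γ i ≤ 1) (hn : 0 < n) (s : ℕ)
    (D : ℝ) (V : Finset (Fin n)) (hV : V.card ≤ s) :
    expect (slotProb α γ n) (slots k n)
      (fun ω => if predim k α (M := (cfg k ω).Carrier) V ≤ D then 1 else 0) ≤
      2 ^ (p * 2 ^ s) * (n : ℝ) ^ (D - V.card) := by
  have hn' : (1 : ℝ) ≤ n := by exact_mod_cast hn
  have hn0 : (0 : ℝ) < n := by linarith
  let S := (slots k n).filter (·.2 ⊆ V)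
  let P := S.powerset.filter fun T => V.card - ∑ e ∈ T, α e.1 ≤ D
  have hq := fun e (_ : e ∈ slots k n) =>
    (⟨(slotProb_mem hα hγ hn e).1.le, (slotProb_mem hα hγ hn e).2⟩ :
      0 ≤ slotProb α γ n e ∧ slotProb α γ n e ≤ 1)
  have h1 : expect (slotProb α γ n) (slots k n)
      (fun ω => if predim k α (M := (cfg k ω).Carrier) V ≤ D then 1 else 0) ≤
      expect (slotProb α γ n) (slots k n) (fun ω => ∑ T ∈ P, if T ⊆ ω then 1 else 0) := by
    refine expect_mono hq fun ω hω => ?_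
    split_ifs with h
    · rw [predim_cfg hω] at h
      have hmem : ω.filter (·.2 ⊆ V) ∈ P :=
        Finset.mem_filter.2 ⟨Finset.mem_powerset.2 (Finset.filter_subset_filter _ hω), h⟩
      refine le_trans ?_ (Finset.single_le_sum (f := fun T => if T ⊆ ω then (1 : ℝ) else 0)
        (fun T _ => by positivity) hmem)
      simp only [if_pos (Finset.filter_subset (fun e : Fin p × Finset (Fin n) => e.2 ⊆ V) ω), le_refl]
    · exact Finset.sum_nonneg fun T _ => by positivity
  refine h1.trans ?_
  rw [expect_sum]
  have h2 : ∀ T ∈ P, expect (slotProb α γ n) (slots k n) (fun ω => if T ⊆ ω then 1 else 0) ≤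
      (n : ℝ) ^ (D - V.card) := by
    intro T hT
    obtain ⟨hT1, hT2⟩ := Finset.mem_filter.1 hT
    rw [expect_subset ((Finset.mem_powerset.1 hT1).trans (Finset.filter_subset _ _))]
    calc ∏ e ∈ T, slotProb α γ n e ≤ ∏ e ∈ T, (n : ℝ) ^ (-α e.1) :=
          Finset.prod_le_prod (fun e _ => (slotProb_mem hα hγ hn e).1.le)
            fun e _ => slotProb_le_rpow hγ e
      _ = (n : ℝ) ^ (∑ e ∈ T, -α e.1) := (Real.rpow_sum_of_pos hn0 _ _).symm
      _ ≤ (n : ℝ) ^ (D - V.card) := by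
          refine Real.rpow_le_rpow_of_exponent_le hn' ?_
          rw [Finset.sum_neg_distrib]
          linarith
  refine (Finset.sum_le_card_nsmul _ _ _ h2).trans ?_
  rw [nsmul_eq_mul]
  refine mul_le_mul_of_nonneg_right ?_ (Real.rpow_nonneg hn0.le _)
  have h3 : S.card ≤ p * 2 ^ s := by
    have : S ⊆ Finset.univ ×ˢ V.powerset := fun e he =>
      Finset.mem_product.2 ⟨Finset.mem_univ _, Finset.mem_powerset.2 (Finset.mem_filter.1 he).2⟩
    refine (Finset.card_le_card this).trans ?_
    rw [Finset.card_product, Finset.card_univ, Fintype.card_fin, Finset.card_powerset]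
    exact Nat.mul_le_mul_left _ (Nat.pow_le_pow_right (by norm_num) hV)
  have h4 : P.card ≤ 2 ^ (p * 2 ^ s) :=
    (Finset.card_filter_le _ _).trans ((Finset.card_powerset S).le.trans
      (Nat.pow_le_pow_right (by norm_num) h3))
  exact_mod_cast h4

/-- The expected number of small sets of small predimension. -/
theorem expect_lowSets_le (hα : ∀ i, 0 < α i) (hγ : ∀ i, 0 < γ i ∧ γ i ≤ 1) (hn : 0 < n) (s : ℕ)
    (D : ℝ) : expect (slotProb α γ n) (slots k n) (fun ω => ((lowSets k α s D ω).card : ℝ)) ≤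
      (s + 1) * 2 ^ (p * 2 ^ s) * (n : ℝ) ^ D := by
  classical
  have hn0 : (0 : ℝ) < n := by exact_mod_cast hn
  let Q : Finset (Finset (Fin n)) := Finset.univ.filter fun V => V.card ≤ s
  have h1 : ∀ ω : Finset (Fin p × Finset (Fin n)), ((lowSets k α s D ω).card : ℝ) =
      ∑ V ∈ Q, if predim k α (M := (cfg k ω).Carrier) V ≤ D then 1 else 0 := by
    intro ω
    rw [Finset.sum_boole, Finset.filter_filter]
    rfl
  simp only [h1]
  rw [expect_sum]
  refine (Finset.sum_le_sum fun V hV => expect_predim_le hα hγ hn s D V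
    (Finset.mem_filter.1 hV).2).trans ?_
  rw [← Finset.sum_fiberwise_of_maps_to (s := Q) (t := Finset.range (s + 1)) (g := Finset.card)
    fun V hV => Finset.mem_range.2 (Nat.lt_succ_of_le (Finset.mem_filter.1 hV).2)]
  -- There are at most `n ^ j` sets of size `j`, which cancels the `-j` in the exponent; each of the
  -- `s + 1` sizes contributes the same bound.
  have h2 : ∀ j ∈ Finset.range (s + 1), ∑ V ∈ Q with V.card = j,
      (2 : ℝ) ^ (p * 2 ^ s) * (n : ℝ) ^ (D - (V.card : ℝ)) ≤ 2 ^ (p * 2 ^ s) * (n : ℝ) ^ D := by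
    intro j _
    rw [Finset.sum_congr rfl (g := fun _ => (2 : ℝ) ^ (p * 2 ^ s) * (n : ℝ) ^ (D - (j : ℝ)))
      fun V hV => by rw [(Finset.mem_filter.1 hV).2], Finset.sum_const, nsmul_eq_mul]
    have h3 : ((Q.filter fun V => V.card = j).card : ℝ) ≤ (n : ℝ) ^ j := by
      have : Q.filter (fun V => V.card = j) ⊆ Finset.univ.powersetCard j := fun V hV =>
        Finset.mem_powersetCard.2 ⟨Finset.subset_univ _, (Finset.mem_filter.1 hV).2⟩
      have h4 := Finset.card_le_card this
      rw [Finset.card_powersetCard, Finset.card_univ, Fintype.card_fin] at h4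
      exact_mod_cast h4.trans (Nat.choose_le_pow n j)
    calc ((Q.filter fun V => V.card = j).card : ℝ) * (2 ^ (p * 2 ^ s) * (n : ℝ) ^ (D - (j : ℝ)))
        ≤ (n : ℝ) ^ j * (2 ^ (p * 2 ^ s) * (n : ℝ) ^ (D - (j : ℝ))) :=
          mul_le_mul_of_nonneg_right h3 (by positivity)
      _ = 2 ^ (p * 2 ^ s) * ((n : ℝ) ^ (j : ℝ) * (n : ℝ) ^ (D - (j : ℝ))) := by
          rw [Real.rpow_natCast]; ring
      _ = 2 ^ (p * 2 ^ s) * (n : ℝ) ^ D := by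
          rw [← Real.rpow_add hn0]; congr 2; ring
  refine (Finset.sum_le_card_nsmul _ _ _ h2).trans ?_
  rw [Finset.card_range, nsmul_eq_mul]
  push_cast
  exact (mul_assoc _ _ _).ge

end RandomConfig

/-! ### The second moment method for copies of an extension. -/

section NewEdges

theorem injective_slot {p n : ℕ} {B : Type} {h : B → Fin n} (hh : Function.Injective h) :
    Function.Injective fun e : Fin p × Finset B => (e.1, e.2.image h) := by
  rintro ⟨i, C⟩ ⟨j, C'⟩ he
  simp only [Prod.mk.injEq] at he ⊢
  exact ⟨he.1, Finset.image_injective hh he.2⟩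

theorem injective_of_mem {n : ℕ} {B : Type} {F : B → Finset (Fin n)}
    (hF : ∀ b b', b ≠ b' → Disjoint (F b) (F b')) {h : B → Fin n} (hh : ∀ b, h b ∈ F b) :
    Function.Injective h := fun b b' hbb => by
  by_contra hne
  exact Finset.disjoint_left.1 (hF b b' hne) (hh b) (hbb ▸ hh b')

variable {p : ℕ} {k : Fin p → ℕ} {α γ : Fin p → ℝ} {n : ℕ}
  {B : Type} [(lang k).Structure B] [Fintype B]

open Classical in
/-- The edges that are not contained in `A`. -/
def newEdges (k : Fin p → ℕ) {B : Type} [(lang k).Structure B] [Fintype B] (A : Finset B) :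
    Finset (Fin p × Finset B) :=
  Finset.univ.filter fun e => e.2 ∈ edges k B e.1 ∧ ¬ e.2 ⊆ A

theorem mem_newEdges {A : Finset B} {e : Fin p × Finset B} :
    e ∈ newEdges k A ↔ e.2 ∈ edges k B e.1 ∧ ¬ e.2 ⊆ A := by
  simp [newEdges]

theorem predim_eq_newEdges [DecidableEq B] {A Z : Finset B} (hAZ : A ⊆ Z) : predim k α Z =
    predim k α A + (Z \ A).card - ∑ e ∈ (newEdges k A).filter (·.2 ⊆ Z), α e.1 := by
  have h1 : ∑ e ∈ (newEdges k A).filter (·.2 ⊆ Z), α e.1 =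
      ∑ i, α i * ((edgeCount k i Z : ℝ) - edgeCount k i A) := by
    rw [← Finset.sum_fiberwise (s := (newEdges k A).filter (·.2 ⊆ Z)) (g := fun e => e.1)]
    refine Finset.sum_congr rfl fun i _ => ?_
    rw [Finset.sum_congr rfl (g := fun _ => α i) fun e he => by rw [(Finset.mem_filter.1 he).2],
      Finset.sum_const, nsmul_eq_mul, mul_comm, edgeCount_eq_card, edgeCount_eq_card]
    congr 1
    have hsub : edgesIn k i A ⊆ edgesIn k i Z := fun C hC => by
      rw [mem_edgesIn] at hC ⊢
      exact ⟨hC.1.trans hAZ, hC.2⟩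
    have h2 := Finset.card_sdiff_add_card_eq_card hsub
    have h3 : (((newEdges k A).filter (·.2 ⊆ Z)).filter fun e => e.1 = i).card =
        (edgesIn k i Z \ edgesIn k i A).card := by
      symm
      refine Finset.card_bij (fun C _ => (i, C)) ?_ ?_ ?_
      · intro C hC
        simp only [Finset.mem_sdiff, mem_edgesIn] at hC
        simp only [Finset.mem_filter, mem_newEdges, and_true]
        exact ⟨⟨hC.1.2, fun h => hC.2 ⟨h, hC.1.2⟩⟩, hC.1.1⟩
      · intro C _ C' _ h
        exact (Prod.mk.inj h).2
      · rintro ⟨j, C⟩ h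
        simp only [Finset.mem_filter, mem_newEdges] at h
        obtain ⟨⟨⟨h4, h5⟩, h6⟩, rfl⟩ := h
        refine ⟨C, ?_, rfl⟩
        simp only [Finset.mem_sdiff, mem_edgesIn]
        exact ⟨⟨h6, h4⟩, fun h => h5 h.1⟩
    rw [h3, ← h2]
    push_cast
    ring
  have h4 : ((Z \ A).card : ℝ) = Z.card - A.card := by
    rw [← Finset.card_sdiff_add_card_eq_card hAZ]
    push_cast
    ring
  rw [h1, h4]
  simp only [predim, mul_sub, Finset.sum_sub_distrib]
  ring

/-- The places that have to be edges for `h` to preserve the new edges. -/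
def slotsOf (k : Fin p → ℕ) [(lang k).Structure B] (A : Finset B) (h : B → Fin n) :
    Finset (Fin p × Finset (Fin n)) :=
  (newEdges k A).image fun e => (e.1, e.2.image h)

theorem slotsOf_subset (A : Finset B) {h : B → Fin n} (hh : Function.Injective h) :
    slotsOf k A h ⊆ slots k n := by
  intro e he
  obtain ⟨e', he', rfl⟩ := Finset.mem_image.1 he
  rw [mem_slots]
  exact (Finset.card_image_of_injective _ hh).trans (mem_newEdges.1 he').1.1

/-- The probability that a given injection preserves the new edges. -/
def extProb (k : Fin p → ℕ) (α γ : Fin p → ℝ) (n : ℕ) [(lang k).Structure B] (A : Finset B) : ℝ :=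
  ∏ e ∈ newEdges k A, (γ e.1 * (n : ℝ) ^ (-α e.1))

theorem prod_slotsOf (A : Finset B) {h : B → Fin n} (hh : Function.Injective h) :
    ∏ e ∈ slotsOf k A h, slotProb α γ n e = extProb k α γ n A :=
  Finset.prod_image fun _ _ _ _ he => injective_slot hh he

/-- With about `n ^ (Finset.univ \ A).card` maps available, the expected number of copies has order
`n ^ (δ(B) - δ(A))`. -/
theorem extProb_eq [DecidableEq B] (hn : 0 < n) (A : Finset B) : extProb k α γ n A =
    (∏ e ∈ newEdges k A, γ e.1) *
      (n : ℝ) ^ (predim k α (Finset.univ : Finset B) - predim k α A - (Finset.univ \ A).card) := by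
  unfold extProb
  rw [Finset.prod_mul_distrib, ← Real.rpow_sum_of_pos (by exact_mod_cast hn),
    predim_eq_newEdges (Finset.subset_univ A), Finset.sum_neg_distrib]
  congr 2
  simp only [Finset.subset_univ, Finset.filter_true]
  ring

/-- Common edges of two copies lie over the set where the copies agree. -/
theorem slotsOf_inter [DecidableEq B] (A : Finset B) {F : B → Finset (Fin n)}
    (hF : ∀ b b', b ≠ b' → Disjoint (F b) (F b')) {h h' : B → Fin n} (hh : ∀ b, h b ∈ F b)
    (hh' : ∀ b, h' b ∈ F b) : slotsOf k A h ∩ slotsOf k A h' =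
      ((newEdges k A).filter (·.2 ⊆ Finset.univ.filter fun b => h b = h' b)).image
        fun e => (e.1, e.2.image h) := by
  ext e
  simp only [slotsOf, Finset.mem_inter, Finset.mem_image, Finset.mem_filter]
  constructor
  · rintro ⟨⟨⟨i, C⟩, hC, rfl⟩, ⟨⟨j, C'⟩, hC', he⟩⟩
    refine ⟨(i, C), ⟨hC, fun b hb => ?_⟩, rfl⟩
    simp only [Prod.mk.injEq] at he
    have hb' : h b ∈ C'.image h' := he.2 ▸ Finset.mem_image_of_mem h hb
    obtain ⟨b', -, hb'⟩ := Finset.mem_image.1 hb'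
    have hbb : b = b' := by
      by_contra hne
      exact Finset.disjoint_left.1 (hF b b' hne) (hh b) (hb' ▸ hh' b')
    subst hbb
    simp [hb']
  · rintro ⟨⟨i, C⟩, ⟨hC, hCZ⟩, rfl⟩
    refine ⟨⟨(i, C), hC, rfl⟩, ⟨(i, C), hC, ?_⟩⟩
    simp only [Prod.mk.injEq, true_and]
    exact Finset.image_congr fun b hb => (Finset.mem_filter.1 (hCZ hb)).2.symm

/-- The joint probability is `extProb ^ 2` divided by the probability of the common slots, and these
lie over the set `Z` where the maps agree. If `Z = A` there are none. Otherwise `δ(Z) - δ(A) ≥ ε`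
bounds their probability below by a constant times `n ^ (ε - (Z \ A).card)`. -/
theorem expect_pair_le [DecidableEq B] (hα : ∀ i, 0 < α i) (hγ : ∀ i, 0 < γ i ∧ γ i ≤ 1) (hn : 0 < n)
    {A : Finset B} {ε : ℝ} (hε : ∀ Z, A ⊆ Z → Z ≠ A → ε ≤ predim k α Z - predim k α A)
    {F : B → Finset (Fin n)} (hF : ∀ b b', b ≠ b' → Disjoint (F b) (F b'))
    (hFA : ∀ b ∈ A, (F b).card = 1) {h h' : B → Fin n} (hh : ∀ b, h b ∈ F b)
    (hh' : ∀ b, h' b ∈ F b) :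
    expect (slotProb α γ n) (slots k n)
      (fun ω => (if slotsOf k A h ⊆ ω then 1 else 0) * (if slotsOf k A h' ⊆ ω then 1 else 0)) ≤
      extProb k α γ n A ^ 2 * (1 + (∏ e ∈ newEdges k A, γ e.1)⁻¹ * (n : ℝ) ^ (-ε) *
        (n : ℝ) ^ ((Finset.univ.filter fun b => h b = h' b) \ A).card) := by
  have hn1 : (1 : ℝ) ≤ n := by exact_mod_cast hn
  have hn0 : (0 : ℝ) < n := by linarith
  have hi := injective_of_mem hF hh
  have hi' := injective_of_mem hF hh'
  set Z := Finset.univ.filter fun b => h b = h' b with hZdef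
  have hAZ : A ⊆ Z := fun b hb => by
    obtain ⟨y, hy⟩ := Finset.card_eq_one.1 (hFA b hb)
    have h1 := hh b
    have h2 := hh' b
    rw [hy, Finset.mem_singleton] at h1 h2
    simp [hZdef, h1, h2]
  have hγ0 : 0 < ∏ e ∈ newEdges k A, γ e.1 := Finset.prod_pos fun e _ => (hγ e.1).1
  have e1 : expect (slotProb α γ n) (slots k n)
      (fun ω => (if slotsOf k A h ⊆ ω then 1 else 0) * (if slotsOf k A h' ⊆ ω then 1 else 0)) =
      ∏ e ∈ slotsOf k A h ∪ slotsOf k A h', slotProb α γ n e := by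
    rw [← expect_subset (Finset.union_subset (slotsOf_subset A hi) (slotsOf_subset A hi'))]
    refine expect_congr fun ω _ => ?_
    simp only [Finset.union_subset_iff, ite_and, ite_mul, one_mul, zero_mul]
  have e2 := Finset.prod_union_inter (s₁ := slotsOf k A h) (s₂ := slotsOf k A h')
    (f := slotProb α γ n)
  rw [prod_slotsOf A hi, prod_slotsOf A hi', ← sq] at e2
  rw [e1]
  by_cases hZ : Z = A
  · have e3 : slotsOf k A h ∩ slotsOf k A h' = ∅ := by
      rw [slotsOf_inter A hF hh hh', ← hZdef, hZ, Finset.image_eq_empty, Finset.filter_eq_empty_iff]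
      exact fun e he => (mem_newEdges.1 he).2
    rw [e3, Finset.prod_empty, mul_one] at e2
    rw [e2]
    exact le_mul_of_one_le_right (sq_nonneg _) (le_add_of_nonneg_right (by positivity))
  · have e3 : ∏ e ∈ slotsOf k A h ∩ slotsOf k A h', slotProb α γ n e =
        (∏ e ∈ (newEdges k A).filter (·.2 ⊆ Z), γ e.1) *
          (n : ℝ) ^ (predim k α Z - predim k α A - (Z \ A).card) := by
      rw [slotsOf_inter A hF hh hh', Finset.prod_image fun _ _ _ _ he => injective_slot hi he]
      simp only [slotProb]
      rw [Finset.prod_mul_distrib, ← Real.rpow_sum_of_pos hn0, predim_eq_newEdges hAZ,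
        Finset.sum_neg_distrib]
      congr 2
      ring
    have e4 : ∏ e ∈ newEdges k A, γ e.1 ≤ ∏ e ∈ (newEdges k A).filter (·.2 ⊆ Z), γ e.1 := by
      rw [← Finset.prod_filter_mul_prod_filter_not (newEdges k A) (fun e => e.2 ⊆ Z)]
      exact mul_le_of_le_one_right (Finset.prod_nonneg fun e _ => (hγ e.1).1.le)
        (Finset.prod_le_one (fun e _ => (hγ e.1).1.le) fun e _ => (hγ e.1).2)
    have e5 : (n : ℝ) ^ (ε - (Z \ A).card) ≤
        (n : ℝ) ^ (predim k α Z - predim k α A - (Z \ A).card) :=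
      Real.rpow_le_rpow_of_exponent_le hn1 (by linarith [hε Z hAZ hZ])
    have e6 : (∏ e ∈ newEdges k A, γ e.1) * (n : ℝ) ^ (ε - (Z \ A).card) ≤
        ∏ e ∈ slotsOf k A h ∩ slotsOf k A h', slotProb α γ n e := by
      rw [e3]
      exact mul_le_mul e4 e5 (Real.rpow_nonneg hn0.le _) (hγ0.le.trans e4)
    have e7 : 0 ≤ ∏ e ∈ slotsOf k A h ∪ slotsOf k A h', slotProb α γ n e :=
      Finset.prod_nonneg fun e _ => (slotProb_mem hα hγ hn e).1.le
    have e8 : (∏ e ∈ newEdges k A, γ e.1)⁻¹ * (n : ℝ) ^ (-ε) * (n : ℝ) ^ (Z \ A).card *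
        ((∏ e ∈ newEdges k A, γ e.1) * (n : ℝ) ^ (ε - (Z \ A).card)) = 1 := by
      have : (n : ℝ) ^ (-ε) * (n : ℝ) ^ (Z \ A).card * (n : ℝ) ^ (ε - (Z \ A).card) = 1 := by
        rw [← Real.rpow_natCast, ← Real.rpow_add hn0, ← Real.rpow_add hn0,
          show -ε + ((Z \ A).card : ℝ) + (ε - ((Z \ A).card : ℝ)) = 0 by ring, Real.rpow_zero]
      calc _ = ((∏ e ∈ newEdges k A, γ e.1)⁻¹ * (∏ e ∈ newEdges k A, γ e.1)) *
            ((n : ℝ) ^ (-ε) * (n : ℝ) ^ (Z \ A).card * (n : ℝ) ^ (ε - (Z \ A).card)) := by ring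
        _ = 1 := by rw [this, inv_mul_cancel₀ hγ0.ne', mul_one]
    set X := (∏ e ∈ newEdges k A, γ e.1)⁻¹ * (n : ℝ) ^ (-ε) * (n : ℝ) ^ (Z \ A).card with hX
    have hX0 : 0 ≤ X := by positivity
    calc ∏ e ∈ slotsOf k A h ∪ slotsOf k A h', slotProb α γ n e
        = (∏ e ∈ slotsOf k A h ∪ slotsOf k A h', slotProb α γ n e) *
            ((∏ e ∈ newEdges k A, γ e.1) * (n : ℝ) ^ (ε - (Z \ A).card)) * X := by
          rw [mul_assoc, mul_comm _ X, e8, mul_one]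
      _ ≤ (∏ e ∈ slotsOf k A h ∪ slotsOf k A h', slotProb α γ n e) *
            (∏ e ∈ slotsOf k A h ∩ slotsOf k A h', slotProb α γ n e) * X :=
          mul_le_mul_of_nonneg_right (mul_le_mul_of_nonneg_left e6 e7) hX0
      _ = extProb k α γ n A ^ 2 * X := by rw [e2]
      _ ≤ _ := mul_le_mul_of_nonneg_left (by linarith) (sq_nonneg _)

/-- The number of maps in a product of sets that preserve the new edges. -/
def copies (k : Fin p → ℕ) [(lang k).Structure B] [DecidableEq B] (A : Finset B) (F : B → Finset (Fin n))
    (ω : Finset (Fin p × Finset (Fin n))) : Finset (B → Fin n) :=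
  (Fintype.piFinset F).filter fun h => slotsOf k A h ⊆ ω

/-- The summand is a product over the points of `B`, so the sum factorizes. A point of `A`
contributes 1, and any other at most `(F b).card + n ≤ 2 * n`. -/
theorem sum_pow_agree_le [DecidableEq B] (hn : 0 < n) {A : Finset B} {F : B → Finset (Fin n)}
    (hFA : ∀ b ∈ A, (F b).card = 1) (h' : B → Fin n) :
    ∑ h ∈ Fintype.piFinset F, (n : ℝ) ^ ((Finset.univ.filter fun b => h b = h' b) \ A).card ≤
      (2 * n : ℝ) ^ (Finset.univ \ A).card := by
  have hn1 : (1 : ℝ) ≤ n := by exact_mod_cast hn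
  have h1 : ∀ h : B → Fin n, (n : ℝ) ^ ((Finset.univ.filter fun b => h b = h' b) \ A).card =
      ∏ b, if h b = h' b ∧ b ∉ A then (n : ℝ) else 1 := by
    intro h
    rw [Finset.prod_ite, Finset.prod_const, Finset.prod_const_one, mul_one]
    congr 2
    ext b
    simp
  simp only [h1]
  rw [← Finset.prod_univ_sum F fun b y => if y = h' b ∧ b ∉ A then (n : ℝ) else 1]
  have h2 : ∀ b, ∑ y ∈ F b, (if y = h' b ∧ b ∉ A then (n : ℝ) else 1) ≤
      if b ∉ A then (2 * n : ℝ) else 1 := by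
    intro b
    by_cases hb : b ∈ A
    · simp [hb, hFA b hb]
    · simp only [hb, not_false_eq_true, and_true, if_true]
      have h3 : ∀ y ∈ F b, (if y = h' b then (n : ℝ) else 1) ≤ 1 + if y = h' b then (n : ℝ) else 0 := by
        intro y _
        split_ifs <;> linarith
      refine (Finset.sum_le_sum h3).trans ?_
      rw [Finset.sum_add_distrib, Finset.sum_const, nsmul_eq_mul, mul_one, Finset.sum_ite_eq']
      have h4 : ((F b).card : ℝ) ≤ n := by
        have := Finset.card_le_univ (F b)
        rw [Fintype.card_fin] at this
        exact_mod_cast this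
      split_ifs <;> linarith
  refine (Finset.prod_le_prod (fun b _ => Finset.sum_nonneg fun y _ => ?_) fun b _ => h2 b).trans ?_
  · split_ifs <;> linarith
  · rw [Finset.prod_ite, Finset.prod_const, Finset.prod_const_one, mul_one]
    refine le_of_eq ?_
    congr 2
    ext b
    simp

/-- Second moment bound: there are rarely few copies. -/
theorem expect_few_copies_le [DecidableEq B] (hα : ∀ i, 0 < α i) (hγ : ∀ i, 0 < γ i ∧ γ i ≤ 1) (hn : 0 < n)
    {A : Finset B} {ε c : ℝ} (hε : ∀ Z, A ⊆ Z → Z ≠ A → ε ≤ predim k α Z - predim k α A)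
    (hc : 0 < c) {F : B → Finset (Fin n)} (hF : ∀ b b', b ≠ b' → Disjoint (F b) (F b'))
    (hFA : ∀ b ∈ A, (F b).card = 1) (hFc : ∀ b ∉ A, c * n ≤ (F b).card) :
    expect (slotProb α γ n) (slots k n) (fun ω => if ((copies k A F ω).card : ℝ) <
      (∏ e ∈ newEdges k A, γ e.1) * c ^ (Finset.univ \ A).card / 2 *
        (n : ℝ) ^ (predim k α (Finset.univ : Finset B) - predim k α A) then 1 else 0) ≤
      4 * ((∏ e ∈ newEdges k A, γ e.1)⁻¹ * (2 / c) ^ (Finset.univ \ A).card) * (n : ℝ) ^ (-ε) := by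
  have hn1 : (1 : ℝ) ≤ n := by exact_mod_cast hn
  have hn0 : (0 : ℝ) < n := by linarith
  have hγ0 : 0 < ∏ e ∈ newEdges k A, γ e.1 := Finset.prod_pos fun e _ => (hγ e.1).1
  have hq := fun e (_ : e ∈ slots k n) =>
    (⟨(slotProb_mem hα hγ hn e).1.le, (slotProb_mem hα hγ hn e).2⟩ :
      0 ≤ slotProb α γ n e ∧ slotProb α γ n e ≤ 1)
  set g := ∏ e ∈ newEdges k A, γ e.1
  set v := (Finset.univ \ A).card
  set q := extProb k α γ n A with hqdef
  have hq0 : 0 < q := Finset.prod_pos fun e _ => mul_pos (hγ e.1).1 (Real.rpow_pos_of_pos hn0 _)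
  set N : ℝ := ((Fintype.piFinset F).card : ℝ) with hN
  have hNc : (c * n) ^ v ≤ N := by
    rw [hN, Fintype.card_piFinset, Nat.cast_prod]
    have : (c * n : ℝ) ^ v = ∏ b, if b ∉ A then (c * n : ℝ) else 1 := by
      rw [Finset.prod_ite, Finset.prod_const, Finset.prod_const_one, mul_one]
      refine congrArg _ (congrArg Finset.card ?_)
      ext b
      simp
    rw [this]
    refine Finset.prod_le_prod (fun b _ => by split_ifs <;> positivity) fun b _ => ?_
    split_ifs with hb
    · rw [hFA b hb, Nat.cast_one]
    · exact hFc b hb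
  have hN0 : 0 < N := lt_of_lt_of_le (by positivity) hNc
  have hX : ∀ ω : Finset (Fin p × Finset (Fin n)), ((copies k A F ω).card : ℝ) =
      ∑ h ∈ Fintype.piFinset F, if slotsOf k A h ⊆ ω then 1 else 0 := fun ω => by
    rw [Finset.sum_boole]; rfl
  have hmem : ∀ {h : B → Fin n}, h ∈ Fintype.piFinset F → ∀ b, h b ∈ F b :=
    fun hh => Fintype.mem_piFinset.1 hh
  have h1 : expect (slotProb α γ n) (slots k n) (fun ω => ((copies k A F ω).card : ℝ)) = N * q := by
    simp only [hX]
    rw [expect_sum, Finset.sum_congr rfl (g := fun _ => q), Finset.sum_const, nsmul_eq_mul]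
    intro h hh
    have hi := injective_of_mem hF (hmem hh)
    rw [expect_subset (slotsOf_subset A hi), prod_slotsOf A hi]
  -- The terms `q ^ 2` add up to the square of the mean; the error terms are smaller by a factor of
  -- order `n ^ (-ε)`.
  have h2 : expect (slotProb α γ n) (slots k n)
      (fun ω => ((copies k A F ω).card : ℝ) * (copies k A F ω).card) ≤
      (N * q) ^ 2 * (1 + g⁻¹ * (2 / c) ^ v * (n : ℝ) ^ (-ε)) := by
    simp only [hX, Finset.sum_mul_sum]
    rw [expect_sum]
    simp only [expect_sum]
    calc _ ≤ ∑ h' ∈ Fintype.piFinset F, ∑ h ∈ Fintype.piFinset F, q ^ 2 * (1 + g⁻¹ * (n : ℝ) ^ (-ε) *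
        (n : ℝ) ^ ((Finset.univ.filter fun b => h b = h' b) \ A).card) := by
          rw [Finset.sum_comm]
          exact Finset.sum_le_sum fun h hh => Finset.sum_le_sum fun h' hh' =>
            expect_pair_le hα hγ hn hε hF hFA (hmem hh') (hmem hh)
      _ ≤ ∑ h' ∈ Fintype.piFinset F, q ^ 2 * (N + g⁻¹ * (n : ℝ) ^ (-ε) * (2 * n : ℝ) ^ v) := by
          refine Finset.sum_le_sum fun h' _ => ?_
          rw [← Finset.mul_sum, Finset.sum_add_distrib, Finset.sum_const, nsmul_eq_mul, mul_one,
            ← Finset.mul_sum]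
          refine mul_le_mul_of_nonneg_left (add_le_add_right (mul_le_mul_of_nonneg_left
            (sum_pow_agree_le hn hFA h') (by positivity)) _) (sq_nonneg _)
      _ = N * q ^ 2 * (N + g⁻¹ * (n : ℝ) ^ (-ε) * (2 * n : ℝ) ^ v) := by
          rw [Finset.sum_const, nsmul_eq_mul]; ring
      _ ≤ N * q ^ 2 * (N + g⁻¹ * (n : ℝ) ^ (-ε) * ((2 / c) ^ v * N)) := by
          refine mul_le_mul_of_nonneg_left (add_le_add_right (mul_le_mul_of_nonneg_left ?_
            (by positivity)) _) (by positivity)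
          have : (2 * n : ℝ) ^ v = (2 / c) ^ v * (c * n) ^ v := by
            rw [← mul_pow]
            congr 1
            field_simp
          rw [this]
          exact mul_le_mul_of_nonneg_left hNc (by positivity)
      _ = _ := by ring
  have h3 := expect_chebyshev hq (mul_pos hN0 hq0) h1 h2
  refine (expect_mono hq fun ω _ => ?_).trans (h3.trans (le_of_eq (by ring)))
  have h4 : g * c ^ v / 2 * (n : ℝ) ^ (predim k α (Finset.univ : Finset B) - predim k α A) ≤
      N * q / 2 := by
    have h5 : (n : ℝ) ^ (predim k α (Finset.univ : Finset B) - predim k α A) =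
        (n : ℝ) ^ v * (n : ℝ) ^ (predim k α (Finset.univ : Finset B) - predim k α A - v) := by
      rw [← Real.rpow_natCast, ← Real.rpow_add hn0]
      congr 1
      ring
    rw [hqdef, extProb_eq hn, h5]
    calc _ = (c * n) ^ v * (g * (n : ℝ) ^ (predim k α (Finset.univ : Finset B) - predim k α A - v)) / 2 := by
          rw [mul_pow]; ring
      _ ≤ _ := by
          refine div_le_div_of_nonneg_right (mul_le_mul_of_nonneg_right hNc ?_) (by norm_num)
          positivity
  split_ifs with h6 h7 h7
  · exact le_rfl
  · exact absurd (h6.trans_le h4) h7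
  · exact zero_le_one
  · exact le_rfl

end NewEdges

/-! ### Amplification by independent blocks of vertices. -/

section Blocks

theorem div_le_card_residue (n : ℕ) {M r : ℕ} (hr : r < M) :
    n / M ≤ (Finset.univ.filter fun y : Fin n => y.val % M = r).card := by
  have hlt : ∀ t : Fin (n / M), t.val * M + r < n := by
    intro t
    have h1 : (t.val + 1) * M ≤ n / M * M := Nat.mul_le_mul_right _ t.2
    have h2 := Nat.div_mul_le_self n M
    rw [add_mul, one_mul] at h1
    omega
  have := Finset.card_le_card_of_injOn (s := (Finset.univ : Finset (Fin (n / M))))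
    (t := Finset.univ.filter fun y : Fin n => y.val % M = r) (fun t => ⟨t.val * M + r, hlt t⟩) ?_ ?_
  · simpa using this
  · intro t _
    simp [Nat.mod_eq_of_lt hr]
  · intro t _ t' _ h
    simp only [Fin.mk.injEq] at h
    exact Fin.ext (Nat.eq_of_mul_eq_mul_right (by omega : 0 < M) (by omega))

variable {p : ℕ} {k : Fin p → ℕ} {α γ : Fin p → ℝ} {n : ℕ}
  {B : Type} [(lang k).Structure B] [Fintype B] [DecidableEq B]

/-- The injections that extend `f` on `A` and preserve the edges not contained in `A`. -/
def weakExts (k : Fin p → ℕ) [(lang k).Structure B] (A : Finset B) (f : B → Fin n)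
    (ω : Finset (Fin p × Finset (Fin n))) : Finset (B → Fin n) :=
  Finset.univ.filter fun h => Function.Injective h ∧ (∀ a ∈ A, h a = f a) ∧ slotsOf k A h ⊆ ω

/-- Possible values of an extension of `f` in the block `j`. -/
def blockFamily {m : ℕ} (M : ℕ) (idx : Fin m × B → ℕ) (A : Finset B) (f : B → Fin n) (j : Fin m)
    (b : B) : Finset (Fin n) :=
  if b ∈ A then {f b} else (Finset.univ.filter fun y : Fin n => y.val % M = idx (j, b)) \ A.image f

/-- A single second moment bound fails with probability of order `n ^ (-ε)`, too much for a union
bound over all `f`. Restricting to `m` blocks of residue classes gives `m` independent attempts, and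
few weak extensions in total means few copies in every block. -/
theorem expect_few_weakExts_le (hα : ∀ i, 0 < α i) (hγ : ∀ i, 0 < γ i ∧ γ i ≤ 1) (A : Finset B)
    {ε : ℝ} (hε : ∀ Z, A ⊆ Z → Z ≠ A → ε ≤ predim k α Z - predim k α A) (m : ℕ) :
    ∃ c > 0, ∃ C ≥ 0, ∃ n₀, ∀ n ≥ n₀, ∀ f : B → Fin n, Set.InjOn f A →
      expect (slotProb α γ n) (slots k n) (fun ω => if ((weakExts k A f ω).card : ℝ) <
        c * (n : ℝ) ^ (predim k α (Finset.univ : Finset B) - predim k α A) then 1 else 0) ≤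
        (C * (n : ℝ) ^ (-ε)) ^ m := by
  classical
  set g := ∏ e ∈ newEdges k A, γ e.1 with hg
  have hγ0 : 0 < g := Finset.prod_pos fun e _ => (hγ e.1).1
  -- Each block and point of `B` receives its own residue class; the 1 keeps the modulus positive.
  set M := Fintype.card (Fin m × B) + 1 with hM
  have hM0 : (0 : ℝ) < M := by positivity
  set v := (Finset.univ \ A).card with hv
  let idx : Fin m × B → ℕ := fun x => (Fintype.equivFin (Fin m × B) x).val
  have hidx : Function.Injective idx := fun x y h => (Fintype.equivFin _).injective (Fin.ext h)
  have hidxM : ∀ x, idx x < M := fun x => (Fintype.equivFin (Fin m × B) x).2.trans (Nat.lt_succ_self _)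
  -- A residue class has at least `n / M` elements, rounded down, of which at most `Fintype.card B`
  -- are removed as values of `f`. The threshold on `n` ensures that at least `n / (2 * M)` remain.
  set c : ℝ := 1 / (2 * M) with hc
  have hc0 : 0 < c := by positivity
  refine ⟨g * c ^ v / 2, by positivity, 4 * (g⁻¹ * (2 / c) ^ v), by positivity,
    2 * M * (Fintype.card B + 1) + 1, fun n hn f hf => ?_⟩
  have hn0 : 0 < n := by omega
  have hq := fun e (_ : e ∈ slots k n) =>
    (⟨(slotProb_mem hα hγ hn0 e).1.le, (slotProb_mem hα hγ hn0 e).2⟩ :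
      0 ≤ slotProb α γ n e ∧ slotProb α γ n e ≤ 1)
  let F : Fin m → B → Finset (Fin n) := blockFamily M idx A f
  have hFA' : ∀ j, ∀ b ∈ A, F j b = {f b} := fun j b hb => if_pos hb
  have hFn : ∀ j, ∀ b ∉ A, ∀ y, y ∈ F j b ↔ y.val % M = idx (j, b) ∧ y ∉ A.image f := by
    intro j b hb y
    have : F j b = (Finset.univ.filter fun y : Fin n => y.val % M = idx (j, b)) \ A.image f :=
      if_neg hb
    rw [this, Finset.mem_sdiff]
    simp
  have hF : ∀ j b b', b ≠ b' → Disjoint (F j b) (F j b') := by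
    intro j b b' hne
    rw [Finset.disjoint_left]
    intro y hy hy'
    by_cases hb : b ∈ A <;> by_cases hb' : b' ∈ A
    · rw [hFA' j b hb, Finset.mem_singleton] at hy
      rw [hFA' j b' hb', Finset.mem_singleton] at hy'
      exact hne (hf hb hb' (hy.symm.trans hy'))
    · rw [hFA' j b hb, Finset.mem_singleton] at hy
      exact ((hFn j b' hb' y).1 hy').2 (hy ▸ Finset.mem_image_of_mem f hb)
    · rw [hFA' j b' hb', Finset.mem_singleton] at hy'
      exact ((hFn j b hb y).1 hy).2 (hy' ▸ Finset.mem_image_of_mem f hb')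
    · have := hidx (((hFn j b hb y).1 hy).1.symm.trans ((hFn j b' hb' y).1 hy').1)
      exact hne (Prod.mk.inj this).2
  have hFA : ∀ j, ∀ b ∈ A, (F j b).card = 1 := fun j b hb => by
    rw [hFA' j b hb, Finset.card_singleton]
  have hFc : ∀ j, ∀ b ∉ A, c * n ≤ (F j b).card := by
    intro j b hb
    have h1 : n / M ≤ (F j b).card + Fintype.card B := by
      refine (div_le_card_residue n (hidxM (j, b))).trans ?_
      have h2 : F j b = (Finset.univ.filter fun y : Fin n => y.val % M = idx (j, b)) \ A.image f :=
        if_neg hb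
      have h3 := Finset.le_card_sdiff (A.image f)
        (Finset.univ.filter fun y : Fin n => y.val % M = idx (j, b))
      rw [← h2] at h3
      have h4 : (A.image f).card ≤ Fintype.card B := Finset.card_image_le.trans (Finset.card_le_univ _)
      omega
    have h2 : (n : ℝ) < M * ((F j b).card + Fintype.card B + 1) := by
      have : n < M * (n / M + 1) := Nat.lt_mul_div_succ n (Nat.succ_pos _)
      have h3 : n < M * ((F j b).card + Fintype.card B + 1) :=
        this.trans_le (Nat.mul_le_mul_left _ (by omega))
      exact_mod_cast h3
    have h3 : (2 * M * (Fintype.card B + 1) : ℝ) ≤ n := by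
      have : 2 * M * (Fintype.card B + 1) ≤ n := by omega
      exact_mod_cast this
    rw [hc, div_mul_eq_mul_div, one_mul, div_le_iff₀ (by positivity)]
    nlinarith
  let P : Fin m → Finset (Fin p × Finset (Fin n)) → ℝ := fun j ω =>
    if ((copies k A (F j) ω).card : ℝ) < g * c ^ v / 2 *
        (n : ℝ) ^ (predim k α (Finset.univ : Finset B) - predim k α A) then 1 else 0
  have h1 : expect (slotProb α γ n) (slots k n) (fun ω => if ((weakExts k A f ω).card : ℝ) <
      g * c ^ v / 2 * (n : ℝ) ^ (predim k α (Finset.univ : Finset B) - predim k α A) then 1 else 0) ≤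
      expect (slotProb α γ n) (slots k n) (fun ω => ∏ j, P j ω) := by
    refine expect_mono hq fun ω _ => ?_
    split_ifs with h
    · refine le_of_eq (Finset.prod_eq_one fun j _ => if_pos (lt_of_le_of_lt ?_ h)).symm
      have : copies k A (F j) ω ⊆ weakExts k A f ω := by
        intro x hx
        obtain ⟨hx1, hx2⟩ := Finset.mem_filter.1 hx
        rw [Fintype.mem_piFinset] at hx1
        refine Finset.mem_filter.2 ⟨Finset.mem_univ _, injective_of_mem (hF j) hx1, fun a ha => ?_, hx2⟩
        have := hx1 a
        rwa [hFA' j a ha, Finset.mem_singleton] at this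
      exact_mod_cast Finset.card_le_card this
    · refine Finset.prod_nonneg fun j _ => ?_
      change (0 : ℝ) ≤ if _ then 1 else 0
      positivity
  refine h1.trans ?_
  let S : Fin m → Set (Fin p × Finset (Fin n)) := fun j =>
    {e | ∃ x : B → Fin n, (∀ b, x b ∈ F j b) ∧ e ∈ slotsOf k A x}
  rw [expect_prod (S := S) Finset.univ]
  · calc ∏ j, expect (slotProb α γ n) (slots k n) (P j)
        ≤ ∏ _j : Fin m, (4 * (g⁻¹ * (2 / c) ^ v) * (n : ℝ) ^ (-ε)) := by
          refine Finset.prod_le_prod (fun j _ => expect_nonneg hq fun ω _ => ?_) fun j _ =>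
            expect_few_copies_le hα hγ hn0 hε hc0 (hF j) (hFA j) (hFc j)
          change (0 : ℝ) ≤ if _ then 1 else 0
          positivity
      _ = _ := by rw [Finset.prod_const, Finset.card_univ, Fintype.card_fin]
  -- Every new edge has a vertex outside `A`, whose image lies in a residue class of its own block
  -- and avoids the values of `f` on `A`. Hence different blocks use disjoint slots.
  · intro j j' hj
    rw [Set.disjoint_left]
    rintro e ⟨x, hx, he⟩ ⟨x', hx', he'⟩
    obtain ⟨⟨i, D⟩, hD, rfl⟩ := Finset.mem_image.1 he
    obtain ⟨⟨i', D'⟩, hD', he'⟩ := Finset.mem_image.1 he'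
    simp only [Prod.mk.injEq] at he'
    obtain ⟨b, hb, hbA⟩ := Finset.not_subset.1 (mem_newEdges.1 hD).2
    have h2 : x b ∈ D'.image x' := he'.2 ▸ Finset.mem_image_of_mem x hb
    obtain ⟨b', -, hbb⟩ := Finset.mem_image.1 h2
    have h3 := (hFn j b hbA _).1 (hx b)
    by_cases hbA' : b' ∈ A
    · have h4 := hx' b'
      rw [hFA' j' b' hbA', Finset.mem_singleton] at h4
      exact h3.2 (Finset.mem_image.2 ⟨b', hbA', h4.symm.trans hbb⟩)
    · have h4 := (hFn j' b' hbA' _).1 (hx' b')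
      rw [hbb] at h4
      exact hj (Prod.mk.inj (hidx (h3.1.symm.trans h4.1))).1
  · intro j ω ω' hω
    have : copies k A (F j) ω = copies k A (F j) ω' := by
      refine Finset.filter_congr fun x hx => ?_
      rw [Fintype.mem_piFinset] at hx
      exact ⟨fun h e he => (hω e ⟨x, hx, he⟩).1 (h he), fun h e he => (hω e ⟨x, hx, he⟩).2 (h he)⟩
    simp only [P, this]

open Classical in
/-- The maps with few weak extensions. -/
def poorMaps (k : Fin p → ℕ) [(lang k).Structure B] (A : Finset B) (x : ℝ)
    (ω : Finset (Fin p × Finset (Fin n))) : Finset (B → Fin n) :=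
  Finset.univ.filter fun f => Set.InjOn f A ∧ ((weakExts k A f ω).card : ℝ) < x

/-- Almost surely, there are no maps with few weak extensions. -/
theorem expect_poorMaps_le (hα : ∀ i, 0 < α i) (hγ : ∀ i, 0 < γ i ∧ γ i ≤ 1) (A : Finset B)
    {ε : ℝ} (hε0 : 0 < ε) (hε : ∀ Z, A ⊆ Z → Z ≠ A → ε ≤ predim k α Z - predim k α A) :
    ∃ c > 0, ∃ C, ∃ n₀, ∀ n ≥ n₀,
      expect (slotProb α γ n) (slots k n) (fun ω => ((poorMaps k A
        (c * (n : ℝ) ^ (predim k α (Finset.univ : Finset B) - predim k α A)) ω).card : ℝ)) ≤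
        C * (n : ℝ) ^ (-1 : ℝ) := by
  classical
  -- With this many blocks the failure probability is `O(n ^ (-Fintype.card B - 1))`, which beats
  -- the at most `n ^ Fintype.card B` maps `f`.
  obtain ⟨m, hm⟩ := exists_nat_gt (((Fintype.card B : ℝ) + 1) / ε)
  rw [div_lt_iff₀ hε0] at hm
  obtain ⟨c, hc, C, hC, n₀, h⟩ := expect_few_weakExts_le (k := k) hα hγ A hε m
  refine ⟨c, hc, C ^ m, n₀ + 1, fun n hn => ?_⟩
  have hn0 : 0 < n := by omega
  have hn1 : (1 : ℝ) ≤ n := by exact_mod_cast hn0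
  have hnp : (0 : ℝ) < n := by linarith
  let Q : Finset (B → Fin n) := Finset.univ.filter fun f => Set.InjOn f A
  have h1 : ∀ ω : Finset (Fin p × Finset (Fin n)), ((poorMaps k A
        (c * (n : ℝ) ^ (predim k α (Finset.univ : Finset B) - predim k α A)) ω).card : ℝ) =
      ∑ f ∈ Q, if ((weakExts k A f ω).card : ℝ) <
        c * (n : ℝ) ^ (predim k α (Finset.univ : Finset B) - predim k α A) then 1 else 0 := by
    intro ω
    rw [Finset.sum_boole, Finset.filter_filter]
    rfl
  simp only [h1]
  rw [expect_sum]
  refine (Finset.sum_le_card_nsmul _ _ _ fun f hf =>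
    h n (by omega) f (Finset.mem_filter.1 hf).2).trans ?_
  rw [nsmul_eq_mul]
  have h2 : (Q.card : ℝ) ≤ (n : ℝ) ^ (Fintype.card B : ℝ) := by
    rw [Real.rpow_natCast]
    have := Finset.card_le_univ Q
    rw [Fintype.card_fun, Fintype.card_fin] at this
    exact_mod_cast this
  calc (Q.card : ℝ) * (C * (n : ℝ) ^ (-ε)) ^ m
      ≤ (n : ℝ) ^ (Fintype.card B : ℝ) * (C * (n : ℝ) ^ (-ε)) ^ m :=
        mul_le_mul_of_nonneg_right h2 (by positivity)
    _ = C ^ m * (n : ℝ) ^ ((Fintype.card B : ℝ) + -ε * m) := by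
        rw [mul_pow, Real.rpow_add hnp, Real.rpow_mul hnp.le, Real.rpow_natCast, Real.rpow_natCast]
        ring
    _ ≤ C ^ m * (n : ℝ) ^ (-1 : ℝ) := by
        refine mul_le_mul_of_nonneg_left (Real.rpow_le_rpow_of_exponent_le hn1 ?_) (by positivity)
        linarith

end Blocks

/-! ### From weak extensions to closed embeddings. -/

section WeakExtensions

variable {p : ℕ} {k : Fin p → ℕ} {α γ : Fin p → ℝ}
  {A B N : Type} [(lang k).Structure A] [(lang k).Structure B] [(lang k).Structure N]

/-- An injection that preserves edges, and under which predimensions of small supersets of the image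
do not decrease, is an embedding with closed range. -/
theorem exists_embedding_of_predim_le (hα : ∀ i, 0 < α i) (hB : IsSymmetric k B)
    (hN : IsSymmetric k N) [Fintype B] (h : B ↪ N)
    (hedge : ∀ i, ∀ C ∈ edges k B i, C.map h ∈ edges k N i) {t : ℕ}
    (hpre : ∀ C : Finset N, Finset.univ.map h ⊆ C → C.card ≤ Fintype.card B + t →
      predim k α (Finset.univ : Finset B) ≤ predim k α C) :
    ∃ e : B ↪[lang k] N, (∀ b, e b = h b) ∧ TClosed k α t (Set.range e) := by
  classical
  set V := (Finset.univ : Finset B).map h with hV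
  have hVc : V.card = Fintype.card B := Finset.card_map _
  let im : Fin p → Finset (Finset N) := fun i =>
    (edgesIn k i (Finset.univ : Finset B)).map ⟨Finset.map h, Finset.map_injective h⟩
  have him : ∀ i, im i ⊆ edgesIn k i V := by
    intro i D hD
    obtain ⟨C, hC, rfl⟩ := Finset.mem_map.1 hD
    exact mem_edgesIn.2 ⟨Finset.map_subset_map.2 (Finset.subset_univ _),
      hedge i C (mem_edgesIn.1 hC).2⟩
  have hle : ∀ i, edgeCount k i (Finset.univ : Finset B) ≤ edgeCount k i V := by
    intro i
    have := Finset.card_le_card (him i)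
    rwa [Finset.card_map, ← edgeCount_eq_card, ← edgeCount_eq_card] at this
  have hVpre : predim k α (Finset.univ : Finset B) ≤ predim k α V :=
    hpre V subset_rfl (by omega)
  have hle' : ∀ i ∈ (Finset.univ : Finset (Fin p)),
      α i * (edgeCount k i (Finset.univ : Finset B) : ℝ) ≤ α i * (edgeCount k i V : ℝ) :=
    fun i _ => mul_le_mul_of_nonneg_left (by exact_mod_cast hle i) (hα i).le
  -- The image has at least the edges of `B`, and the predimension bound for the image itself
  -- permits no more. As all weights are positive, the counts agree for each symbol, so `h` also
  -- reflects edges.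
  have hsum : ∑ i, α i * (edgeCount k i (Finset.univ : Finset B) : ℝ) =
      ∑ i, α i * (edgeCount k i V : ℝ) := by
    refine le_antisymm (Finset.sum_le_sum hle') ?_
    unfold predim at hVpre
    rw [hVc, Finset.card_univ] at hVpre
    linarith
  have heq : ∀ i, edgeCount k i (Finset.univ : Finset B) = edgeCount k i V := by
    intro i
    have := (Finset.sum_eq_sum_iff_of_le hle').1 hsum i (Finset.mem_univ _)
    exact_mod_cast mul_left_cancel₀ (hα i).ne' this
  have hims : ∀ i, im i = edgesIn k i V := fun i =>
    Finset.eq_of_subset_of_card_le (him i) (by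
      rw [Finset.card_map, ← edgeCount_eq_card, ← edgeCount_eq_card, heq i])
  have hedge' : ∀ i (C : Finset B), C.map h ∈ edges k N i ↔ C ∈ edges k B i := by
    intro i C
    refine ⟨fun hC => ?_, hedge i C⟩
    have h1 : C.map h ∈ im i := hims i ▸ mem_edgesIn.2
      ⟨Finset.map_subset_map.2 (Finset.subset_univ _), hC⟩
    obtain ⟨C', hC', hCC⟩ := Finset.mem_map.1 h1
    rw [← Finset.map_injective h hCC]
    exact (mem_edgesIn.1 hC').2
  refine ⟨embOfEdges hB hN h hedge', fun b => rfl, ?_⟩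
  have hr : Set.range (embOfEdges hB hN h hedge') = (V : Set N) := by
    rw [hV, Finset.coe_map, Finset.coe_univ, Set.image_univ]
    rfl
  rw [hr, tClosed_coe_iff hα]
  intro F hF
  have hpV : predim k α V = predim k α (Finset.univ : Finset B) :=
    predim_map (embOfEdges hB hN h hedge') Finset.univ
  rw [hpV]
  exact hpre _ Finset.subset_union_left ((Finset.card_union_le _ _).trans (by omega))

/-- Predimension of a union of small supersets of a closed set. -/
theorem predim_biUnion_le [DecidableEq N] (hα : ∀ i, 0 < α i) {u : ℕ} {V₀ : Finset N}
    (hV₀ : TClosed k α u (V₀ : Set N)) {D : ℝ} {ι : Type} [DecidableEq ι] (s : Finset ι)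
    (C : ι → Finset N) (hC : ∀ j ∈ s, V₀ ⊆ C j) (hcard : ∀ j ∈ s, (C j).card ≤ V₀.card + u)
    (hD : ∀ j ∈ s, predim k α (C j) ≤ D) :
    predim k α (V₀ ∪ s.biUnion C) ≤ predim k α V₀ + s.card * (D - predim k α V₀) := by
  induction s using Finset.induction_on with
  | empty => simp
  | insert j s hj ih =>
    have ih := ih (fun i hi => hC i (Finset.mem_insert_of_mem hi))
      (fun i hi => hcard i (Finset.mem_insert_of_mem hi))
      fun i hi => hD i (Finset.mem_insert_of_mem hi)
    -- The intersection is a small superset of the closed set `V₀`, so its predimension is at least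
    -- that of `V₀`. Hence adding `C j` raises the predimension by at most `D - δ(V₀)`.
    have h1 := predim_submodular (k := k) hα (V₀ ∪ s.biUnion C) (C j)
    have h2 : predim k α V₀ ≤ predim k α ((V₀ ∪ s.biUnion C) ∩ C j) := by
      refine hV₀ V₀ _ ?_ ((Finset.card_le_card Finset.inter_subset_right).trans
        (hcard j (Finset.mem_insert_self _ _)))
      rw [eq_comm, Set.inter_eq_right]
      exact fun x hx => Finset.mem_coe.2 (Finset.mem_inter.2 ⟨Finset.mem_union_left _ hx,
        hC j (Finset.mem_insert_self _ _) hx⟩)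
    have h3 := hD j (Finset.mem_insert_self _ _)
    rw [Finset.biUnion_insert, Finset.union_comm (C j), ← Finset.union_assoc,
      Finset.card_insert_of_notMem hj]
    push_cast
    linarith

end WeakExtensions

/-! ### Bad copies force many sets of small predimension. -/

section Counting

variable {p : ℕ} {k : Fin p → ℕ} {α γ : Fin p → ℝ} {n : ℕ}
  {A B : Type} [(lang k).Structure A] [(lang k).Structure B] [Fintype A] [Fintype B] [DecidableEq B]

/-- If a closed copy of `A` has no good extension to `B`, then its weak extensions give rise to many
sets of small predimension. -/
theorem card_weakExts_pow_le (hα : ∀ i, 0 < α i) (hB : IsSymmetric k B) (g : A ↪[lang k] B)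
    {t u : ℕ} (hu : Fintype.card B + t ≤ Fintype.card A + u) {ε : ℝ}
    (hε : ∀ (M : Type) [(lang k).Structure M] (C : Finset M), C.card ≤ Fintype.card B + t →
      predim k α C < predim k α (Finset.univ : Finset B) →
      predim k α C ≤ predim k α (Finset.univ : Finset B) - ε)
    (ω : Finset (Fin p × Finset (Fin n))) (f : A ↪[lang k] (cfg k ω).Carrier)
    (hf : TClosed k α u (Set.range f))
    (hno : ¬ ∃ e : B ↪[lang k] (cfg k ω).Carrier, TClosed k α t (Set.range e) ∧ ∀ a, e (g a) = f a)
    (f' : B → Fin n) (hf' : ∀ a, f' (g a) = f a) (K : ℕ) :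
    (weakExts k (Finset.univ.map g.toEmbedding) f' ω).card ^ K ≤
      ((Fintype.card A + K * (Fintype.card B + t)) ^ Fintype.card B) ^ K *
        (lowSets k α (Fintype.card A + K * (Fintype.card B + t))
          (predim k α (Finset.univ : Finset A) + K * (predim k α (Finset.univ : Finset B) - ε -
            predim k α (Finset.univ : Finset A))) ω).card := by
  classical
  set N := (cfg k ω).Carrier with hN
  set s := Fintype.card A + K * (Fintype.card B + t) with hs
  set A' := (Finset.univ : Finset A).map g.toEmbedding with hA'
  let V₀ : Finset N := Finset.univ.map f.toEmbedding
  have hV₀ : predim k α V₀ = predim k α (Finset.univ : Finset A) := predim_map f _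
  have hV₀c : V₀.card = Fintype.card A := Finset.card_map _
  have hV₀f : (V₀ : Set N) = Set.range f := by
    rw [Finset.coe_map, Finset.coe_univ, Set.image_univ]
    rfl
  have hmem : ∀ {x : B → Fin n}, x ∈ weakExts k A' f' ω ↔ Function.Injective x ∧
      (∀ a ∈ A', x a = f' a) ∧ slotsOf k A' x ⊆ ω := by
    intro x
    simp [weakExts]
  have hga : ∀ a, g a ∈ A' := fun a => Finset.mem_map_of_mem _ (Finset.mem_univ a)
  -- A weak extension that is not a `t`-closed embedding lies in a set of at most `Fintype.card B +
  -- t` points whose predimension falls below that of `B`, hence by the gap falls short by at least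
  -- `ε`.
  have hext : ∀ x : B → Fin n, ∃ C : Finset N, x ∈ weakExts k A' f' ω →
      (∀ b, (x b : N) ∈ C) ∧ V₀ ⊆ C ∧ C.card ≤ Fintype.card B + t ∧
      predim k α C ≤ predim k α (Finset.univ : Finset B) - ε := by
    intro x
    by_cases hx : x ∈ weakExts k A' f' ω
    swap
    · exact ⟨∅, fun h => absurd h hx⟩
    obtain ⟨hx1, hx2, hx3⟩ := hmem.1 hx
    let h : B ↪ N := ⟨x, hx1⟩
    have hxf : ∀ a, h (g a) = f a := fun a => (hx2 _ (hga a)).trans (hf' a)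
    have hedge : ∀ i, ∀ C ∈ edges k B i, C.map h ∈ edges k N i := by
      intro i C hC
      by_cases hCA : C ⊆ A'
      · obtain ⟨C', -, rfl⟩ := Finset.subset_map_iff.1 hCA
        rw [map_mem_edges] at hC
        have : (C'.map g.toEmbedding).map h = C'.map f.toEmbedding := by
          rw [Finset.map_map]
          congr 1
          exact DFunLike.ext _ _ hxf
        rw [this, map_mem_edges]
        exact hC
      · have h1 : (i, C.image x) ∈ ω := hx3 (Finset.mem_image.2
          ⟨(i, C), mem_newEdges.2 ⟨hC, hCA⟩, rfl⟩)
        rw [Finset.map_eq_image]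
        exact (mem_edges_cfg ω i (C.image x)).2
          ⟨(Finset.card_image_of_injective _ hx1).trans hC.1, h1⟩
    by_contra hcon
    refine hno ?_
    obtain ⟨e, he1, he2⟩ := exists_embedding_of_predim_le (N := N) (α := α) hα hB
      (isSymmetric_toStructure (cfg k ω)) h hedge (t := t) (by
        intro C hC1 hC2
        by_contra hlt
        refine hcon ⟨C, fun _ => ⟨fun b => hC1 (Finset.mem_map_of_mem h (Finset.mem_univ b)), ?_,
          hC2, hε N C hC2 (not_le.1 hlt)⟩⟩
        intro y hy
        obtain ⟨a, -, rfl⟩ := Finset.mem_map.1 hy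
        have h1 : f a = h (g a) := (hxf a).symm
        exact hC1 (h1 ▸ Finset.mem_map_of_mem h (Finset.mem_univ (g a))))
    exact ⟨e, he2, fun a => (he1 _).trans (hxf a)⟩
  choose C hC using hext
  -- A `K`-tuple of weak extensions is sent to the union of its deficient sets, so the deficit `ε`
  -- accumulates `K` times. The fibres are bounded because all values of the tuple lie in that
  -- union.
  let T : Finset (Fin K → B → Fin n) := Fintype.piFinset fun _ => weakExts k A' f' ω
  let V : (Fin K → B → Fin n) → Finset (Fin n) := fun x =>
    (V₀ ∪ Finset.univ.biUnion fun j => C (x j) : Finset N)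
  have hT : (weakExts k A' f' ω).card ^ K = T.card := by
    rw [Fintype.card_piFinset, Finset.prod_const, Finset.card_univ, Fintype.card_fin]
  have hVs : ∀ x ∈ T, (V x).card ≤ s := by
    intro x hx
    rw [Fintype.mem_piFinset] at hx
    refine (Finset.card_union_le (α := N) _ _).trans ?_
    rw [hV₀c, hs]
    refine Nat.add_le_add_left ?_ _
    refine (Finset.card_biUnion_le_card_mul _ _ (Fintype.card B + t)
      fun j _ => (hC _ (hx j)).2.2.1).trans ?_
    rw [Finset.card_univ, Fintype.card_fin]
  rw [hT]
  refine Finset.card_le_mul_card_image_of_maps_to (f := V) (fun x hx => ?_) _ fun W hW => ?_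
  · have hx' := Fintype.mem_piFinset.1 hx
    refine mem_lowSets.2 ⟨hVs x hx, ?_⟩
    have := predim_biUnion_le (u := u) hα (hV₀f ▸ hf)
      (D := predim k α (Finset.univ : Finset B) - ε) (Finset.univ : Finset (Fin K))
      (fun j => C (x j)) (fun j _ => (hC _ (hx' j)).2.1)
      (fun j _ => (hC _ (hx' j)).2.2.1.trans (by rw [hV₀c]; exact hu))
      fun j _ => (hC _ (hx' j)).2.2.2
    rw [hV₀, Finset.card_univ, Fintype.card_fin] at this
    exact this
  · have h1 : T.filter (fun x => V x = W) ⊆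
        Fintype.piFinset fun _ => Fintype.piFinset fun _ => W := by
      intro x hx
      obtain ⟨hx1, hx2⟩ := Finset.mem_filter.1 hx
      rw [Fintype.mem_piFinset] at hx1
      rw [Fintype.mem_piFinset]
      intro j
      rw [Fintype.mem_piFinset]
      intro b
      have : (x j b : N) ∈ V x := Finset.mem_union_right _
        (Finset.mem_biUnion.2 ⟨j, Finset.mem_univ _, (hC _ (hx1 j)).1 b⟩)
      exact hx2 ▸ this
    refine (Finset.card_le_card h1).trans ?_
    simp only [Fintype.card_piFinset, Finset.prod_const, Finset.card_univ, Fintype.card_fin]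
    exact Nat.pow_le_pow_left (Nat.pow_le_pow_left (mem_lowSets.1 hW).1 _) _

/-- Equal predimensions would give a rational linear relation among 1 and the `α i`, forcing equal
cardinalities. Thus proper supersets of a closed set have strictly larger predimension, and
finiteness of `B` makes the gap uniform. This is the step that uses linear independence. -/
theorem exists_strict_gap (hind : LinearIndependent ℚ (Fin.cons 1 α : Fin (p + 1) → ℝ))
    {A : Finset B} (hA : ∀ t, TClosed k α t (A : Set B)) :
    ∃ ε > 0, ∀ Z, A ⊆ Z → Z ≠ A → ε ≤ predim k α Z - predim k α A := by
  classical
  have hpos : ∀ Z, A ⊆ Z → Z ≠ A → 0 < predim k α Z - predim k α A := by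
    intro Z hAZ hne
    have h1 : predim k α A ≤ predim k α Z := hA Z.card A Z (by
      rw [eq_comm, Set.inter_eq_right]; exact_mod_cast hAZ) (by omega)
    refine lt_of_le_of_ne (sub_nonneg.2 h1) fun h0 => hne ?_
    have h2 := Fintype.linearIndependent_iff.1 hind (Fin.cons ((Z.card : ℚ) - A.card)
      fun i => -((edgeCount k i Z : ℚ) - edgeCount k i A)) (by
        rw [Fin.sum_univ_succ]
        simp only [Fin.cons_zero, Fin.cons_succ, Rat.smul_def]
        push_cast
        unfold predim at h0
        rw [h0]
        simp only [neg_mul, sub_mul, Finset.sum_neg_distrib, Finset.sum_sub_distrib,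
          mul_comm (α _)]
        ring) 0
    simp only [Fin.cons_zero] at h2
    have h3 : Z.card = A.card := by
      have := sub_eq_zero.1 h2
      exact_mod_cast this
    exact (Finset.eq_of_subset_of_card_le hAZ h3.le).symm
  have hgap : ∀ S : Finset (Finset B), ∃ ε > 0, ∀ Z ∈ S, A ⊆ Z → Z ≠ A →
      ε ≤ predim k α Z - predim k α A := by
    intro S
    induction S using Finset.induction_on with
    | empty => exact ⟨1, one_pos, by simp⟩
    | insert Y S hY ih =>
      obtain ⟨ε, hε, h⟩ := ih
      by_cases hYA : A ⊆ Y ∧ Y ≠ A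
      · refine ⟨min ε (predim k α Y - predim k α A), lt_min hε (hpos Y hYA.1 hYA.2), ?_⟩
        intro Z hZ h1 h2
        rcases Finset.mem_insert.1 hZ with rfl | hZ
        · exact min_le_right _ _
        · exact (min_le_left _ _).trans (h Z hZ h1 h2)
      · refine ⟨ε, hε, fun Z hZ h1 h2 => ?_⟩
        rcases Finset.mem_insert.1 hZ with rfl | hZ
        · exact absurd ⟨h1, h2⟩ hYA
        · exact h Z hZ h1 h2
  obtain ⟨ε, hε, h⟩ := hgap Finset.univ
  exact ⟨ε, hε, fun Z => h Z (Finset.mem_univ _)⟩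

end Counting

/-! ### The almost sure theory. -/

section AlmostSure

variable {p : ℕ} {k : Fin p → ℕ} {α γ : Fin p → ℝ} {n : ℕ}

theorem prob_nonneg (hα : ∀ i, 0 < α i) (hγ : ∀ i, 0 < γ i ∧ γ i ≤ 1) (hn : 0 < n)
    (φ : (lang k).Sentence) : 0 ≤ prob α γ n φ := by
  classical
  rw [prob_eq_expect]
  refine expect_nonneg (fun e _ => ⟨(slotProb_mem hα hγ hn e).1.le, (slotProb_mem hα hγ hn e).2⟩)
    fun ω _ => ?_
  positivity

theorem prob_add_prob_not (φ : (lang k).Sentence) :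
    prob α γ n φ + prob α γ n (Formula.not φ) = 1 := by
  classical
  rw [prob_eq_expect, prob_eq_expect, ← expect_add]
  refine (expect_congr (F' := fun _ => 1) fun ω _ => ?_).trans (expect_const 1)
  by_cases h : (cfg k ω).Carrier ⊨ φ
  · simp [h]
  · simp [h]

theorem prob_le_one (hα : ∀ i, 0 < α i) (hγ : ∀ i, 0 < γ i ∧ γ i ≤ 1) (hn : 0 < n)
    (φ : (lang k).Sentence) : prob α γ n φ ≤ 1 := by
  linarith [prob_add_prob_not (α := α) (γ := γ) (n := n) φ, prob_nonneg hα hγ hn (Formula.not φ)]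

theorem exists_realize_of_prob_pos {φ : (lang k).Sentence} (h : 0 < prob α γ n φ) :
    ∃ ω : Finset (Fin p × Finset (Fin n)), (cfg k ω).Carrier ⊨ φ := by
  classical
  by_contra hcon
  rw [prob_eq_expect, expect_congr (F' := fun _ => 0), expect_const] at h
  · exact lt_irrefl _ h
  · exact fun ω _ => if_neg fun h => hcon ⟨ω, h⟩

/-- A first moment criterion for membership in the almost sure theory. -/
theorem mem_almostSureTheory_of_expect_le (hα : ∀ i, 0 < α i) (hγ : ∀ i, 0 < γ i ∧ γ i ≤ 1)
    {φ : (lang k).Sentence} (Z : ∀ n, Finset (Fin p × Finset (Fin n)) → ℝ)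
    (hZ0 : ∀ n ω, 0 ≤ Z n ω) (n₀ : ℕ)
    (hZ : ∀ n ≥ n₀, ∀ ω ⊆ slots k n, ¬ (cfg k ω).Carrier ⊨ φ → 1 ≤ Z n ω) {C η : ℝ} (hη : 0 < η)
    (hC : ∀ n ≥ n₀, expect (slotProb α γ n) (slots k n) (Z n) ≤ C * (n : ℝ) ^ (-η)) :
    φ ∈ almostSureTheory k α γ := by
  classical
  have hlim : Filter.Tendsto (fun n : ℕ => 1 - C * (n : ℝ) ^ (-η)) Filter.atTop (nhds 1) := by
    have h1 := ((tendsto_rpow_neg_atTop hη).comp tendsto_natCast_atTop_atTop).const_mul C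
    have h2 := h1.const_sub 1
    simpa using h2
  refine tendsto_of_tendsto_of_tendsto_of_le_of_le' hlim tendsto_const_nhds ?_ ?_
  · filter_upwards [Filter.eventually_ge_atTop (n₀ + 1)] with n hn
    have hn0 : 0 < n := by omega
    have h1 : (1 : ℝ) ≤ prob α γ n φ + expect (slotProb α γ n) (slots k n) (Z n) := by
      rw [prob_eq_expect, ← expect_add]
      refine (expect_const (q := slotProb α γ n) (W := slots k n) 1).ge.trans (expect_mono
        (fun e _ => ⟨(slotProb_mem hα hγ hn0 e).1.le, (slotProb_mem hα hγ hn0 e).2⟩) fun ω hω => ?_)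
      by_cases h : (cfg k ω).Carrier ⊨ φ
      · rw [if_pos h]
        linarith [hZ0 n ω]
      · rw [if_neg h]
        linarith [hZ n (by omega) ω hω h]
    linarith [hC n (by omega)]
  · filter_upwards [Filter.eventually_gt_atTop 0] with n hn using prob_le_one hα hγ hn φ

theorem mem_almostSureTheory_of_forall (hα : ∀ i, 0 < α i) (hγ : ∀ i, 0 < γ i ∧ γ i ≤ 1)
    {φ : (lang k).Sentence} (n₀ : ℕ)
    (h : ∀ n ≥ n₀, ∀ ω : Finset (Fin p × Finset (Fin n)), (cfg k ω).Carrier ⊨ φ) :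
    φ ∈ almostSureTheory k α γ :=
  mem_almostSureTheory_of_expect_le hα hγ (fun _ _ => 0) (fun _ _ => le_rfl) n₀
    (fun n hn ω _ hφ => absurd (h n hn ω) hφ) (C := 0) one_pos fun n _ => by
      rw [expect_const, zero_mul]

/-- Almost surely, small sets have nonnegative predimension. -/
theorem predim_sentence_mem (hα : ∀ i, 0 < α i) (hγ : ∀ i, 0 < γ i ∧ γ i ≤ 1) (s : ℕ)
    {σ : (lang k).Sentence} (hσ : ∀ (M : Type) [(lang k).Structure M], M ⊨ σ ↔
      ∀ A : Finset M, A.card ≤ s → 0 ≤ predim k α A) : σ ∈ almostSureTheory k α γ := by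
  -- A negative predimension on at most `s` points is at most `-ε`, and the expected number of such
  -- sets is `O(n ^ (-ε))`.
  obtain ⟨ε, hε, hgap⟩ := exists_predim_gap (k := k) hα s 0
  refine mem_almostSureTheory_of_expect_le hα hγ (fun n ω => ((lowSets k α s (-ε) ω).card : ℝ))
    (fun _ _ => Nat.cast_nonneg _) 1 (fun n _ ω _ h => ?_) hε fun n hn =>
      expect_lowSets_le hα hγ hn s (-ε)
  rw [hσ] at h
  push Not at h
  obtain ⟨V, hV, hV'⟩ := h
  have h1 := hgap _ V hV hV'
  rw [zero_sub] at h1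
  have h2 : 0 < (lowSets k α s (-ε) ω).card := Finset.card_pos.2 ⟨V, mem_lowSets.2 ⟨hV, h1⟩⟩
  exact_mod_cast h2

/-- Almost surely, closed copies extend. -/
theorem extension_sentence_mem (hα : ∀ i, 0 < α i) (hγ : ∀ i, 0 < γ i ∧ γ i ≤ 1)
    (hind : LinearIndependent ℚ (Fin.cons 1 α : Fin (p + 1) → ℝ)) {t u : ℕ} {A B : Type}
    [(lang k).Structure A] [(lang k).Structure B] [Fintype A] [Fintype B] (hB : InClass k α B)
    (g : A ↪[lang k] B) (hg : ∀ t, TClosed k α t (Set.range g))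
    (hu : Fintype.card B + t ≤ Fintype.card A + u) {σ : (lang k).Sentence}
    (hσ : ∀ (M : Type) [(lang k).Structure M], M ⊨ σ ↔
      ∀ f : A ↪[lang k] M, TClosed k α u (Set.range f) →
        ∃ h : B ↪[lang k] M, TClosed k α t (Set.range h) ∧ ∀ a, h (g a) = f a) :
    σ ∈ almostSureTheory k α γ := by
  classical
  set A' := (Finset.univ : Finset A).map g.toEmbedding with hA'
  have hA'g : (A' : Set B) = Set.range g := by
    rw [Finset.coe_map, Finset.coe_univ, Set.image_univ]
    rfl
  have hA'p : predim k α A' = predim k α (Finset.univ : Finset A) := predim_map g _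
  obtain ⟨ε₁, hε₁, hgap₁⟩ := exists_strict_gap (k := k) hind (hA'g ▸ hg)
  obtain ⟨c, hc, C₁, n₁, hpoor⟩ := expect_poorMaps_le (k := k) hα hγ A' hε₁ hgap₁
  obtain ⟨ε, hε, hgap⟩ := exists_predim_gap (k := k) hα (Fintype.card B + t)
    (predim k α (Finset.univ : Finset B))
  -- A copy that is not poor but has no good extension yields at least a constant times `n ^ (K *
  -- d)` low sets, against an expectation of order `n ^ D` with `D = δ(A') + K * d - K * ε`. This
  -- `K` makes the ratio `O(n ^ (-1))`.
  obtain ⟨K, hK⟩ := exists_nat_gt ((predim k α A' + 1) / ε)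
  rw [div_lt_iff₀ hε] at hK
  set d := predim k α (Finset.univ : Finset B) - predim k α A' with hd
  set s := Fintype.card A + K * (Fintype.card B + t) with hs
  set D := predim k α A' + K * (predim k α (Finset.univ : Finset B) - ε - predim k α A') with hD
  set R : ℝ := ((s : ℝ) ^ Fintype.card B) ^ K with hR
  have hR0 : 0 ≤ R := by positivity
  -- If some closed copy has no good extension, either it is a poor map, so the first term is at
  -- least 1, or its many weak extensions make the normalized number of low sets at least 1.
  refine mem_almostSureTheory_of_expect_le hα hγ (fun n ω =>
    ((poorMaps k A' (c * (n : ℝ) ^ d) ω).card : ℝ) +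
      R * ((c * (n : ℝ) ^ d) ^ K)⁻¹ * ((lowSets k α s D ω).card : ℝ)) (fun n ω => by positivity)
    (n₁ + 1) (fun n hn ω hω hno => ?_) (C := C₁ + R * (c ^ K)⁻¹ * ((s + 1) * 2 ^ (p * 2 ^ s)))
    one_pos fun n hn => ?_
  · have hn0 : (0 : ℝ) < n := by
      have : 0 < n := by omega
      exact_mod_cast this
    rw [hσ] at hno
    push Not at hno
    obtain ⟨f, hf, hno⟩ := hno
    let f' : B → Fin n := Function.extend g (f : A → Fin n) fun _ => ⟨0, by omega⟩
    have hf' : ∀ a, f' (g a) = f a := fun a => g.injective.extend_apply _ _ a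
    have hinj : Set.InjOn f' A' := by
      intro x hx y hy hxy
      rw [hA'g] at hx hy
      obtain ⟨a, rfl⟩ := hx
      obtain ⟨b, rfl⟩ := hy
      rw [hf', hf'] at hxy
      rw [f.injective hxy]
    by_cases hpf : ((weakExts k A' f' ω).card : ℝ) < c * (n : ℝ) ^ d
    · have h1 : 0 < (poorMaps k A' (c * (n : ℝ) ^ d) ω).card :=
        Finset.card_pos.2 ⟨f', by simpa [poorMaps] using ⟨hinj, hpf⟩⟩
      have h2 : (1 : ℝ) ≤ (poorMaps k A' (c * (n : ℝ) ^ d) ω).card := by exact_mod_cast h1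
      have h3 : 0 ≤ R * ((c * (n : ℝ) ^ d) ^ K)⁻¹ * ((lowSets k α s D ω).card : ℝ) := by positivity
      linarith
    · have h1 := card_weakExts_pow_le hα hB.1 g hu hgap ω f hf
        (by rintro ⟨e, he1, he2⟩; obtain ⟨a, ha⟩ := hno e he1; exact ha (he2 a)) f' hf' K
      rw [← hA'p, ← hA'] at h1
      have h2 : ((weakExts k A' f' ω).card : ℝ) ^ K ≤ R * ((lowSets k α s D ω).card : ℝ) := by
        rw [hR]
        exact_mod_cast h1
      have h3 : (c * (n : ℝ) ^ d) ^ K ≤ R * ((lowSets k α s D ω).card : ℝ) :=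
        (pow_le_pow_left₀ (by positivity) (not_lt.1 hpf) K).trans h2
      have h4 : 0 < (c * (n : ℝ) ^ d) ^ K := by positivity
      have h5 : 1 ≤ R * ((c * (n : ℝ) ^ d) ^ K)⁻¹ * ((lowSets k α s D ω).card : ℝ) := by
        rw [mul_right_comm, ← div_eq_mul_inv, le_div_iff₀ h4, one_mul]
        exact h3
      have h6 : (0 : ℝ) ≤ (poorMaps k A' (c * (n : ℝ) ^ d) ω).card := Nat.cast_nonneg _
      linarith
  · have hn0' : 0 < n := by omega
    have hn0 : (0 : ℝ) < n := by exact_mod_cast hn0'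
    have hn1 : (1 : ℝ) ≤ n := by exact_mod_cast hn0'
    rw [expect_add, expect_const_mul, add_mul]
    refine add_le_add (hpoor n (by omega)) ?_
    have h1 := expect_lowSets_le (k := k) hα hγ hn0' s D
    have h2 : ((c * (n : ℝ) ^ d) ^ K)⁻¹ * (n : ℝ) ^ D ≤ (c ^ K)⁻¹ * (n : ℝ) ^ (-1 : ℝ) := by
      rw [mul_pow, mul_inv, mul_assoc, ← Real.rpow_natCast ((n : ℝ) ^ d) K, ← Real.rpow_mul hn0.le,
        ← Real.rpow_neg hn0.le, ← Real.rpow_add hn0]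
      refine mul_le_mul_of_nonneg_left (Real.rpow_le_rpow_of_exponent_le hn1 ?_) (by positivity)
      rw [hD, hd]
      nlinarith
    calc _ ≤ R * ((c * (n : ℝ) ^ d) ^ K)⁻¹ * ((s + 1) * 2 ^ (p * 2 ^ s) * (n : ℝ) ^ D) :=
          mul_le_mul_of_nonneg_left h1 (by positivity)
      _ = R * ((s + 1) * 2 ^ (p * 2 ^ s)) * (((c * (n : ℝ) ^ d) ^ K)⁻¹ * (n : ℝ) ^ D) := by ring
      _ ≤ R * ((s + 1) * 2 ^ (p * 2 ^ s)) * ((c ^ K)⁻¹ * (n : ℝ) ^ (-1 : ℝ)) :=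
          mul_le_mul_of_nonneg_left h2 (by positivity)
      _ = _ := by ring

theorem semigenericTheory_subset (hα : ∀ i, 0 < α i) (hγ : ∀ i, 0 < γ i ∧ γ i ≤ 1)
    (hind : LinearIndependent ℚ (Fin.cons 1 α : Fin (p + 1) → ℝ)) :
    semigenericTheory k α ⊆ almostSureTheory k α γ := by
  rintro σ (hσ | ⟨s, hσ⟩ | ⟨t, u, v, A, B, _, _, _, _, g, hB, hg, hc, hu, hσ⟩)
  · exact mem_almostSureTheory_of_forall hα hγ 0 fun n _ ω =>
      (hσ _).2 (isSymmetric_toStructure (cfg k ω))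
  · exact predim_sentence_mem hα hγ s hσ
  · have := Fintype.ofFinite A
    have := Fintype.ofFinite B
    rw [Nat.card_eq_fintype_card, Nat.card_eq_fintype_card] at hc
    exact extension_sentence_mem hα hγ hind hB g hg (by omega) hσ

theorem semigeneric_of_model (hα : ∀ i, 0 < α i) (hγ : ∀ i, 0 < γ i ∧ γ i ≤ 1)
    (hind : LinearIndependent ℚ (Fin.cons 1 α : Fin (p + 1) → ℝ)) (M : Type)
    [(lang k).Structure M] (hM : M ⊨ almostSureTheory k α γ) : Semigeneric k α M :=
  (model_semigenericTheory_iff hα).1 (hM.mono (semigenericTheory_subset hα hγ hind))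

/-- The almost sure theory is closed under consequence. -/
theorem mem_of_models (hα : ∀ i, 0 < α i) (hγ : ∀ i, 0 < γ i ∧ γ i ≤ 1) {φ : (lang k).Sentence}
    (h : almostSureTheory k α γ ⊨ᵇ φ) : φ ∈ almostSureTheory k α γ := by
  classical
  -- By compactness finitely many hypotheses suffice, and the union bound applies to their failures.
  obtain ⟨Γ, hΓ, hφ⟩ := Theory.models_iff_finset_models.1 h
  have hlim : Filter.Tendsto (fun n => 1 - ∑ ψ ∈ Γ, (1 - prob α γ n ψ)) Filter.atTop (nhds 1) := by
    have h1 : Filter.Tendsto (fun n => ∑ ψ ∈ Γ, (1 - prob α γ n ψ)) Filter.atTop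
        (nhds (∑ _ψ ∈ Γ, (1 - 1 : ℝ))) :=
      tendsto_finsetSum _ fun ψ hψ => Filter.Tendsto.const_sub 1 (hΓ hψ)
    simpa using h1.const_sub 1
  refine tendsto_of_tendsto_of_tendsto_of_le_of_le' hlim tendsto_const_nhds ?_ ?_
  · filter_upwards [Filter.eventually_gt_atTop 0] with n hn
    have h1 : ∀ ψ : (lang k).Sentence, 1 - prob α γ n ψ = prob α γ n (Formula.not ψ) := fun ψ => by
      linarith [prob_add_prob_not (α := α) (γ := γ) (n := n) ψ]
    simp only [h1]
    rw [sub_le_iff_le_add]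
    simp only [prob_eq_expect]
    rw [← expect_sum, ← expect_add]
    refine (expect_const (q := slotProb α γ n) (W := slots k n) 1).ge.trans (expect_mono
      (fun e _ => ⟨(slotProb_mem hα hγ hn e).1.le, (slotProb_mem hα hγ hn e).2⟩) fun ω _ => ?_)
    have h2 : ∀ ψ ∈ Γ, (0 : ℝ) ≤ if (cfg k ω).Carrier ⊨ Formula.not ψ then 1 else 0 :=
      fun ψ _ => by positivity
    by_cases hall : ∀ ψ ∈ Γ, (cfg k ω).Carrier ⊨ ψ
    · have hne : Nonempty (cfg k ω).Carrier := ⟨(⟨0, hn⟩ : Fin n)⟩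
      have hmod : (cfg k ω).Carrier ⊨ (Γ : (lang k).Theory) := ⟨fun ψ hψ => hall ψ hψ⟩
      rw [if_pos (hφ.realize_sentence _)]
      linarith [Finset.sum_nonneg h2]
    · push Not at hall
      obtain ⟨ψ, hψ, hψ'⟩ := hall
      have h3 := Finset.single_le_sum h2 hψ
      rw [if_pos ((Sentence.realize_not _).2 hψ')] at h3
      have h4 : (0 : ℝ) ≤ if (cfg k ω).Carrier ⊨ φ then 1 else 0 := by positivity
      linarith
  · filter_upwards [Filter.eventually_gt_atTop 0] with n hn using prob_le_one hα hγ hn φ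

/-- All models of the almost sure theory are semigeneric, hence elementarily equivalent to `M`;
closure under consequence puts every truth of `M` into it. Conversely, a sentence and its negation
cannot both have limit probability 1. -/
theorem almostSureTheory_eq_completeTheory (hα : ∀ i, 0 < α i) (hγ : ∀ i, 0 < γ i ∧ γ i ≤ 1)
    (hind : LinearIndependent ℚ (Fin.cons 1 α : Fin (p + 1) → ℝ)) {M : Type}
    [(lang k).Structure M] (hM : Semigeneric k α M) :
    almostSureTheory k α γ = (lang k).completeTheory M := by
  have h1 : ∀ φ : (lang k).Sentence, M ⊨ φ → φ ∈ almostSureTheory k α γ := by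
    intro φ hφ
    refine mem_of_models hα hγ (Theory.models_sentence_iff.2 fun N => ?_)
    exact (hM.realize_sentence_iff hα (semigeneric_of_model hα hγ hind N N.is_model) φ).1 hφ
  ext φ
  rw [mem_completeTheory]
  refine ⟨fun hφ => ?_, h1 φ⟩
  by_contra hcon
  have h2 : Filter.Tendsto (fun n => prob α γ n (Formula.not φ)) Filter.atTop (nhds 1) :=
    h1 _ ((Sentence.realize_not M).2 hcon)
  have h3 := Filter.Tendsto.add hφ h2
  simp only [prob_add_prob_not] at h3
  have h4 := tendsto_nhds_unique h3 tendsto_const_nhds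
  norm_num at h4

theorem cardGe_mem (hα : ∀ i, 0 < α i) (hγ : ∀ i, 0 < γ i ∧ γ i ≤ 1) (m : ℕ) :
    Sentence.cardGe (lang k) m ∈ almostSureTheory k α γ := by
  refine mem_almostSureTheory_of_forall hα hγ m fun n hn ω => ?_
  rw [Sentence.realize_cardGe]
  have : Cardinal.mk (cfg k ω).Carrier = n := Cardinal.mk_fin n
  rw [this]
  exact_mod_cast hn

theorem infinite_of_cardGe {L : FirstOrder.Language.{0, 0}} {M : Type} [L.Structure M]
    (h : ∀ m, M ⊨ Sentence.cardGe L m) : Infinite M := by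
  rw [Cardinal.infinite_iff]
  exact Cardinal.aleph0_le.2 fun m => (Sentence.realize_cardGe L m).1 (h m)

/-- A theorem has positive probability at some positive `n`, hence holds in some structure of that
size. -/
theorem finiteModelProperty_almostSureTheory (hα : ∀ i, 0 < α i)
    (hγ : ∀ i, 0 < γ i ∧ γ i ≤ 1) : FiniteModelProperty (almostSureTheory k α γ) := by
  intro φ hφ
  have h1 : Filter.Tendsto (fun n => prob α γ n φ) Filter.atTop (nhds 1) := mem_of_models hα hγ hφ
  obtain ⟨n, hn, hn0⟩ := ((h1.eventually (lt_mem_nhds (zero_lt_one' ℝ))).and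
    (Filter.eventually_gt_atTop 0)).exists
  obtain ⟨ω, hω⟩ := exists_realize_of_prob_pos hn
  exact ⟨(cfg k ω).Carrier, inferInstance, ⟨(⟨0, hn0⟩ : Fin n)⟩, inferInstance, hω⟩

/-- The conjunction of a finite axiomatization would be a theorem; its finite model would satisfy
all consequences of `T`, including those that force infinitely many elements. -/
theorem not_finitelyAxiomatizable {L : FirstOrder.Language.{0, 0}} {T : L.Theory}
    (hT : FiniteModelProperty T) (hinf : ∀ m, Sentence.cardGe L m ∈ T) :
    ¬ FinitelyAxiomatizable T := by
  rintro ⟨S, hS, hST⟩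
  have : Finite S := hS
  let σ : L.Sentence := Formula.iInf fun ψ : S => ψ.1
  have hσ : ∀ (M : Type) [L.Structure M], M ⊨ σ ↔ M ⊨ S := by
    intro M _
    rw [Theory.model_iff]
    simp only [σ, Sentence.Realize, Formula.realize_iInf, Subtype.forall]
  have h1 : T ⊨ᵇ σ := (hST σ).1 (Theory.models_sentence_iff.2 fun M => (hσ M).2 M.is_model)
  obtain ⟨M, _, hne, hfin, hM⟩ := hT σ h1
  have hMS : M ⊨ S := (hσ M).1 hM
  have : Infinite M := infinite_of_cardGe fun m =>
    ((hST _).2 (Theory.models_sentence_of_mem (hinf m))).realize_sentence M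
  exact not_finite M

end AlmostSure

end SparseRandom

end

theorem mainTheorem1 {p : ℕ} (k : Fin p → ℕ) (α γ : Fin p → ℝ)
    (hα : ∀ i, 0 < α i ∧ α i ≤ 1) (hγ : ∀ i, 0 < γ i ∧ γ i ≤ 1)
    (hind : LinearIndependent ℚ (Fin.cons 1 α : Fin (p + 1) → ℝ)) :
    (∃ (M : Type) (_ : (SparseRandom.lang k).Structure M), SparseRandom.IsGeneric k α M) ∧
    (∀ (M : Type) [(SparseRandom.lang k).Structure M], SparseRandom.IsGeneric k α M →
      SparseRandom.almostSureTheory k α γ = (SparseRandom.lang k).completeTheory M) ∧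
    (SparseRandom.almostSureTheory k α γ).IsComplete ∧
    SparseRandom.IsStable (SparseRandom.almostSureTheory k α γ) ∧
    SparseRandom.NearlyModelComplete (SparseRandom.almostSureTheory k α γ) ∧
    SparseRandom.FiniteModelProperty (SparseRandom.almostSureTheory k α γ) ∧
    (∀ (M : Type) [(SparseRandom.lang k).Structure M],
      M ⊨ SparseRandom.almostSureTheory k α γ → Infinite M) ∧
    ¬ SparseRandom.FinitelyAxiomatizable (SparseRandom.almostSureTheory k α γ) := by
  have hα' : ∀ i, 0 < α i := fun i => (hα i).1
  have hsg : ∀ (M : Type) [(SparseRandom.lang k).Structure M],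
      M ⊨ SparseRandom.almostSureTheory k α γ → SparseRandom.Semigeneric k α M :=
    fun M _ hM => SparseRandom.semigeneric_of_model hα' hγ hind M hM
  have hinf : ∀ (M : Type) [(SparseRandom.lang k).Structure M],
      M ⊨ SparseRandom.almostSureTheory k α γ → Infinite M := fun M _ hM =>
    SparseRandom.infinite_of_cardGe fun m =>
      hM.realize_of_mem _ (SparseRandom.cardGe_mem hα' hγ m)
  have heq : ∀ (M : Type) [(SparseRandom.lang k).Structure M], SparseRandom.IsGeneric k α M →
      SparseRandom.almostSureTheory k α γ = (SparseRandom.lang k).completeTheory M := fun M _ hM =>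
    SparseRandom.almostSureTheory_eq_completeTheory hα' hγ hind (hM.semigeneric hα')
  refine ⟨SparseRandom.exists_isGeneric hα', heq, ?_,
    SparseRandom.isStable_of_semigeneric hα' hsg,
    SparseRandom.nearlyModelComplete_of_semigeneric hα' hsg,
    SparseRandom.finiteModelProperty_almostSureTheory hα' hγ, hinf,
    SparseRandom.not_finitelyAxiomatizable
      (SparseRandom.finiteModelProperty_almostSureTheory hα' hγ)
      (SparseRandom.cardGe_mem hα' hγ)⟩
  obtain ⟨M, _, hM⟩ := SparseRandom.exists_isGeneric (k := k) hα'
  have hMT := heq M hM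
  -- Infinitude supplies the nonemptiness needed for the theory of `M` to be complete.
  have : Infinite M := hinf M (by rw [hMT]; infer_instance)
  rw [hMT]
  exact completeTheory.isComplete (SparseRandom.lang k) M
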